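/- There are an absolute constant $d$ and a function $g$ with $g(\epsilon)=o(\epsilon^{-2.5})$ as $\epsilon\to 0^+$ such that the following holds for every $0<\epsilon<1$. Let $G$ be a finite plane multigraph with non-negative edge weights $w$. Let $P_1$ and $P_2$ be simple paths (possibly single vertices) that are subpaths of the boundary walk of the outer face of $G$, such that every common vertex of $P_1$ and $P_2$ is an end of both. Suppose that $P_1$ and $P_2$ are $\epsilon$-short: the distance along the path between any two of its vertices is at most $(1+\epsilon)$ times their distance in $G$. For a subgraph or multisubgraph $H$ of $G$, a joining vertex of $H$ with $P_1\cup P_2$ is a vertex of $P_1\cup P_2$ that is an endpoint of an edge of $H$ not belonging to $P_1\cup P_2$. Let $\mathcal F$ be a set of subtrees of $G$ that are pairwise non-crossing (they are pairwise edge-disjoint, parallel edges of $G$ counting as different edges, and at no common vertex do two edges of one tree alternate with two edges of another in the cyclic order around the vertex), such that the leaves of each tree are exactly its joining vertices with $P_1\cup P_2$, and each tree has leaves on both paths. Then there are a (possibly empty) finite multisubgraph $\widehat C$ of $G$, a finite set $\widehat{\mathcal F}$ of trees that are multisubgraphs of $G$, and a map $\phi:\mathcal F\to\widehat{\mathcal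 F}\cup\{\widehat C\}$ with the following properties. (Multisubgraphs of $G$ may use several copies of an edge of $G$; different copies are different edges, each of the weight of the original edge, and copies of edges of $P_1\cup P_2$ count as edges of $P_1\cup P_2$.) 1. For every $T\in\mathcal F$, $\phi(T)$ spans the leaves of $T$, that is, $\phi(T)$ is connected and contains all leaves of $T$. 2. For any two different trees $T_1,T_2\in\mathcal F$, if $\phi(T_i)\ne\widehat C$ for at least one $i\in\{1,2\}$, then $\phi(T_1)$ and $\phi(T_2)$ are edge-disjoint (taking edge multiplicities into account). 3. The subgraph $\bigcup\widehat{\mathcal F}\cup\widehat C$ has at most $g(\epsilon)$ joining vertices with $P_1\cup P_2$. 4. $w(\widehat C)+w(\widehat{\mathcal F})\le 6\,w(P_2)+(1+d\epsilon)\,w(\mathcal F)$, where the weight of a set of trees is the sum of the weights of the trees. 5. Any two vertices of $\widehat C\cap(P_1\cup P_2)$ are three-edge-connected in $\widehat C$, that is, joined by three pairwise edge-disjoint paths in $\widehat C$. 6. For any three pairs $(x_i,y_i)$, $i=1,2,3$, of vertices of $\widehat C\cap(P_1\cup P_2)$ (vertices may be repeated), $\widehat C$ contains three pairwise edge-disjoint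 paths, the $i$-th one joining $x_i$ to $y_i$. -/

import Mathlib

universe u v

open scoped Graph

/-! ### Walks, trees and weights in multigraphs (`Graph α β`: vertices `α`, edges `β`) -/

namespace BrickForest

/-- Walks in a multigraph; the edges used are part of the data. -/
inductive Walk {α : Type u} {β : Type v} (H : Graph α β) : α → α → Type (max u v)
  | nil (x : α) (hx : x ∈ V(H)) : Walk H x x
  | cons {x y z : α} (e : β) (h : H.IsLink e x y) (p : Walk H y z) : Walk H x z

namespace Walk

variable {α : Type u} {β : Type v} {H : Graph α β}

/-- The list of vertices visited by a walk, in order. -/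
def support : {x y : α} → Walk H x y → List α
  | _, _, nil x _ => [x]
  | x, _, cons _ _ p => x :: p.support

/-- The list of edges traversed by a walk, in order. -/
def edges : {x y : α} → Walk H x y → List β
  | _, _, nil _ _ => []
  | _, _, cons e _ p => e :: p.edges

/-- A path is a walk without repeated vertices. -/
def IsPath {x y : α} (p : Walk H x y) : Prop := p.support.Nodup

/-- A cycle is a nonempty closed walk that repeats neither an edge nor a vertex (other than the
base point). Loops and pairs of parallel edges are cycles. -/
def IsCycle {x : α} (p : Walk H x x) : Prop :=
  p.edges ≠ [] ∧ p.edges.Nodup ∧ p.support.tail.Nodup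

/-- The weight of a walk. -/
def weight (w : β → ℝ) {x y : α} (p : Walk H x y) : ℝ := (p.edges.map w).sum

end Walk

section Multigraph

variable {α : Type u} {β : Type v}

/-- A multigraph is connected if it is nonempty and any two vertices are joined by a walk. -/
def IsConnected (H : Graph α β) : Prop :=
  V(H).Nonempty ∧ ∀ x ∈ V(H), ∀ y ∈ V(H), Nonempty (Walk H x y)

/-- A tree is a connected multigraph without cycles. -/
def IsTree (H : Graph α β) : Prop :=
  IsConnected H ∧ ∀ (x : α) (p : Walk H x x), ¬ p.IsCycle

/-- The leaves of a tree: the vertices with exactly one incident edge. -/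
def leaves (T : Graph α β) : Set α := {x | x ∈ V(T) ∧ ∃! e, T.Inc e x}

/-- `H` spans the vertex set `S`: it is connected and contains `S`. -/
def Spans (H : Graph α β) (S : Set α) : Prop := IsConnected H ∧ S ⊆ V(H)

/-- The total weight of the edges of `H` (meaningful when `H` has finitely many edges). -/
noncomputable def weight (w : β → ℝ) (H : Graph α β) : ℝ := ∑ᶠ e ∈ E(H), w e

/-- The distance between two vertices: the least weight of a walk between them. -/
noncomputable def wdist (w : β → ℝ) (H : Graph α β) (x y : α) : ℝ :=
  sInf {r | ∃ p : Walk H x y, r = p.weight w}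

/-- The joining vertices of `H` with a path (or a union of paths) whose vertex set is `PV` and
whose edge set is `PE`: the vertices of the path that are endpoints of an edge of `H` that is not
an edge of the path. -/
def joiningVertices (H : Graph α β) (PV : Set α) (PE : Set β) : Set α :=
  {x | x ∈ PV ∧ ∃ e, e ∉ PE ∧ H.Inc e x}

/-- `H` contains three pairwise edge-disjoint paths, the `i`-th one from `x i` to `y i`. -/
def HasThreeEdgeDisjointPaths (H : Graph α β) (x y : Fin 3 → α) : Prop :=
  ∃ p : ∀ i, Walk H (x i) (y i), (∀ i, (p i).IsPath) ∧
    ∀ i j, i ≠ j → List.Disjoint (p i).edges (p j).edges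

/-- `x` and `y` are three-edge-connected in `H`. -/
def ThreeEdgeConnected (H : Graph α β) (x y : α) : Prop :=
  HasThreeEdgeDisjointPaths H (fun _ => x) (fun _ => y)

/-- The multigraph in which every edge `e` of `H` is replaced by parallel copies
`(e, 0), (e, 1), …`. The subgraphs of `copies H` are the multisubgraphs of `H`. -/
def copies (H : Graph α β) : Graph α (β × ℕ) where
  vertexSet := V(H)
  IsLink e x y := H.IsLink e.1 x y
  isLink_symm := fun _ _ => ⟨fun _ _ h => h.symm⟩
  eq_or_eq_of_isLink_of_isLink := fun _ _ _ _ _ h h' => H.eq_or_eq_of_isLink_of_isLink h h'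
  left_mem_of_isLink := fun _ _ _ h => H.left_mem_of_isLink h

end Multigraph

/-! ### Plane multigraphs

A plane multigraph is given by its rotation system. The edge `e` consists of the two darts
`(e, false)` and `(e, true)`, which are its two orientations. -/

/-- The reversal of darts. -/
def rev (E : Type v) : Equiv.Perm (E × Bool) := Equiv.prodCongr (Equiv.refl E) Equiv.boolNot

/-- A plane multigraph: `src d` is the initial vertex of the dart `d`, and `rot` sends a dart to
the next one in the cyclic order around its initial vertex. The faces are the orbits of
`d ↦ rot (rev d)`, and the embedding is planar: Euler's formula
`#vertices + #faces = #edges + 2 #components` holds, isolated vertices being disregarded. -/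
structure PlaneGraph (V : Type u) (E : Type v) where
  src : E × Bool → V
  rot : Equiv.Perm (E × Bool)
  rot_sameCycle : ∀ d d' : E × Bool, rot.SameCycle d d' ↔ src d = src d'
  euler :
    Nat.card (Quotient (Equiv.Perm.SameCycle.setoid rot)) +
      Nat.card (Quotient (Equiv.Perm.SameCycle.setoid (rot * rev E))) =
    Nat.card E +
      2 * Nat.card (Quotient
        (Equiv.Perm.SameCycle.setoid rot ⊔ Equiv.Perm.SameCycle.setoid (rev E)))

namespace PlaneGraph

variable {V : Type u} {E : Type v}

/-- The face permutation: the successor of a dart on the boundary walk of its face. -/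
def face (G : PlaneGraph V E) : Equiv.Perm (E × Bool) := G.rot * rev E

/-- The underlying multigraph. -/
def toGraph (G : PlaneGraph V E) : Graph V E where
  vertexSet := Set.univ
  IsLink e x y := ∃ b : Bool, G.src (e, b) = x ∧ G.src (e, !b) = y
  isLink_symm := fun _ _ => ⟨fun _ _ ⟨b, h, h'⟩ => ⟨!b, h', by simpa using h⟩⟩
  eq_or_eq_of_isLink_of_isLink := by
    rintro e x y v w ⟨b, rfl, rfl⟩ ⟨b', rfl, rfl⟩
    cases b <;> cases b' <;> simp
  left_mem_of_isLink := fun _ _ _ _ => Set.mem_univ _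

/-- The darts `a`, `b`, `c`, `d` are distinct, leave the same vertex, and appear around it in this
cyclic order. -/
def CyclicOrder (G : PlaneGraph V E) (a b c d : E × Bool) : Prop :=
  ∃ i j k : ℕ, 0 < i ∧ i < j ∧ j < k ∧ (∀ m, 0 < m → m ≤ k → (G.rot ^ m) a ≠ a) ∧
    (G.rot ^ i) a = b ∧ (G.rot ^ j) a = c ∧ (G.rot ^ k) a = d

/-- Two subgraphs are non-crossing if they have no edge in common and there is no vertex at which
two edges of the one are separated, in the cyclic order, by two edges of the other (so that
no path of the one crosses a path of the other). They may have vertices in common. -/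
def NonCrossing (G : PlaneGraph V E) (T T' : Graph V E) : Prop :=
  Disjoint E(T) E(T') ∧
    ¬ ∃ a b c d : E × Bool, a.1 ∈ E(T) ∧ b.1 ∈ E(T') ∧ c.1 ∈ E(T) ∧ d.1 ∈ E(T') ∧
      G.CyclicOrder a b c d

/-- A (simple, possibly one-vertex) path that is a subpath of the boundary walk of the face of
the dart `o`: it consists of `length` consecutive darts of that walk, the first one being
`start`. If `length = 0`, the path is the initial vertex of `start`. -/
structure BoundaryPath (G : PlaneGraph V E) (o : E × Bool) where
  start : E × Bool
  length : ℕ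
  start_mem : G.face.SameCycle o start
  injOn : Set.InjOn (fun i : ℕ => G.src ((G.face ^ i) start)) (Set.Iic length)

namespace BoundaryPath

variable {G : PlaneGraph V E} {o : E × Bool}

/-- The `i`-th vertex of the path, for `0 ≤ i ≤ length`. -/
def vertex (P : BoundaryPath G o) (i : ℕ) : V := G.src ((G.face ^ i) P.start)

/-- The `i`-th edge of the path, from vertex `i` to vertex `i + 1`, for `0 ≤ i < length`. -/
def edge (P : BoundaryPath G o) (i : ℕ) : E := ((G.face ^ i) P.start).1

/-- The set of vertices of the path. -/
def verts (P : BoundaryPath G o) : Set V := P.vertex '' Set.Iic P.length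

/-- The set of edges of the path. -/
def edgs (P : BoundaryPath G o) : Set E := P.edge '' Set.Iio P.length

/-- The two ends of the path. -/
def ends (P : BoundaryPath G o) : Set V := {P.vertex 0, P.vertex P.length}

/-- The distance along the path from its `i`-th to its `j`-th vertex, for `i ≤ j`. -/
def distAlong (P : BoundaryPath G o) (w : E → ℝ) (i j : ℕ) : ℝ :=
  ∑ m ∈ Finset.Ico i j, w (P.edge m)

/-- The weight of the path. -/
def weight (P : BoundaryPath G o) (w : E → ℝ) : ℝ := P.distAlong w 0 P.length

/-- The path is `ε`-short: the distance along the path between any two of its vertices is at most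
`1 + ε` times their distance in the graph. -/
def IsShort (P : BoundaryPath G o) (w : E → ℝ) (ε : ℝ) : Prop :=
  ∀ i j : ℕ, i ≤ j → j ≤ P.length →
    P.distAlong w i j ≤ (1 + ε) * wdist w G.toGraph (P.vertex i) (P.vertex j)

end BoundaryPath

end PlaneGraph

end BrickForest

/-! The bound obtained is `24 * ε ^ (-2)`: only `O(1/ε)` trees stay outside the common part, and
each of them is given `O(1/ε)` joining vertices.

Common part. With `m = ⌈1/ε⌉` (and at least `m` trees), among the `m` trees that reach furthest
towards the start of `P₁` there is a tree `Ta` of weight at most `ε w(F)`, and among the `m`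
reaching furthest towards its end there is such a tree `Tb`. Let `l` be the first position of `Ta`
and `r` the last position of `Tb` on `P₁`. If `l ≤ r`, all but at most `4/ε` trees have their leaves
on `P₁[l,r]` or on `P₂`. They are all replaced by one graph `C`: a closed walk through `P₁[l,r]`, a
path of `Tb`, the path `P₂`, and a path of `Ta`, with every edge doubled. Three pairs of vertices
can be joined by arcs of a closed walk such that no step is used by all three, so two copies of each
edge suffice (`Walk.double_linked`). Since `P₁` is short, `P₁[l,r]` costs about as much as the
detour through `Ta`, `P₂` and `Tb`.

Remaining trees. A tree `T` with leaves on a short path is replaced by a part of it with at most `2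
^ k` leaves, together with intervals of the path, at total cost `(1 + 2ε) w(T)` as soon as `2 ^ k ≥
1/ε` (`RTree.exists_simplification`). At a branching, either the whole tree collapses to one
root-leaf path and one interval, or both branches are simplified with half of the leaves; the
cheaper choice at least halves the relative excess. A tree with leaves off each of the paths is
simplified on `P₁`, and the interval that it spans on `P₂` is added. These intervals are
edge-disjoint, as a tree with more than three leaves leaves no room for an overlap
(`IsBrickForest.hulls_disjoint`); trees with at most three such leaves are kept. So the intervals
cost at most `w(P₂)` in all.

Planarity enters only through `PlaneGraph.not_crosswise`, a discrete Jordan curve theorem: by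
Euler's formula every cycle modulo 2 is a sum of face boundaries, so a path between two corners of a
face, closed up through the face, separates the two arcs of the boundary walk. -/

namespace BrickForest

/-! ### Walks: concatenation, transport, extraction of paths -/

namespace Walk

variable {α : Type*} {β : Type*} {γ : Type*} {H : Graph α β}

theorem left_mem : ∀ {x y : α}, Walk H x y → x ∈ V(H)
  | _, _, nil _ hx => hx
  | _, _, cons _ h _ => h.left_mem

theorem right_mem : ∀ {x y : α}, Walk H x y → y ∈ V(H)
  | _, _, nil _ hx => hx
  | _, _, cons _ _ p => p.right_mem

/-- Concatenation of walks. -/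
def append : {x y z : α} → Walk H x y → Walk H y z → Walk H x z
  | _, _, _, nil _ _, q => q
  | _, _, _, cons e h p, q => cons e h (p.append q)

theorem edges_append : ∀ {x y z : α} (p : Walk H x y) (q : Walk H y z),
    (p.append q).edges = p.edges ++ q.edges
  | _, _, _, nil _ _, q => rfl
  | _, _, _, cons e h p, q => by simp [append, edges, edges_append p q]

/-- The reversed walk. -/
def reverse : {x y : α} → Walk H x y → Walk H y x
  | _, _, nil x hx => nil x hx
  | _, _, cons e h p => p.reverse.append (cons e h.symm (nil _ h.left_mem))

theorem edges_reverse : ∀ {x y : α} (p : Walk H x y), p.reverse.edges = p.edges.reverse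
  | _, _, nil _ _ => rfl
  | _, _, cons e h p => by simp [reverse, edges, edges_append, edges_reverse p]

theorem weight_append (w : β → ℝ) {x y z : α} (p : Walk H x y) (q : Walk H y z) :
    (p.append q).weight w = p.weight w + q.weight w := by
  simp [weight, edges_append]

theorem weight_reverse (w : β → ℝ) {x y : α} (p : Walk H x y) :
    p.reverse.weight w = p.weight w := by
  simp [weight, edges_reverse, List.sum_reverse]

theorem weight_nonneg {w : β → ℝ} (hw : ∀ e, 0 ≤ w e) {x y : α} (p : Walk H x y) :
    0 ≤ p.weight w := by
  apply List.sum_nonneg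
  simp only [List.mem_map]
  rintro _ ⟨e, _, rfl⟩
  exact hw e

theorem edges_subset : ∀ {x y : α} (p : Walk H x y) {e : β}, e ∈ p.edges → e ∈ E(H)
  | _, _, nil _ _, _, h => by simp [edges] at h
  | _, _, cons e h p, f, hf => by
    simp only [edges, List.mem_cons] at hf
    rcases hf with rfl | hf
    · exact h.edge_mem
    · exact edges_subset p hf

theorem start_mem_support : ∀ {x y : α} (p : Walk H x y), x ∈ p.support
  | _, _, nil _ _ => by simp [support]
  | _, _, cons _ _ _ => by simp [support]

theorem end_mem_support : ∀ {x y : α} (p : Walk H x y), y ∈ p.support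
  | _, _, nil _ _ => by simp [support]
  | _, _, cons _ _ p => by simp [support, end_mem_support p]

theorem support_subset : ∀ {x y : α} (p : Walk H x y) {z : α}, z ∈ p.support → z ∈ V(H)
  | _, _, nil _ hx, _, h => by simp [support] at h; exact h ▸ hx
  | _, _, cons e h p, f, hf => by
    simp only [support, List.mem_cons] at hf
    rcases hf with rfl | hf
    · exact h.left_mem
    · exact support_subset p hf

theorem mem_support_of_inc : ∀ {x y : α} (p : Walk H x y) {e : β} {z : α},
    e ∈ p.edges → H.Inc e z → z ∈ p.support
  | _, _, nil _ _, _, _, h, _ => by simp [edges] at h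
  | _, _, cons e h p, f, z, hf, hz => by
    simp only [edges, List.mem_cons] at hf
    simp only [support, List.mem_cons]
    rcases hf with rfl | hf
    · rcases hz.eq_or_eq_of_isLink h with rfl | rfl
      · exact Or.inl rfl
      · exact Or.inr p.start_mem_support
    · exact Or.inr (mem_support_of_inc p hf hz)

/-- Transport of a walk along a map of edges. -/
theorem exists_map {H' : Graph α γ} (f : β → γ) : ∀ {x y : α} (p : Walk H x y),
    x ∈ V(H') → (∀ e ∈ p.edges, ∀ a b, H.IsLink e a b → H'.IsLink (f e) a b) →
    ∃ q : Walk H' x y, q.edges = p.edges.map f ∧ q.support = p.support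
  | _, _, nil x _, hx, _ => ⟨nil x hx, rfl, rfl⟩
  | _, _, cons e h p, _, hl => by
    have he := hl e (by simp [edges]) _ _ h
    obtain ⟨q, hq, hq'⟩ := exists_map f p he.right_mem
      (fun e' he' => hl e' (by simp [edges, he']))
    exact ⟨cons _ he q, by simp [edges, hq], by simp [support, hq']⟩

theorem exists_mono {H' : Graph α β} (hle : H ≤ H') {x y : α} (p : Walk H x y) :
    ∃ q : Walk H' x y, q.edges = p.edges := by
  obtain ⟨q, hq, -⟩ := p.exists_map (H' := H') id (hle.vertexSet_mono p.left_mem)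
    (fun e _ a b h => h.mono hle)
  exact ⟨q, by simpa using hq⟩

theorem exists_suffix : ∀ {x y : α} (p : Walk H x y) {z : α}, z ∈ p.support →
    ∃ q : Walk H z y, q.support <:+ p.support ∧ q.edges <:+ p.edges
  | _, _, nil x hx, z, h => by
    simp only [support, List.mem_singleton] at h
    subst h
    exact ⟨nil _ hx, List.suffix_refl _, List.suffix_refl _⟩
  | _, _, cons e h p, z, hz => by
    simp only [support, List.mem_cons] at hz
    rcases hz with rfl | hz
    · exact ⟨cons e h p, List.suffix_refl _, List.suffix_refl _⟩
    · obtain ⟨q, h1, h2⟩ := exists_suffix p hz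
      exact ⟨q, h1.trans (List.suffix_cons _ _), h2.trans (List.suffix_cons _ _)⟩

theorem exists_path : ∀ {x y : α} (p : Walk H x y),
    ∃ q : Walk H x y, q.IsPath ∧ q.edges ⊆ p.edges
  | _, _, nil x hx => ⟨nil x hx, by simp [IsPath, support], fun _ h => h⟩
  | x, _, cons e h p => by
    obtain ⟨q, hq, hs⟩ := exists_path p
    by_cases hx : x ∈ q.support
    · obtain ⟨r, h1, h2⟩ := q.exists_suffix hx
      refine ⟨r, h1.sublist.nodup hq, ?_⟩
      intro f hf
      exact List.mem_cons_of_mem _ (hs (h2.subset hf))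
    · refine ⟨cons e h q, ?_, ?_⟩
      · simp only [IsPath, support, List.nodup_cons]
        exact ⟨hx, hq⟩
      · exact List.cons_subset_cons _ hs

theorem IsPath.edges_nodup : ∀ {x y : α} {p : Walk H x y}, p.IsPath → p.edges.Nodup
  | _, _, nil _ _, _ => by simp [edges]
  | _, _, cons e h p, hp => by
    simp only [IsPath, support, List.nodup_cons] at hp
    simp only [edges, List.nodup_cons]
    exact ⟨fun he => hp.1 (p.mem_support_of_inc he h.inc_left), edges_nodup (p := p) hp.2⟩

/-- An inner vertex of a trail is incident to two edges of the trail. -/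
theorem not_inc_of_subsingleton {v : α} (hv : ∀ e e', H.Inc e v → H.Inc e' v → e = e') :
    ∀ {x y : α} (p : Walk H x y), p.edges.Nodup → v ≠ x → v ≠ y →
      ∀ e ∈ p.edges, ¬ H.Inc e v
  | _, _, nil _ _, _, _, _ => by simp [edges]
  | _, _, cons e h p, hn, hx, hy => by
    simp only [edges, List.nodup_cons] at hn
    have key : ∀ f ∈ p.edges, ¬ H.Inc f v := by
      rename_i z
      by_cases hz : v = z
      · subst hz
        intro f hf hfv
        exact hn.1 (hv _ _ h.inc_right hfv ▸ hf)
      · exact not_inc_of_subsingleton hv p hn.2 hz hy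
    intro f hf hfv
    simp only [edges, List.mem_cons] at hf
    rcases hf with rfl | hf
    · have hvz := hfv.eq_of_isLink_of_ne_left h hx
      subst hvz
      cases p with
      | nil => exact hy rfl
      | cons e' h' p' =>
        refine hn.1 ?_
        rw [hv _ _ hfv h'.inc_left]
        simp [edges]
    · exact key f hf hfv

end Walk

section Weight

variable {α β : Type*}

theorem list_sum_le_weight {w : β → ℝ} (hw : ∀ e, 0 ≤ w e) {H : Graph α β} (hf : E(H).Finite)
    {L : List β} (hn : L.Nodup) (hL : ∀ e ∈ L, e ∈ E(H)) : (L.map w).sum ≤ weight w H := by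
  classical
  unfold weight
  rw [finsum_mem_eq_finite_toFinset_sum _ hf, ← List.sum_toFinset _ hn]
  apply Finset.sum_le_sum_of_subset_of_nonneg
  · intro e he
    simpa using hL e (by simpa using he)
  · intro e _ _
    exact hw e

theorem weight_nonneg {w : β → ℝ} (hw : ∀ e, 0 ≤ w e) (H : Graph α β) : 0 ≤ weight w H :=
  finsum_nonneg fun e => finsum_nonneg fun _ => hw e

end Weight

/-! ### Deleting edges; spanning trees -/

section Restrict

variable {α β : Type*}

/-- The spanning subgraph with edge set `E(H) ∩ X`. -/
def keepEdges (H : Graph α β) (X : Set β) : Graph α β where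
  vertexSet := V(H)
  IsLink e x y := e ∈ X ∧ H.IsLink e x y
  isLink_symm := fun _ _ => ⟨fun _ _ h => ⟨h.1, h.2.symm⟩⟩
  eq_or_eq_of_isLink_of_isLink := fun _ _ _ _ _ h h' =>
    H.eq_or_eq_of_isLink_of_isLink h.2 h'.2
  left_mem_of_isLink := fun _ _ _ h => h.2.left_mem

theorem keepEdges_le (H : Graph α β) (X : Set β) : keepEdges H X ≤ H :=
  ⟨subset_rfl, fun _ _ _ h => h.2⟩

theorem edgeSet_keepEdges (H : Graph α β) (X : Set β) : E(keepEdges H X) = X ∩ E(H) := by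
  ext e
  constructor
  · rintro ⟨x, y, h⟩
    exact ⟨h.1, h.2.edge_mem⟩
  · rintro ⟨h1, h2⟩
    obtain ⟨x, y, h⟩ := H.exists_isLink_of_mem_edgeSet h2
    exact ⟨x, y, h1, h⟩

/-- Deleting an edge whose ends remain joined keeps all connections. -/
theorem exists_walk_keepEdges_diff {H : Graph α β} {e : β} {x y : α} (h : H.IsLink e x y)
    (q : Walk H y x) (hq : e ∉ q.edges) {a b : α} (p : Walk H a b) :
    Nonempty (Walk (keepEdges H {e}ᶜ) a b) := by
  obtain ⟨r, -, -⟩ := q.exists_map (H' := keepEdges H {e}ᶜ) id q.left_mem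
    (fun f hf a b hl => ⟨fun hfe => hq ((Set.mem_singleton_iff.1 hfe) ▸ hf), hl⟩)
  induction p with
  | nil x hx => exact ⟨Walk.nil x hx⟩
  | @cons c d f g hl p ih =>
    obtain ⟨ih⟩ := ih
    by_cases hfe : g = e
    · subst hfe
      rcases hl.eq_and_eq_or_eq_and_eq h with ⟨rfl, rfl⟩ | ⟨rfl, rfl⟩
      · exact ⟨r.reverse.append ih⟩
      · exact ⟨r.append ih⟩
    · exact ⟨Walk.cons g ⟨hfe, hl⟩ ih⟩

/-- A connected multigraph with finitely many edges has a spanning tree. -/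
theorem exists_spanning_tree {H : Graph α β} (hf : E(H).Finite) (hc : IsConnected H) :
    ∃ T ≤ H, IsTree T ∧ V(T) = V(H) := by
  obtain ⟨n, hn⟩ : ∃ n, E(H).ncard = n := ⟨_, rfl⟩
  induction n using Nat.strong_induction_on generalizing H with
  | _ n ih =>
    by_cases ht : IsTree H
    · exact ⟨H, le_rfl, ht, rfl⟩
    · have : ∃ (x : α) (p : Walk H x x), p.IsCycle := by
        by_contra hcon
        push Not at hcon
        exact ht ⟨hc, hcon⟩
      obtain ⟨x, p, hp⟩ := this
      cases p with
      | nil => exact absurd rfl hp.1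
      | @cons _ y _ e h q =>
        have hn' := hp.2.1
        simp only [Walk.edges, List.nodup_cons] at hn'
        have hlt : E(keepEdges H {e}ᶜ) ⊂ E(H) := by
          rw [edgeSet_keepEdges]
          refine ⟨Set.inter_subset_right, fun hsub => ?_⟩
          exact (hsub h.edge_mem).1 rfl
        obtain ⟨T, hT, hT', hV⟩ := ih _ (hn ▸ Set.ncard_lt_ncard hlt hf)
          (hf.subset hlt.1) (H := keepEdges H {e}ᶜ)
          ⟨hc.1, fun a ha b hb => by
            obtain ⟨r⟩ := hc.2 a ha b hb
            exact exists_walk_keepEdges_diff h q hn'.1 r⟩ rfl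
        exact ⟨T, hT.trans (keepEdges_le _ _), hT', hV⟩

end Restrict

end BrickForest

/-! ### Homology modulo 2 of a plane multigraph -/

namespace BrickForest

section Homology

variable {E : Type*}

theorem rel_of_sameCycle {D : Type*} {f : Equiv.Perm D} {r : Setoid D} (h : ∀ d, r d (f d))
    {x y : D} (hxy : f.SameCycle x y) : r x y := by
  obtain ⟨i, rfl⟩ := hxy
  induction i using Int.induction_on with
  | zero => exact r.refl' _
  | succ i ih =>
    refine r.trans' ih ?_
    rw [add_comm, zpow_add, zpow_one]
    exact h _
  | pred i ih =>
    refine r.trans' ih (r.symm' ?_)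
    have := h ((f ^ (-(i : ℤ) - 1)) x)
    rwa [← Equiv.Perm.mul_apply, ← zpow_one_add, add_sub_cancel] at this

/-- Modulo `rev`, each of `rot` and `rot * rev E` generates the other. Hence vertices and faces
yield the same components, and the same number of components enters both rank computations below. -/
theorem setoid_face_sup (rot : Equiv.Perm (E × Bool)) :
    Equiv.Perm.SameCycle.setoid (rot * rev E) ⊔ Equiv.Perm.SameCycle.setoid (rev E) =
      Equiv.Perm.SameCycle.setoid rot ⊔ Equiv.Perm.SameCycle.setoid (rev E) := by
  have hrr : ∀ d, rev E (rev E d) = d := by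
    rintro ⟨e, b⟩
    simp [rev]
  apply le_antisymm
  · refine sup_le (fun x y hxy => rel_of_sameCycle (f := rot * rev E) (fun d => ?_) hxy)
      le_sup_right
    refine Setoid.trans' _ (y := rev E d) ?_ ?_
    · exact (le_sup_right : Equiv.Perm.SameCycle.setoid (rev E) ≤ _) ⟨1, by simp⟩
    · exact (le_sup_left : Equiv.Perm.SameCycle.setoid rot ≤ _) ⟨1, by simp⟩
  · refine sup_le (fun x y hxy => rel_of_sameCycle (f := rot) (fun d => ?_) hxy) le_sup_right
    refine Setoid.trans' _ (y := rev E d) ?_ ?_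
    · exact (le_sup_right : Equiv.Perm.SameCycle.setoid (rev E) ≤ _) ⟨1, by simp⟩
    · exact (le_sup_left : Equiv.Perm.SameCycle.setoid (rot * rev E) ≤ _)
        ⟨1, by simp [hrr]⟩

/-- The coboundary of a function on classes of darts: on the edge `e`, the sum of its values
on the two darts of `e`. -/
def coboundary (r : Setoid (E × Bool)) : (Quotient r → ZMod 2) →ₗ[ZMod 2] (E → ZMod 2) where
  toFun g e := g ⟦(e, false)⟧ + g ⟦(e, true)⟧
  map_add' g h := by
    ext e
    simp only [Pi.add_apply]
    ring
  map_smul' c g := by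
    ext e
    simp only [Pi.smul_apply, smul_eq_mul, RingHom.id_apply]
    ring

theorem zmod_two_eq_of_add_eq_zero {a b : ZMod 2} (h : a + b = 0) : a = b := by
  revert a b
  decide

theorem zmod_two_add_self (a : ZMod 2) : a + a = 0 := by
  revert a
  decide

/-- Rank-nullity: over `ZMod 2` a function has zero coboundary exactly when it is constant on the
classes of `r ⊔ rev`. The lemma is applied to the vertex classes and to the face classes. -/
theorem finrank_range_coboundary [Finite E] (r : Setoid (E × Bool)) :
    Module.finrank (ZMod 2) (LinearMap.range (coboundary r)) +
      Nat.card (Quotient (r ⊔ Equiv.Perm.SameCycle.setoid (rev E))) = Nat.card (Quotient r) := by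
  classical
  have := Fintype.ofFinite E
  set R := r ⊔ Equiv.Perm.SameCycle.setoid (rev E) with hR
  have hle : r ≤ R := le_sup_left
  let q : Quotient r → Quotient R := Quotient.map id (fun a b h => hle h)
  have hq : Function.Surjective q := by
    intro x
    obtain ⟨d, rfl⟩ := Quotient.exists_rep x
    exact ⟨⟦d⟧, rfl⟩
  have hker : LinearMap.ker (coboundary r) =
      LinearMap.range (LinearMap.funLeft (ZMod 2) (ZMod 2) q) := by
    ext g
    rw [LinearMap.mem_ker, LinearMap.mem_range]
    constructor
    · intro hg
      have hg' : ∀ e, g ⟦(e, false)⟧ = g ⟦(e, true)⟧ := fun e =>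
        zmod_two_eq_of_add_eq_zero (congrFun hg e)
      have hS : R ≤ Setoid.ker (fun d : E × Bool => g ⟦d⟧) := by
        refine sup_le (fun a b hab => ?_) (fun a b hab => ?_)
        · exact congrArg g (Quotient.sound hab)
        · refine rel_of_sameCycle (fun d => ?_) hab
          obtain ⟨e, b⟩ := d
          cases b
          · exact hg' e
          · exact (hg' e).symm
      refine ⟨Quotient.lift (fun d : E × Bool => g ⟦d⟧) (fun a b h => hS h), ?_⟩
      ext x
      obtain ⟨d, rfl⟩ := Quotient.exists_rep x
      rfl
    · rintro ⟨g, rfl⟩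
      ext e
      have : (⟦(e, false)⟧ : Quotient R) = ⟦(e, true)⟧ :=
        Quotient.sound ((le_sup_right : Equiv.Perm.SameCycle.setoid (rev E) ≤ R)
          ⟨1, by simp [rev]⟩)
      change g ⟦(e, false)⟧ + g ⟦(e, true)⟧ = 0
      rw [this, zmod_two_add_self]
  have h1 := LinearMap.finrank_range_add_finrank_ker (coboundary r)
  rw [hker, LinearMap.finrank_range_of_inj (LinearMap.funLeft_injective_of_surjective _ _ _ hq),
    Module.finrank_fintype_fun_eq_card, Module.finrank_fintype_fun_eq_card] at h1
  rw [Nat.card_eq_fintype_card, Nat.card_eq_fintype_card]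
  exact h1

/-- In a plane multigraph every cycle modulo 2 is a boundary. -/
theorem PlaneGraph.exists_face_coloring {V : Type*} [Fintype E]
    (G : PlaneGraph V E) (z : E → ZMod 2)
    (hz : ∀ g : V → ZMod 2, ∑ d : E × Bool, z d.1 * g (G.src d) = 0) :
    ∃ s : E × Bool → ZMod 2, (∀ d, s (G.face d) = s d) ∧ ∀ d, s (rev E d) = s d + z d.1 := by
  classical
  let rv := Equiv.Perm.SameCycle.setoid G.rot
  let rf := Equiv.Perm.SameCycle.setoid (G.rot * rev E)
  have hv := finrank_range_coboundary rv
  have hf := finrank_range_coboundary rf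
  have heul : Nat.card (Quotient rv) + Nat.card (Quotient rf) = Nat.card E +
      2 * Nat.card (Quotient (rv ⊔ Equiv.Perm.SameCycle.setoid (rev E))) := G.euler
  have hsup := setoid_face_sup G.rot
  rw [show rf ⊔ Equiv.Perm.SameCycle.setoid (rev E) =
    rv ⊔ Equiv.Perm.SameCycle.setoid (rev E) from hsup] at hf
  -- `A` is the cycle space and `B` the space of sums of face boundaries, both viewed in the dual of
  -- the edge space.
  let A := (LinearMap.range (coboundary rv)).dualAnnihilator
  let B := (LinearMap.range (coboundary rf)).map
    (dotProductEquiv (ZMod 2) E).toLinearMap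
  have hBA : B ≤ A := by
    rintro _ ⟨_, ⟨s, rfl⟩, rfl⟩
    rw [Submodule.mem_dualAnnihilator]
    rintro _ ⟨g, rfl⟩
    change (coboundary rf s) ⬝ᵥ (coboundary rv g) = 0
    have e1 : (coboundary rf s) ⬝ᵥ (coboundary rv g) =
        (∑ d : E × Bool, s ⟦d⟧ * g ⟦d⟧) + ∑ d : E × Bool, s ⟦d⟧ * g ⟦rev E d⟧ := by
      rw [Fintype.sum_prod_type, Fintype.sum_prod_type, ← Finset.sum_add_distrib]
      refine Finset.sum_congr rfl fun e _ => ?_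
      simp only [coboundary, LinearMap.coe_mk, AddHom.coe_mk, Fintype.sum_bool, rev,
        Equiv.prodCongr_apply, Equiv.coe_refl, Prod.map_apply, id, Equiv.boolNot_apply,
        Bool.not_true, Bool.not_false]
      ring
    -- Reindexing by the face permutation: `s` does not change along a face, and `rot` does not
    -- change the vertex seen by `g`.
    have e2 : ∑ d : E × Bool, s ⟦d⟧ * g ⟦rev E d⟧ = ∑ d : E × Bool, s ⟦d⟧ * g ⟦d⟧ := by
      rw [← Equiv.sum_comp (G.rot * rev E) (fun d => s ⟦d⟧ * g ⟦d⟧)]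
      refine Finset.sum_congr rfl fun d _ => ?_
      congr 2
      · exact Quotient.sound ⟨1, by simp⟩
      · exact Quotient.sound ⟨1, by simp⟩
    rw [e1, e2, zmod_two_add_self]
  -- With `c` components, `dim A = #E - #V + c` and `dim B = #F - c`; Euler's formula says that
  -- these agree.
  have hdim : Module.finrank (ZMod 2) A ≤ Module.finrank (ZMod 2) B := by
    have h1 := Subspace.finrank_add_finrank_dualAnnihilator_eq (LinearMap.range (coboundary rv))
    have h2 := LinearEquiv.finrank_map_eq (dotProductEquiv (ZMod 2) E)
      (LinearMap.range (coboundary rf))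
    rw [Module.finrank_fintype_fun_eq_card, ← Nat.card_eq_fintype_card] at h1
    change _ + Module.finrank (ZMod 2) A = _ at h1
    change Module.finrank (ZMod 2) B = _ at h2
    omega
  have hAB : B = A := Submodule.eq_of_le_of_finrank_le hBA hdim
  have hzA : dotProductEquiv (ZMod 2) E z ∈ A := by
    rw [Submodule.mem_dualAnnihilator]
    rintro _ ⟨g, rfl⟩
    change z ⬝ᵥ (coboundary rv g) = 0
    obtain ⟨g', hg'⟩ : ∃ g' : V → ZMod 2, ∀ d, g' (G.src d) = g ⟦d⟧ := by
      have : Function.FactorsThrough (fun d : E × Bool => g ⟦d⟧) G.src := fun a b hab =>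
        congrArg g (Quotient.sound ((G.rot_sameCycle a b).2 hab))
      exact ⟨Function.extend G.src (fun d : E × Bool => g ⟦d⟧) 0, fun d =>
        this.extend_apply _ d⟩
    rw [← hz g', Fintype.sum_prod_type]
    refine Finset.sum_congr rfl fun e _ => ?_
    simp only [coboundary, LinearMap.coe_mk, AddHom.coe_mk, Fintype.sum_bool, hg']
    ring
  rw [← hAB] at hzA
  obtain ⟨_, ⟨s, rfl⟩, hs⟩ := hzA
  have hs' : coboundary rf s = z := (dotProductEquiv (ZMod 2) E).injective hs
  refine ⟨fun d => s ⟦d⟧, fun d => ?_, fun d => ?_⟩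
  · exact congrArg s (Quotient.sound ⟨-1, by simp [PlaneGraph.face]⟩)
  · obtain ⟨e, b⟩ := d
    have h := congrFun hs' e
    simp only [coboundary, LinearMap.coe_mk, AddHom.coe_mk] at h
    rw [← h]
    cases b
    · change s ⟦(e, true)⟧ = s ⟦(e, false)⟧ + (s ⟦(e, false)⟧ + s ⟦(e, true)⟧)
      rw [← add_assoc, zmod_two_add_self, zero_add]
    · change s ⟦(e, false)⟧ = s ⟦(e, true)⟧ + (s ⟦(e, false)⟧ + s ⟦(e, true)⟧)
      rw [add_comm (s ⟦(e, false)⟧), ← add_assoc, zmod_two_add_self, zero_add]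

end Homology

end BrickForest

/-! ### Orbits of permutations, and a discrete Jordan curve theorem -/

namespace BrickForest

section Period

variable {D : Type*}

theorem pow_minimalPeriod_apply (f : Equiv.Perm D) (x : D) :
    (f ^ Function.minimalPeriod f x) x = x := by
  rw [← Equiv.Perm.iterate_eq_pow]
  exact Function.iterate_minimalPeriod

theorem pow_apply_ne_of_lt_minimalPeriod (f : Equiv.Perm D) (x : D) {q : ℕ} (h0 : 0 < q)
    (hq : q < Function.minimalPeriod f x) : (f ^ q) x ≠ x := by
  rw [← Equiv.Perm.iterate_eq_pow]
  exact fun h => Function.not_isPeriodicPt_of_pos_of_lt_minimalPeriod h0.ne' hq h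

theorem minimalPeriod_perm_pos [Finite D] (f : Equiv.Perm D) (x : D) :
    0 < Function.minimalPeriod f x := by
  refine Function.IsPeriodicPt.minimalPeriod_pos (orderOf_pos f) ?_
  change (f^[orderOf f]) x = x
  rw [Equiv.Perm.iterate_eq_pow, pow_orderOf_eq_one]
  rfl

theorem exists_pow_lt_minimalPeriod [Finite D] {f : Equiv.Perm D} {x y : D}
    (h : f.SameCycle x y) : ∃ m < Function.minimalPeriod f x, (f ^ m) x = y := by
  obtain ⟨i, -, hi⟩ := h.exists_pow_eq'
  refine ⟨i % Function.minimalPeriod f x, Nat.mod_lt _ (minimalPeriod_perm_pos f x), ?_⟩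
  rw [← Equiv.Perm.iterate_eq_pow, Function.iterate_mod_minimalPeriod_eq,
    Equiv.Perm.iterate_eq_pow, hi]

theorem pow_apply_ne_pow_apply (f : Equiv.Perm D) (x : D) {i j : ℕ} (hij : i < j)
    (hj : j < i + Function.minimalPeriod f x) : (f ^ i) x ≠ (f ^ j) x := by
  intro h
  obtain ⟨k, rfl⟩ := Nat.exists_eq_add_of_lt hij
  rw [show i + k + 1 = i + (k + 1) by ring, pow_add, Equiv.Perm.mul_apply] at h
  exact pow_apply_ne_of_lt_minimalPeriod f x (Nat.succ_pos k) (by omega)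
    ((f ^ i).injective h).symm

end Period

namespace PlaneGraph

variable {V : Type*} {E : Type*} (G : PlaneGraph V E)

theorem rev_rev (d : E × Bool) : rev E (rev E d) = d := by
  obtain ⟨e, b⟩ := d
  simp [rev]

theorem src_rot (d : E × Bool) : G.src (G.rot d) = G.src d :=
  ((G.rot_sameCycle _ _).1 ⟨1, by simp⟩).symm

theorem src_face (d : E × Bool) : G.src (G.face d) = G.src (rev E d) := G.src_rot _

theorem face_pow_succ (i : ℕ) (d : E × Bool) :
    (G.face ^ (i + 1)) d = G.face ((G.face ^ i) d) := by
  rw [pow_succ', Equiv.Perm.mul_apply]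

theorem isLink_dart (d : E × Bool) : G.toGraph.IsLink d.1 (G.src d) (G.src (rev E d)) :=
  ⟨d.2, rfl, rfl⟩

theorem exists_dart {e : E} {x y : V} (h : G.toGraph.IsLink e x y) :
    ∃ d : E × Bool, d.1 = e ∧ G.src d = x ∧ G.src (rev E d) = y := by
  obtain ⟨b, h1, h2⟩ := h
  exact ⟨(e, b), rfl, h1, h2⟩

theorem inc_of_src {T : Graph V E} (hT : T ≤ G.toGraph) {d : E × Bool} (hd : d.1 ∈ E(T)) :
    T.Inc d.1 (G.src d) :=
  ⟨_, (hT.isLink_iff hd).2 (G.isLink_dart d)⟩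

/-- The boundary modulo 2 of a walk is the sum of its two ends, tested against an arbitrary function
`g` on the vertices. -/
theorem sum_count_mul_src [Fintype E] [DecidableEq E] {T : Graph V E} (hT : T ≤ G.toGraph)
    (g : V → ZMod 2) : ∀ {x y : V} (p : Walk T x y),
      ∑ d : E × Bool, (p.edges.count d.1 : ZMod 2) * g (G.src d) = g x + g y
  | _, _, Walk.nil x _ => by simp [Walk.edges, zmod_two_add_self]
  | x, y, @Walk.cons _ _ _ _ z _ e h p => by
    have ih := sum_count_mul_src hT g p
    have he : ∑ d : E × Bool, ((if e = d.1 then 1 else 0 : ℕ) : ZMod 2) * g (G.src d) =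
        g x + g z := by
      rw [Fintype.sum_prod_type, Finset.sum_eq_single e]
      · obtain ⟨b, rfl, rfl⟩ := h.mono hT
        cases b <;> simp [add_comm]
      · intro f _ hf
        simp [hf.symm]
      · simp
    have : ∀ d : E × Bool, ((Walk.cons e h p).edges.count d.1 : ZMod 2) =
        p.edges.count d.1 + ((if e = d.1 then 1 else 0 : ℕ) : ZMod 2) := by
      intro d
      simp only [Walk.edges, List.count_cons, beq_iff_eq]
      push_cast
      rfl
    simp only [this, add_mul, Finset.sum_add_distrib, ih, he]
    calc g z + g y + (g x + g z) = g x + g y + (g z + g z) := by ring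
      _ = g x + g y := by rw [zmod_two_add_self, add_zero]

/-- The vertices at positions `i₁ < i₂ < i₃ < i₄` of one turn of a facial walk cannot be joined
crosswise by two non-crossing subgraphs. -/
theorem not_crosswise [Finite E] {T T' : Graph V E} (hT : T ≤ G.toGraph) (hT' : T' ≤ G.toGraph)
    (hc' : IsConnected T') (hN : G.NonCrossing T T') {o : E × Bool} {i₁ i₂ i₃ i₄ : ℕ}
    (h12 : i₁ < i₂) (h23 : i₂ < i₃) (h34 : i₃ < i₄)
    (h41 : i₄ < i₁ + Function.minimalPeriod G.face o)
    (p : Walk T (G.src ((G.face ^ i₁) o)) (G.src ((G.face ^ i₃) o)))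
    (hp2 : ∀ e ∈ p.edges, ¬ T.Inc e (G.src ((G.face ^ i₂) o)))
    (hp4 : ∀ e ∈ p.edges, ¬ T.Inc e (G.src ((G.face ^ i₄) o)))
    (hb : G.src ((G.face ^ i₂) o) ∈ V(T')) (hd : G.src ((G.face ^ i₄) o) ∈ V(T'))
    (n21 : G.src ((G.face ^ i₂) o) ≠ G.src ((G.face ^ i₁) o))
    (n23 : G.src ((G.face ^ i₂) o) ≠ G.src ((G.face ^ i₃) o))
    (n41 : G.src ((G.face ^ i₄) o) ≠ G.src ((G.face ^ i₁) o))
    (n43 : G.src ((G.face ^ i₄) o) ≠ G.src ((G.face ^ i₃) o))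
    (hl1 : ∀ e e', T'.Inc e (G.src ((G.face ^ i₁) o)) → T'.Inc e' (G.src ((G.face ^ i₁) o)) →
      e = e')
    (hl3 : ∀ e e', T'.Inc e (G.src ((G.face ^ i₃) o)) → T'.Inc e' (G.src ((G.face ^ i₃) o)) →
      e = e') : False := by
  classical
  have := Fintype.ofFinite E
  let δ : ℕ → E × Bool := fun i => (G.face ^ i) o
  have hδs : ∀ i, G.face (δ i) = δ (i + 1) := fun i => (G.face_pow_succ i o).symm
  -- The arc of the facial walk from `i₁` to `i₃`. Together with `p` it forms a closed walk, hence a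
  -- cycle modulo 2; its face coloring `s` exists by Euler's formula.
  let I : Finset (E × Bool) := (Finset.Ico i₁ i₃).image δ
  have hinj : Set.InjOn δ (Finset.Ico i₁ i₃) := by
    intro i hi j hj hij
    simp only [Finset.coe_Ico, Set.mem_Ico] at hi hj
    rcases lt_trichotomy i j with h | h | h
    · exact absurd hij (pow_apply_ne_pow_apply _ _ h (by omega))
    · exact h
    · exact absurd hij.symm (pow_apply_ne_pow_apply _ _ h (by omega))
  let χ : E × Bool → ZMod 2 := fun d => if d ∈ I then 1 else 0
  let z : E → ZMod 2 := fun e => (p.edges.count e : ZMod 2)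
  have hzT : ∀ e, z e ≠ 0 → e ∈ p.edges := by
    intro e he
    by_contra hne
    exact he (by simp [z, List.count_eq_zero_of_not_mem hne])
  have hχsum : ∀ h : E × Bool → ZMod 2, ∑ d, χ d * h d = ∑ i ∈ Finset.Ico i₁ i₃, h (δ i) := by
    intro h
    simp only [χ, ite_mul, one_mul, zero_mul]
    rw [← Finset.sum_filter, Finset.filter_mem_eq_inter, Finset.univ_inter,
      Finset.sum_image hinj]
  obtain ⟨s, hsf, hsr⟩ := G.exists_face_coloring
    (fun e => z e + (χ (e, false) + χ (e, true))) (by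
      intro g
      have e1 : ∀ d : E × Bool, (z d.1 + (χ (d.1, false) + χ (d.1, true))) * g (G.src d) =
          z d.1 * g (G.src d) + (χ d * g (G.src d) + χ (rev E d) * g (G.src d)) := by
        rintro ⟨e, b⟩
        cases b
        · simp only [rev, Equiv.prodCongr_apply, Equiv.coe_refl, Prod.map_apply, id,
            Equiv.boolNot_apply, Bool.not_false]
          ring
        · simp only [rev, Equiv.prodCongr_apply, Equiv.coe_refl, Prod.map_apply, id,
            Equiv.boolNot_apply, Bool.not_true]
          ring
      have e2 : ∑ d, χ (rev E d) * g (G.src d) = ∑ d, χ d * g (G.src (rev E d)) := by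
        rw [← Equiv.sum_comp (rev E)]
        simp only [rev_rev]
      have e3 : ∀ m, i₁ ≤ m → ∑ i ∈ Finset.Ico i₁ m, (g (G.src (δ i)) + g (G.src (δ (i + 1)))) =
          g (G.src (δ i₁)) + g (G.src (δ m)) := by
        intro m hm
        induction m, hm using Nat.le_induction with
        | base => simp [zmod_two_add_self]
        | succ m hm ih =>
          rw [Finset.sum_Ico_succ_top hm, ih]
          calc _ = g (G.src (δ i₁)) + g (G.src (δ (m + 1))) +
                (g (G.src (δ m)) + g (G.src (δ m))) := by ring
            _ = _ := by rw [zmod_two_add_self, add_zero]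
      have e4 : ∀ i, g (G.src (rev E (δ i))) = g (G.src (δ (i + 1))) := fun i => by
        rw [← hδs, src_face]
      simp only [e1, Finset.sum_add_distrib, e2]
      rw [hχsum (fun d => g (G.src d)), hχsum (fun d => g (G.src (rev E d)))]
      simp only [e4]
      rw [← Finset.sum_add_distrib, e3 i₃ (by omega), G.sum_count_mul_src hT g p]
      exact zmod_two_add_self _)
  -- Switching the color on the arc amounts to cutting the face by a chord between the corners `i₁`
  -- and `i₃`. The new color changes only across edges of `p` and, within the face, at these two
  -- corners; it records the side of `p` plus chord.
  let s' : E × Bool → ZMod 2 := fun d => s d + χ d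
  have hrev : ∀ d, s' (rev E d) = s' d + z d.1 := by
    rintro ⟨e, b⟩
    simp only [s', hsr]
    cases b
    · change s (e, false) + (z e + (χ (e, false) + χ (e, true))) + χ (e, true) =
        s (e, false) + χ (e, false) + z e
      linear_combination zmod_two_add_self (χ (e, true))
    · change s (e, true) + (z e + (χ (e, false) + χ (e, true))) + χ (e, false) =
        s (e, true) + χ (e, true) + z e
      linear_combination zmod_two_add_self (χ (e, false))
  have hχface : ∀ f, G.src (G.face f) ≠ G.src (δ i₁) → G.src (G.face f) ≠ G.src (δ i₃) →
      χ (G.face f) = χ f := by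
    intro f ha hc
    have : G.face f ∈ I ↔ f ∈ I := by
      simp only [I, Finset.mem_image, Finset.mem_Ico]
      constructor
      · rintro ⟨i, hi, hif⟩
        rcases Nat.eq_or_lt_of_le hi.1 with h | h
        · subst h
          exact absurd (congrArg G.src hif.symm) ha
        · refine ⟨i - 1, by omega, G.face.injective ?_⟩
          rw [hδs, ← hif, Nat.sub_add_cancel (by omega)]
      · rintro ⟨i, hi, rfl⟩
        rw [hδs] at hc ⊢
        refine ⟨i + 1, ⟨by omega, ?_⟩, rfl⟩
        by_contra hlt
        exact hc (by rw [show i + 1 = i₃ by omega])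
    simp only [χ, this]
  have hrot : ∀ d, G.src d ≠ G.src (δ i₁) → G.src d ≠ G.src (δ i₃) →
      s' (G.rot d) = s' d + z d.1 := by
    intro d ha hc
    have hfd : G.face (rev E d) = G.rot d := by simp [face, rev_rev]
    have := hχface (rev E d) (by rwa [hfd, src_rot]) (by rwa [hfd, src_rot])
    rw [← hrev]
    simp only [s']
    rw [← hfd, hsf, this]
  have hrotpow : ∀ d, G.src d ≠ G.src (δ i₁) → G.src d ≠ G.src (δ i₃) → ∀ m n, m ≤ n →
      (∀ l, m ≤ l → l < n → ((G.rot ^ l) d).1 ∉ p.edges) →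
      s' ((G.rot ^ n) d) = s' ((G.rot ^ m) d) := by
    intro d ha hc m n hmn hl
    induction n, hmn using Nat.le_induction with
    | base => rfl
    | succ n hn ih =>
      have hsrc : ∀ n, G.src ((G.rot ^ n) d) = G.src d := fun n =>
        ((G.rot_sameCycle _ _).1 ⟨n, by simp⟩).symm
      rw [pow_succ', Equiv.Perm.mul_apply, hrot _ (by rwa [hsrc]) (by rwa [hsrc]),
        ih fun l h1 h2 => hl l h1 (by omega)]
      have : z ((G.rot ^ n) d).1 = 0 := by
        by_contra hne
        exact hl n hn (by omega) (hzT _ hne)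
      rw [this, add_zero]
  -- At a common vertex two darts of `T'` lie on the same side. At the ends of `p`, where rotation
  -- may change the color, `T'` has at most one edge, so the darts agree or are the two darts of a
  -- loop.
  have hsameT' : ∀ d d' : E × Bool, d.1 ∈ E(T') → d'.1 ∈ E(T') → G.src d = G.src d' →
      s' d = s' d' := by
    intro d d' hdT hdT' hdd
    have hz0 : z d.1 = 0 := by
      by_contra hne
      exact Set.disjoint_left.1 hN.1 (p.edges_subset (hzT _ hne)) hdT
    have hac : (∀ e e', T'.Inc e (G.src d) → T'.Inc e' (G.src d) → e = e') → s' d = s' d' := by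
      intro hu
      have hee := hu _ _ (G.inc_of_src hT' hdT) (hdd ▸ G.inc_of_src hT' hdT')
      by_cases hdd' : d = d'
      · rw [hdd']
      · have : d' = rev E d := by
          obtain ⟨e, b⟩ := d
          obtain ⟨e', b'⟩ := d'
          dsimp only at hee
          subst hee
          cases b <;> cases b' <;> first | exact absurd rfl hdd' | rfl
        rw [this, hrev, hz0, add_zero]
    by_cases ha : G.src d = G.src (δ i₁)
    · exact hac (by rw [ha]; exact hl1)
    by_cases hc : G.src d = G.src (δ i₃)
    · exact hac (by rw [hc]; exact hl3)
    obtain ⟨m, hm, hmd⟩ := exists_pow_lt_minimalPeriod ((G.rot_sameCycle d d').2 hdd)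
    set N := Function.minimalPeriod G.rot d with hNdef
    -- If `p` has a dart between `d` and `d'`, it has none between `d'` and `d`, since otherwise the
    -- four darts would alternate. The colors are then compared by rotating on from `d'` to `d`.
    by_cases hcase : ∃ l < m, ((G.rot ^ l) d).1 ∈ p.edges
    · obtain ⟨l, hlm, hl⟩ := hcase
      have hl0 : 0 < l := by
        rcases Nat.eq_zero_or_pos l with rfl | h
        · exact absurd hdT (Set.disjoint_left.1 hN.1 (p.edges_subset hl))
        · exact h
      have key := hrotpow d ha hc m N hm.le (by
        intro l' h1 h2 hl'
        have hml' : m < l' := by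
          rcases Nat.eq_or_lt_of_le h1 with h | h
          · subst h
            rw [hmd] at hl'
            exact absurd hdT' (Set.disjoint_left.1 hN.1 (p.edges_subset hl'))
          · exact h
        have hpow : ∀ a, ((G.rot ^ a) ((G.rot ^ l) d)) = (G.rot ^ (a + l)) d := fun a => by
          rw [pow_add, Equiv.Perm.mul_apply]
        refine hN.2 ⟨(G.rot ^ l) d, d', (G.rot ^ l') d, d, p.edges_subset hl, hdT',
          p.edges_subset hl', hdT, m - l, l' - l, N - l, by omega, by omega, by omega, ?_, ?_,
          ?_, ?_⟩
        · intro q hq0 hq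
          rw [hpow]
          exact (pow_apply_ne_pow_apply _ _ (by omega) (by omega)).symm
        · rw [hpow, Nat.sub_add_cancel (by omega), hmd]
        · rw [hpow, Nat.sub_add_cancel (by omega)]
        · rw [hpow, Nat.sub_add_cancel (by omega), hNdef, pow_minimalPeriod_apply])
      rw [← hmd, ← key, hNdef, pow_minimalPeriod_apply]
    · push Not at hcase
      have key := hrotpow d ha hc 0 m (Nat.zero_le _) fun l _ h2 => hcase l h2
      rw [← hmd, key]
      rfl
  -- The darts `δ i₂` and `δ i₄` need not belong to `T'`. But `p` has no edge at their vertices, so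
  -- there all darts have one color.
  have hsame : ∀ d d' : E × Bool, G.src d = G.src d' →
      (G.src d = G.src (δ i₂) ∨ G.src d = G.src (δ i₄) ∨ (d.1 ∈ E(T') ∧ d'.1 ∈ E(T'))) →
      s' d = s' d' := by
    intro d d' hdd h
    have hall : (∀ e ∈ p.edges, ¬ T.Inc e (G.src d)) → G.src d ≠ G.src (δ i₁) →
        G.src d ≠ G.src (δ i₃) → s' d = s' d' := by
      intro hp ha hc
      obtain ⟨m, hm, hmd⟩ := exists_pow_lt_minimalPeriod ((G.rot_sameCycle d d').2 hdd)
      have key := hrotpow d ha hc 0 m (Nat.zero_le _) fun l _ _ hl => hp _ hl (by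
        have := G.inc_of_src hT (p.edges_subset hl)
        rwa [show G.src ((G.rot ^ l) d) = G.src d from
          ((G.rot_sameCycle _ _).1 ⟨l, by simp⟩).symm] at this)
      rw [← hmd, key]
      rfl
    rcases h with h | h | h
    · exact hall (by rw [h]; exact hp2) (by rw [h]; exact n21) (by rw [h]; exact n23)
    · exact hall (by rw [h]; exact hp4) (by rw [h]; exact n41) (by rw [h]; exact n43)
    · exact hsameT' d d' h.1 h.2 hdd
  -- The color is constant along `T'`, which shares no edge with `p`. A walk from the vertex of `i₂`
  -- to that of `i₄` contradicts `i₂` being inside the arc and `i₄` outside.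
  have hwalk : ∀ {x y : V} (q : Walk T' x y) (f f' : E × Bool), G.src f = x → G.src f' = y →
      (f.1 ∈ E(T') ∨ x = G.src (δ i₂)) → y = G.src (δ i₄) → s' f = s' f' := by
    intro x y q
    induction q with
    | nil x hx =>
      intro f f' hf hf' h1 h2
      exact hsame f f' (hf.trans hf'.symm) (Or.inr (Or.inl (hf.trans h2)))
    | @cons x t y e h q ih =>
      intro f f' hf hf' h1 h2
      obtain ⟨d, rfl, hdx, hdz⟩ := G.exists_dart (h.mono hT')
      have hz0 : z d.1 = 0 := by
        by_contra hne
        exact Set.disjoint_left.1 hN.1 (p.edges_subset (hzT _ hne)) h.edge_mem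
      have e1 : s' f = s' d := by
        refine hsame f d (hf.trans hdx.symm) ?_
        rcases h1 with h1 | h1
        · exact Or.inr (Or.inr ⟨h1, h.edge_mem⟩)
        · exact Or.inl (hf.trans h1)
      rw [e1, ← ih (rev E d) f' hdz hf' (Or.inl h.edge_mem) h2, hrev, hz0, add_zero]
  obtain ⟨q⟩ := hc'.2 _ hb _ hd
  have hfin := hwalk q (δ i₂) (δ i₄) rfl rfl (Or.inr rfl) rfl
  have hsδ : ∀ i, s (δ i) = s o := by
    intro i
    induction i with
    | zero => rfl
    | succ i ih => rw [← hδs, hsf, ih]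
  have c2 : χ (δ i₂) = 1 := if_pos (Finset.mem_image_of_mem _ (Finset.mem_Ico.2 ⟨by omega, h23⟩))
  have c4 : χ (δ i₄) = 0 := by
    refine if_neg fun hmem => ?_
    obtain ⟨i, hi, hii⟩ := Finset.mem_image.1 hmem
    rw [Finset.mem_Ico] at hi
    exact pow_apply_ne_pow_apply _ _ (show i < i₄ by omega) (by omega) hii
  simp only [s', hsδ, c2, c4] at hfin
  simp at hfin

end PlaneGraph

end BrickForest

/-! ### Rooted trees: construction and pruning -/

namespace BrickForest

/-- Rooted trees in a multigraph, built from leaves by prolonging the root along an edge and by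
identifying two roots. Each leaf carries an interval of positions. -/
inductive RTree {α : Type*} {β : Type*} (H : Graph α β) : α → Type _
  | leaf (x : α) (hx : x ∈ V(H)) (l h : ℕ) : RTree H x
  | edge {x y : α} (e : β) (h : H.IsLink e x y) (t : RTree H y) : RTree H x
  | join {x : α} (t t' : RTree H x) : RTree H x

namespace RTree

variable {α : Type*} {β : Type*} {H : Graph α β}

/-- The leaves with their intervals. -/
def leaves : {x : α} → RTree H x → List (α × ℕ × ℕ)
  | _, leaf x _ l h => [(x, l, h)]
  | _, edge _ _ t => t.leaves
  | _, join t t' => t.leaves ++ t'.leaves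

/-- The edges, with repetitions. -/
def edges : {x : α} → RTree H x → List β
  | _, leaf _ _ _ _ => []
  | _, edge e _ t => e :: t.edges
  | _, join t t' => t.edges ++ t'.edges

/-- The leaf vertices. -/
def leafVerts : {x : α} → RTree H x → List α
  | _, leaf x _ _ _ => [x]
  | _, edge _ _ t => t.leafVerts
  | _, join t t' => t.leafVerts ++ t'.leafVerts

theorem map_leaves : ∀ {x : α} (t : RTree H x), t.leaves.map Prod.fst = t.leafVerts
  | _, leaf _ _ _ _ => rfl
  | _, edge _ _ t => map_leaves t
  | _, join t t' => by simp [leaves, leafVerts, map_leaves t, map_leaves t']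

theorem edges_subset : ∀ {x : α} (t : RTree H x) {e : β}, e ∈ t.edges → e ∈ E(H)
  | _, leaf _ _ _ _, _, h => by simp [edges] at h
  | _, edge e h t, f, hf => by
    simp only [edges, List.mem_cons] at hf
    rcases hf with rfl | hf
    · exact h.edge_mem
    · exact edges_subset t hf
  | _, join t t', f, hf => by
    simp only [edges, List.mem_append] at hf
    rcases hf with hf | hf
    · exact edges_subset t hf
    · exact edges_subset t' hf

theorem exists_walk_leaf : ∀ {x : α} (t : RTree H x) {y : α}, y ∈ t.leafVerts →
    ∃ p : Walk H x y, p.edges.Sublist t.edges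
  | _, leaf x hx _ _, y, hy => by
    simp only [leafVerts, List.mem_singleton] at hy
    subst hy
    exact ⟨Walk.nil _ hx, List.Sublist.refl _⟩
  | _, edge e h t, y, hy => by
    obtain ⟨p, hp⟩ := exists_walk_leaf t hy
    exact ⟨Walk.cons e h p, hp.cons_cons e⟩
  | _, join t t', y, hy => by
    simp only [leafVerts, List.mem_append] at hy
    rcases hy with hy | hy
    · obtain ⟨p, hp⟩ := exists_walk_leaf t hy
      exact ⟨p, hp.trans (List.sublist_append_left _ _)⟩
    · obtain ⟨p, hp⟩ := exists_walk_leaf t' hy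
      exact ⟨p, hp.trans (List.sublist_append_right _ _)⟩

theorem exists_leaf : ∀ {x : α} (t : RTree H x), ∃ y, y ∈ t.leafVerts
  | _, leaf x _ _ _ => ⟨x, by simp [leafVerts]⟩
  | _, edge _ _ t => exists_leaf t
  | _, join t _ => by
    obtain ⟨y, hy⟩ := exists_leaf t
    exact ⟨y, by simp [leafVerts, hy]⟩

theorem root_mem_leafVerts_or : ∀ {x : α} (t : RTree H x),
    x ∈ t.leafVerts ∨ ∃ e ∈ t.edges, H.Inc e x
  | _, leaf x _ _ _ => Or.inl (by simp [leafVerts])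
  | _, edge e h t => Or.inr ⟨e, by simp [edges], h.inc_left⟩
  | _, join t _ => by
    rcases root_mem_leafVerts_or t with h | ⟨e, he, h⟩
    · exact Or.inl (by simp [leafVerts, h])
    · exact Or.inr ⟨e, by simp [edges, he], h⟩

/-- A vertex with only one edge of `H` is incident to the edges of a rooted tree only at its root
and at its leaves. -/
theorem mem_leafVerts_of_inc {v : α} (hv : ∀ e e', H.Inc e v → H.Inc e' v → e = e') :
    ∀ {x : α} (t : RTree H x), t.edges.Nodup → v ≠ x → ∀ e ∈ t.edges, H.Inc e v →
      v ∈ t.leafVerts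
  | _, leaf _ _ _ _, _, _, e, he, _ => by simp [edges] at he
  | _, @edge _ _ _ _ y f h t, hn, hx, e, he, hev => by
    simp only [edges, List.nodup_cons] at hn
    by_cases hy : v = y
    · rcases root_mem_leafVerts_or t with hr | ⟨e', he', hr⟩
      · exact hy ▸ hr
      · subst hy
        exact absurd (hv _ _ h.inc_right hr ▸ he') hn.1
    · simp only [edges, List.mem_cons] at he
      rcases he with rfl | he
      · exact absurd (hev.eq_of_isLink_of_ne_left h hx) hy
      · exact mem_leafVerts_of_inc hv t hn.2 hy e he hev
  | _, join t t', hn, hx, e, he, hev => by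
    simp only [edges, List.nodup_append] at hn
    simp only [edges, List.mem_append] at he
    simp only [leafVerts, List.mem_append]
    rcases he with he | he
    · exact Or.inl (mem_leafVerts_of_inc hv t hn.1 hx e he hev)
    · exact Or.inr (mem_leafVerts_of_inc hv t' hn.2.1 hx e he hev)

/-- The growth step for spanning trees. The vertex `x` remains a leaf by means of `join`, so inner
vertices may be leaves too, and pruning later selects the leaves that matter. The interval `0, 0` is
a placeholder that simplification overwrites. -/
theorem exists_insert {x y : α} {e : β} (h : H.IsLink e x y) : ∀ {r : α} (t : RTree H r),
    x ∈ t.leafVerts → ∃ t' : RTree H r,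
      (∀ z, z ∈ t'.leafVerts ↔ z = y ∨ z ∈ t.leafVerts) ∧ t'.edges.Perm (e :: t.edges)
  | _, leaf r hr l l', hx => by
    simp only [leafVerts, List.mem_singleton] at hx
    subst hx
    refine ⟨join (leaf x hr l l') (edge e h (leaf y h.right_mem 0 0)), fun z => ?_, ?_⟩
    · simp [leafVerts, or_comm]
    · simp [edges]
  | _, edge f hf t, hx => by
    obtain ⟨t', h1, h2⟩ := exists_insert h t hx
    refine ⟨edge f hf t', h1, ?_⟩
    simp only [edges]
    exact (h2.cons f).trans (List.Perm.swap _ _ _)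
  | _, join t₁ t₂, hx => by
    simp only [leafVerts, List.mem_append] at hx
    rcases hx with hx | hx
    · obtain ⟨t', h1, h2⟩ := exists_insert h t₁ hx
      refine ⟨join t' t₂, fun z => ?_, ?_⟩
      · simp [leafVerts, h1, or_assoc]
      · simpa [edges] using h2.append_right t₂.edges
    · obtain ⟨t', h1, h2⟩ := exists_insert h t₂ hx
      refine ⟨join t₁ t', fun z => ?_, ?_⟩
      · simp only [leafVerts, List.mem_append, h1]
        tauto
      · simp only [edges]
        exact (h2.append_left t₁.edges).trans List.perm_middle

/-- At a `join`, a branch that misses `S` is dropped. As there is no empty rooted tree, some leaf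
must lie in `S`. -/
theorem exists_prune (S : Set α) : ∀ {r : α} (t : RTree H r), (∃ x ∈ t.leafVerts, x ∈ S) →
    ∃ t' : RTree H r, (∀ z, z ∈ t'.leafVerts ↔ z ∈ t.leafVerts ∧ z ∈ S) ∧ t'.edges.Sublist t.edges
  | _, leaf r hr l l', ⟨x, hx, hS⟩ => by
    simp only [leafVerts, List.mem_singleton] at hx
    subst hx
    refine ⟨leaf x hr l l', fun z => ?_, List.Sublist.refl _⟩
    simp only [leafVerts, List.mem_singleton]
    exact ⟨fun h => ⟨h, h ▸ hS⟩, fun h => h.1⟩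
  | _, edge f hf t, hx => by
    obtain ⟨t', h1, h2⟩ := exists_prune S t hx
    exact ⟨edge f hf t', h1, h2.cons_cons f⟩
  | _, join t₁ t₂, hx => by
    by_cases c1 : ∃ x ∈ t₁.leafVerts, x ∈ S
    · obtain ⟨t₁', h1, h2⟩ := exists_prune S t₁ c1
      by_cases c2 : ∃ x ∈ t₂.leafVerts, x ∈ S
      · obtain ⟨t₂', h3, h4⟩ := exists_prune S t₂ c2
        refine ⟨join t₁' t₂', fun z => ?_, h2.append h4⟩
        simp only [leafVerts, List.mem_append, h1, h3]
        tauto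
      · refine ⟨t₁', fun z => ?_, h2.trans (List.sublist_append_left _ _)⟩
        simp only [leafVerts, List.mem_append, h1]
        have : ¬ (z ∈ t₂.leafVerts ∧ z ∈ S) := fun h => c2 ⟨z, h⟩
        tauto
    · have c2 : ∃ x ∈ t₂.leafVerts, x ∈ S := by
        obtain ⟨x, hx, hS⟩ := hx
        simp only [leafVerts, List.mem_append] at hx
        exact hx.elim (fun h => absurd ⟨x, h, hS⟩ c1) fun h => ⟨x, h, hS⟩
      obtain ⟨t₂', h3, h4⟩ := exists_prune S t₂ c2
      refine ⟨t₂', fun z => ?_, h4.trans (List.sublist_append_right _ _)⟩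
      simp only [leafVerts, List.mem_append, h3]
      have : ¬ (z ∈ t₁.leafVerts ∧ z ∈ S) := fun h => c1 ⟨z, h⟩
      tauto

theorem exists_boundary_edge {S : Set α} : ∀ {x y : α} (_ : Walk H x y), x ∈ S → y ∉ S →
    ∃ e a b, H.IsLink e a b ∧ a ∈ S ∧ b ∉ S
  | _, _, Walk.nil _ _, h, h' => absurd h h'
  | x, _, @Walk.cons _ _ _ _ z _ e h p, hx, hy => by
    by_cases hz : z ∈ S
    · exact exists_boundary_edge p hz hy
    · exact ⟨e, x, z, h, hx, hz⟩

/-- A connected multigraph has a spanning rooted tree. -/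
theorem exists_spanning [Finite α] (hc : IsConnected H) {r : α} (hr : r ∈ V(H)) :
    ∃ t : RTree H r, (∀ x ∈ V(H), x ∈ t.leafVerts) ∧ t.edges.Nodup := by
  have hsub : ∀ t : RTree H r, {x | x ∈ t.leafVerts} ⊆ V(H) := fun t x hx => by
    obtain ⟨p, -⟩ := t.exists_walk_leaf hx
    exact p.right_mem
  -- All ends of edges used so far are leaves; an edge leaving the leaf set is therefore new, which
  -- keeps `t.edges` free of repetitions.
  have main : ∀ n ≤ V(H).ncard, ∃ t : RTree H r, n ≤ {x | x ∈ t.leafVerts}.ncard ∧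
      t.edges.Nodup ∧ ∀ e ∈ t.edges, ∀ x, H.Inc e x → x ∈ t.leafVerts := by
    intro n
    induction n with
    | zero => exact fun _ => ⟨leaf r hr 0 0, by simp, by simp [edges], by simp [edges]⟩
    | succ n ih =>
      intro hn
      obtain ⟨t, h1, h2, h3⟩ := ih (by omega)
      by_cases hall : ∀ x ∈ V(H), x ∈ t.leafVerts
      · exact ⟨t, hn.trans (Set.ncard_le_ncard hall (Set.toFinite _)), h2, h3⟩
      · push Not at hall
        obtain ⟨v, hv, hvt⟩ := hall
        obtain ⟨y₀, hy₀⟩ := t.exists_leaf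
        obtain ⟨q⟩ := hc.2 y₀ (hsub t hy₀) v hv
        obtain ⟨e, a, b, hl, ha, hb⟩ :=
          exists_boundary_edge (S := {x | x ∈ t.leafVerts}) q hy₀ hvt
        obtain ⟨t', h4, h5⟩ := exists_insert hl t ha
        refine ⟨t', ?_, ?_, ?_⟩
        · have : {x | x ∈ t'.leafVerts} = insert b {x | x ∈ t.leafVerts} := by
            ext z
            exact h4 z
          rw [this, Set.ncard_insert_of_notMem hb (Set.toFinite _)]
          omega
        · rw [h5.nodup_iff, List.nodup_cons]
          exact ⟨fun he => hb (h3 e he b hl.inc_right), h2⟩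
        · intro f hf x hx
          rw [h4]
          rw [h5.mem_iff, List.mem_cons] at hf
          rcases hf with rfl | hf
          · rcases hx.eq_or_eq_of_isLink hl with rfl | rfl
            · exact Or.inr ha
            · exact Or.inl rfl
          · exact Or.inr (h3 f hf x hx)
  obtain ⟨t, h1, h2, -⟩ := main _ le_rfl
  have := Set.eq_of_subset_of_ncard_le (hsub t) h1 (Set.toFinite _)
  exact ⟨t, fun x hx => this.symm.subset hx, h2⟩

end RTree

end BrickForest

/-! ### Simplifying a rooted tree with leaves on a short path -/

namespace BrickForest

namespace RTree

variable {α : Type*} {β : Type*} {H : Graph α β}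

/-- The total length of the edges. -/
def wt (w : β → ℝ) {x : α} (t : RTree H x) : ℝ := (t.edges.map w).sum

/-- The total length of the edges and of the intervals at the leaves. -/
def cost (w : β → ℝ) (span : ℕ → ℕ → ℝ) {x : α} (t : RTree H x) : ℝ :=
  t.wt w + (t.leaves.map fun l => span l.2.1 l.2.2).sum

/-- The distance from the root to the nearest leaf. -/
noncomputable def near (w : β → ℝ) : {x : α} → RTree H x → ℝ
  | _, leaf _ _ _ _ => 0
  | _, edge e _ t => w e + t.near w
  | _, join t t' => min (t.near w) (t'.near w)

/-- The least position of a leaf. -/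
def lo (idx : α → ℕ) : {x : α} → RTree H x → ℕ
  | _, leaf x _ _ _ => idx x
  | _, edge _ _ t => t.lo idx
  | _, join t t' => min (t.lo idx) (t'.lo idx)

/-- The largest position of a leaf. -/
def hi (idx : α → ℕ) : {x : α} → RTree H x → ℕ
  | _, leaf x _ _ _ => idx x
  | _, edge _ _ t => t.hi idx
  | _, join t t' => max (t.hi idx) (t'.hi idx)

/-- The distance from the root to a leaf of least position. -/
noncomputable def dlo (w : β → ℝ) (idx : α → ℕ) : {x : α} → RTree H x → ℝ
  | _, leaf _ _ _ _ => 0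
  | _, edge e _ t => w e + t.dlo w idx
  | _, join t t' => if t.lo idx ≤ t'.lo idx then t.dlo w idx else t'.dlo w idx

/-- The distance from the root to a leaf of largest position. -/
noncomputable def dhi (w : β → ℝ) (idx : α → ℕ) : {x : α} → RTree H x → ℝ
  | _, leaf _ _ _ _ => 0
  | _, edge e _ t => w e + t.dhi w idx
  | _, join t t' => if t'.hi idx ≤ t.hi idx then t.dhi w idx else t'.dhi w idx

variable {w : β → ℝ} {idx : α → ℕ} {span : ℕ → ℕ → ℝ}

theorem wt_leaf (x : α) (hx : x ∈ V(H)) (l h : ℕ) : (leaf x hx l h : RTree H x).wt w = 0 := by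
  simp [wt, edges]

theorem wt_edge {x y : α} (e : β) (h : H.IsLink e x y) (t : RTree H y) :
    (edge e h t).wt w = w e + t.wt w := by
  simp [wt, edges]

theorem wt_join {x : α} (t t' : RTree H x) : (join t t').wt w = t.wt w + t'.wt w := by
  simp [wt, edges]

theorem cost_edge {x y : α} (e : β) (h : H.IsLink e x y) (t : RTree H y) :
    (edge e h t).cost w span = w e + t.cost w span := by
  simp only [cost, wt_edge, leaves]
  ring

theorem cost_join {x : α} (t t' : RTree H x) :
    (join t t').cost w span = t.cost w span + t'.cost w span := by
  simp only [cost, wt_join, leaves, List.map_append, List.sum_append]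
  ring

theorem wt_nonneg (hw : ∀ e, 0 ≤ w e) {x : α} (t : RTree H x) : 0 ≤ t.wt w := by
  apply List.sum_nonneg
  simp only [List.mem_map]
  rintro _ ⟨e, _, rfl⟩
  exact hw e

theorem near_le_dlo : ∀ {x : α} (t : RTree H x), t.near w ≤ t.dlo w idx
  | _, leaf _ _ _ _ => le_rfl
  | _, edge e _ t => by
    simp only [near, dlo]
    linarith [near_le_dlo t]
  | _, join t t' => by
    simp only [near, dlo]
    split_ifs
    · exact (min_le_left _ _).trans (near_le_dlo t)
    · exact (min_le_right _ _).trans (near_le_dlo t')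

theorem near_le_dhi : ∀ {x : α} (t : RTree H x), t.near w ≤ t.dhi w idx
  | _, leaf _ _ _ _ => le_rfl
  | _, edge e _ t => by
    simp only [near, dhi]
    linarith [near_le_dhi t]
  | _, join t t' => by
    simp only [near, dhi]
    split_ifs
    · exact (min_le_left _ _).trans (near_le_dhi t)
    · exact (min_le_right _ _).trans (near_le_dhi t')

theorem dlo_le_wt (hw : ∀ e, 0 ≤ w e) : ∀ {x : α} (t : RTree H x), t.dlo w idx ≤ t.wt w
  | _, leaf _ _ _ _ => by simp [dlo, wt_leaf]
  | _, edge e _ t => by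
    simp only [dlo, wt_edge]
    linarith [dlo_le_wt hw t]
  | _, join t t' => by
    simp only [dlo, wt_join]
    split_ifs
    · linarith [dlo_le_wt hw t, t'.wt_nonneg hw]
    · linarith [dlo_le_wt hw t', t.wt_nonneg hw]

theorem dhi_le_wt (hw : ∀ e, 0 ≤ w e) : ∀ {x : α} (t : RTree H x), t.dhi w idx ≤ t.wt w
  | _, leaf _ _ _ _ => by simp [dhi, wt_leaf]
  | _, edge e _ t => by
    simp only [dhi, wt_edge]
    linarith [dhi_le_wt hw t]
  | _, join t t' => by
    simp only [dhi, wt_join]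
    split_ifs
    · linarith [dhi_le_wt hw t, t'.wt_nonneg hw]
    · linarith [dhi_le_wt hw t', t.wt_nonneg hw]

theorem lo_le : ∀ {x : α} (t : RTree H x) {y : α}, y ∈ t.leafVerts → t.lo idx ≤ idx y
  | _, leaf _ _ _ _, y, hy => by
    simp only [leafVerts, List.mem_singleton] at hy
    simp [lo, hy]
  | _, edge _ _ t, y, hy => lo_le t hy
  | _, join t t', y, hy => by
    simp only [leafVerts, List.mem_append] at hy
    rcases hy with hy | hy
    · exact (min_le_left _ _).trans (lo_le t hy)
    · exact (min_le_right _ _).trans (lo_le t' hy)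

theorem le_hi : ∀ {x : α} (t : RTree H x) {y : α}, y ∈ t.leafVerts → idx y ≤ t.hi idx
  | _, leaf _ _ _ _, y, hy => by
    simp only [leafVerts, List.mem_singleton] at hy
    simp [hi, hy]
  | _, edge _ _ t, y, hy => le_hi t hy
  | _, join t t', y, hy => by
    simp only [leafVerts, List.mem_append] at hy
    rcases hy with hy | hy
    · exact (le_hi t hy).trans (le_max_left _ _)
    · exact (le_hi t' hy).trans (le_max_right _ _)

theorem exists_walk_lo : ∀ {x : α} (t : RTree H x),
    ∃ y ∈ t.leafVerts, idx y = t.lo idx ∧ ∃ p : Walk H x y, p.weight w = t.dlo w idx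
  | _, leaf x hx _ _ => ⟨x, by simp [leafVerts], rfl, Walk.nil x hx, by
      simp [Walk.weight, Walk.edges, dlo]⟩
  | _, edge e h t => by
    obtain ⟨y, hy, h1, p, hp⟩ := exists_walk_lo t
    exact ⟨y, hy, h1, Walk.cons e h p, by simp [Walk.weight, Walk.edges, dlo, ← hp]⟩
  | _, join t t' => by
    by_cases hle : t.lo idx ≤ t'.lo idx
    · obtain ⟨y, hy, h1, p, hp⟩ := exists_walk_lo t
      exact ⟨y, by simp [leafVerts, hy], by simp [lo, h1, hle], p, by simp [dlo, hle, hp]⟩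
    · obtain ⟨y, hy, h1, p, hp⟩ := exists_walk_lo t'
      exact ⟨y, by simp [leafVerts, hy], by simp [lo, h1, (not_le.1 hle).le], p, by
        simp [dlo, hle, hp]⟩

theorem exists_walk_hi : ∀ {x : α} (t : RTree H x),
    ∃ y ∈ t.leafVerts, idx y = t.hi idx ∧ ∃ p : Walk H x y, p.weight w = t.dhi w idx
  | _, leaf x hx _ _ => ⟨x, by simp [leafVerts], rfl, Walk.nil x hx, by
      simp [Walk.weight, Walk.edges, dhi]⟩
  | _, edge e h t => by
    obtain ⟨y, hy, h1, p, hp⟩ := exists_walk_hi t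
    exact ⟨y, hy, h1, Walk.cons e h p, by simp [Walk.weight, Walk.edges, dhi, ← hp]⟩
  | _, join t t' => by
    by_cases hle : t'.hi idx ≤ t.hi idx
    · obtain ⟨y, hy, h1, p, hp⟩ := exists_walk_hi t
      exact ⟨y, by simp [leafVerts, hy], by simp [hi, h1, hle], p, by simp [dhi, hle, hp]⟩
    · obtain ⟨y, hy, h1, p, hp⟩ := exists_walk_hi t'
      exact ⟨y, by simp [leafVerts, hy], by simp [hi, h1, (not_le.1 hle).le], p, by
        simp [dhi, hle, hp]⟩

theorem exists_walk_le_wt (hw : ∀ e, 0 ≤ w e) {x : α} (t : RTree H x) {y : α}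
    (hy : y ∈ t.leafVerts) : ∃ p : Walk H x y, p.weight w ≤ t.wt w := by
  obtain ⟨p, hp⟩ := t.exists_walk_leaf hy
  refine ⟨p, (hp.map w).sum_le_sum ?_⟩
  simp only [List.mem_map]
  rintro _ ⟨e, _, rfl⟩
  exact hw e

theorem exists_walk_leaf_leaf (hw : ∀ e, 0 ≤ w e) : ∀ {x : α} (t : RTree H x) {y z : α},
    y ∈ t.leafVerts → z ∈ t.leafVerts → ∃ p : Walk H y z, p.weight w ≤ t.wt w
  | _, leaf x hx _ _, y, z, hy, hz => by
    simp only [leafVerts, List.mem_singleton] at hy hz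
    subst hy
    subst hz
    exact ⟨Walk.nil _ hx, by simp [Walk.weight, Walk.edges, wt_leaf]⟩
  | _, edge e _ t, y, z, hy, hz => by
    obtain ⟨p, hp⟩ := exists_walk_leaf_leaf hw t hy hz
    exact ⟨p, by rw [wt_edge]; linarith [hw e]⟩
  | _, join t t', y, z, hy, hz => by
    simp only [leafVerts, List.mem_append] at hy hz
    simp only [wt_join]
    have h0 := t.wt_nonneg hw
    have h0' := t'.wt_nonneg hw
    rcases hy with hy | hy <;> rcases hz with hz | hz
    · obtain ⟨p, hp⟩ := exists_walk_leaf_leaf hw t hy hz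
      exact ⟨p, by linarith⟩
    · obtain ⟨p, hp⟩ := exists_walk_le_wt hw t hy
      obtain ⟨q, hq⟩ := exists_walk_le_wt hw t' hz
      exact ⟨p.reverse.append q, by rw [Walk.weight_append, Walk.weight_reverse]; linarith⟩
    · obtain ⟨p, hp⟩ := exists_walk_le_wt hw t' hy
      obtain ⟨q, hq⟩ := exists_walk_le_wt hw t hz
      exact ⟨p.reverse.append q, by rw [Walk.weight_append, Walk.weight_reverse]; linarith⟩
    · obtain ⟨p, hp⟩ := exists_walk_leaf_leaf hw t' hy hz
      exact ⟨p, by linarith⟩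

/-- Only the path from the root to a nearest leaf is kept; the interval placed there is to reach all
the other leaves. -/
theorem exists_collapse (l h : ℕ) : ∀ {x : α} (t : RTree H x),
    ∃ s : RTree H x, (∃ y ∈ t.leafVerts, s.leaves = [(y, l, h)]) ∧ s.edges.Sublist t.edges ∧
      s.wt w = t.near w
  | _, leaf x hx _ _ => ⟨leaf x hx l h, ⟨x, by simp [leafVerts], rfl⟩, List.Sublist.refl _, by
      simp [wt_leaf, near]⟩
  | _, edge e he t => by
    obtain ⟨s, ⟨y, hy, h1⟩, h2, h3⟩ := exists_collapse l h t
    exact ⟨edge e he s, ⟨y, hy, h1⟩, h2.cons_cons e, by rw [wt_edge, h3]; rfl⟩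
  | _, join t t' => by
    by_cases hle : t.near w ≤ t'.near w
    · obtain ⟨s, ⟨y, hy, h1⟩, h2, h3⟩ := exists_collapse l h t
      exact ⟨s, ⟨y, by simp [leafVerts, hy], h1⟩, h2.trans (List.sublist_append_left _ _), by
        simp [h3, near, hle]⟩
    · obtain ⟨s, ⟨y, hy, h1⟩, h2, h3⟩ := exists_collapse l h t'
      exact ⟨s, ⟨y, by simp [leafVerts, hy], h1⟩, h2.trans (List.sublist_append_right _ _), by
        simp [h3, near, (not_le.1 hle).le]⟩

/-- `s` is a simplification of `t`: it uses edges of `t` and leaves of `t`, and the intervals at its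
leaves cover all leaves of `t`. -/
structure Simplifies (idx : α → ℕ) {x : α} (s t : RTree H x) : Prop where
  edges_sublist : s.edges.Sublist t.edges
  mem_leaf : ∀ l ∈ s.leaves, l.1 ∈ t.leafVerts ∧ l.2.1 ≤ idx l.1 ∧ idx l.1 ≤ l.2.2 ∧
    ∃ y ∈ t.leafVerts, idx y = l.2.2
  cover : ∀ y ∈ t.leafVerts, ∃ l ∈ s.leaves, l.2.1 ≤ idx y ∧ idx y ≤ l.2.2

theorem Simplifies.join {x : α} {s t s' t' : RTree H x} (h : s.Simplifies idx t)
    (h' : s'.Simplifies idx t') : (s.join s').Simplifies idx (t.join t') where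
  edges_sublist := h.edges_sublist.append h'.edges_sublist
  mem_leaf l hl := by
    simp only [leaves, List.mem_append] at hl
    simp only [leafVerts, List.mem_append]
    rcases hl with hl | hl
    · obtain ⟨h1, h2, h3, y, h4, h5⟩ := h.mem_leaf l hl
      exact ⟨Or.inl h1, h2, h3, y, Or.inl h4, h5⟩
    · obtain ⟨h1, h2, h3, y, h4, h5⟩ := h'.mem_leaf l hl
      exact ⟨Or.inr h1, h2, h3, y, Or.inr h4, h5⟩
  cover y hy := by
    simp only [leafVerts, List.mem_append] at hy
    simp only [leaves, List.mem_append]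
    rcases hy with hy | hy
    · obtain ⟨l, hl, h1⟩ := h.cover y hy
      exact ⟨l, Or.inl hl, h1⟩
    · obtain ⟨l, hl, h1⟩ := h'.cover y hy
      exact ⟨l, Or.inr hl, h1⟩

theorem exists_collapse_simplifies {x : α} (t : RTree H x) :
    ∃ s : RTree H x, s.Simplifies idx t ∧ s.leaves.length = 1 ∧
      s.cost w span = t.near w + span (t.lo idx) (t.hi idx) := by
  obtain ⟨s, ⟨y, hy, h1⟩, h2, h3⟩ := exists_collapse (w := w) (t.lo idx) (t.hi idx) t
  refine ⟨s, ⟨h2, ?_, ?_⟩, by simp [h1], by simp [cost, h1, h3]⟩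
  · simp only [h1, List.mem_singleton, forall_eq]
    obtain ⟨z, hz, hz', -⟩ := exists_walk_hi (w := w) (idx := idx) t
    exact ⟨hy, lo_le t hy, le_hi t hy, z, hz, hz'⟩
  · intro z hz
    exact ⟨(y, t.lo idx, t.hi idx), by simp [h1], lo_le t hz, le_hi t hz⟩

/-- The numerical core of the simplification: the cheaper of two solutions. -/
theorem excess_bound {N x ρ ρ₁ ρ₂ W₁ W₂ d₁ d₂ : ℝ} (h1 : ρ ≤ ρ₁) (h2 : ρ ≤ ρ₂)
    (hd1 : ρ₁ ≤ d₁) (hd2 : ρ₂ ≤ d₂) (hx : x ≤ ρ - ((W₁ - d₁) + (W₂ - d₂)))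
    (hN : N * x ≤ (W₁ - d₁) + (W₂ - d₂)) :
    (2 * N + 1) * x ≤ (W₁ + W₂) - d₁ ∧ (2 * N + 1) * x ≤ (W₁ + W₂) - d₂ := by
  -- Adding `hx` to twice `hN` gives `(2 * N + 1) * x ≤ (W₁ - d₁) + (W₂ - d₂) + ρ`, and `ρ` is at
  -- most `d₂` as well as `d₁`.
  constructor <;> linarith

/-- Simplification of a rooted tree whose leaves are on a short path. -/
theorem exists_simplification (hw : ∀ e, 0 ≤ w e) {a : ℝ} (ha : 1 ≤ a) {S : Set α}
    (hs : ∀ x y (p : Walk H x y), x ∈ S → y ∈ S → idx x ≤ idx y →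
      span (idx x) (idx y) ≤ a * p.weight w) :
    ∀ {x : α} (t : RTree H x), (∀ y ∈ t.leafVerts, y ∈ S) → ∀ k : ℕ,
      ∃ s : RTree H x, s.Simplifies idx t ∧ s.leaves.length ≤ 2 ^ k ∧
        (2 * (2 ^ k - 1) + 1) * (s.cost w span - a * t.wt w) ≤ t.wt w - t.dlo w idx ∧
        (2 * (2 ^ k - 1) + 1) * (s.cost w span - a * t.wt w) ≤ t.wt w - t.dhi w idx
  | _, leaf x hx l h, hS, k => by
    have hspan : span (idx x) (idx x) ≤ 0 := by
      have hxS := hS x (by simp [leafVerts])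
      have := hs x x (Walk.nil x hx) hxS hxS le_rfl
      simpa [Walk.weight, Walk.edges] using this
    have hk : (1 : ℝ) ≤ 2 ^ k := one_le_pow₀ (by norm_num)
    refine ⟨leaf x hx (idx x) (idx x), ⟨List.Sublist.refl _, ?_, ?_⟩, ?_, ?_⟩
    · simp [leaves, leafVerts]
    · simp [leaves, leafVerts]
    · simpa [leaves] using Nat.one_le_two_pow
    · simp only [cost, leaves, wt_leaf, dlo, dhi, List.map_cons, List.map_nil, List.sum_cons,
        List.sum_nil]
      constructor <;> nlinarith
  | _, edge e he t, hS, k => by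
    obtain ⟨s, h1, h2, h3, h4⟩ := exists_simplification hw ha hs t hS k
    have hk : (1 : ℝ) ≤ 2 ^ k := one_le_pow₀ (by norm_num)
    -- The new edge adds equally to the weight and to the distances on the right-hand sides, so only
    -- the left-hand sides change, and they do not increase.
    have hae : w e - a * w e ≤ 0 := by nlinarith [hw e]
    have hmul : (2 * ((2 : ℝ) ^ k - 1) + 1) * (w e - a * w e) ≤ 0 :=
      mul_nonpos_of_nonneg_of_nonpos (by linarith) hae
    refine ⟨edge e he s, ⟨h1.edges_sublist.cons_cons e, h1.mem_leaf, h1.cover⟩, h2, ?_, ?_⟩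
    · rw [cost_edge, wt_edge, dlo]
      linarith
    · rw [cost_edge, wt_edge, dhi]
      linarith
  | x, join t₁ t₂, hS, k => by
    have hS1 : ∀ y ∈ t₁.leafVerts, y ∈ S := fun y hy => hS y (by simp [leafVerts, hy])
    have hS2 : ∀ y ∈ t₂.leafVerts, y ∈ S := fun y hy => hS y (by simp [leafVerts, hy])
    have hk : (1 : ℝ) ≤ 2 ^ k := one_le_pow₀ (by norm_num)
    obtain ⟨s, hs1, hs2, hs3⟩ :=
      exists_collapse_simplifies (w := w) (idx := idx) (span := span) (join t₁ t₂)
    obtain ⟨xl, hxl, hxl', pl, hpl⟩ := exists_walk_lo (w := w) (idx := idx) (join t₁ t₂)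
    obtain ⟨xh, hxh, hxh', ph, hph⟩ := exists_walk_hi (w := w) (idx := idx) (join t₁ t₂)
    have hlohi : idx xl ≤ idx xh := by
      rw [hxl']
      exact lo_le _ hxh
    have w1 := t₁.wt_nonneg hw
    have w2 := t₂.wt_nonneg hw
    have dl := dlo_le_wt (idx := idx) hw (join t₁ t₂)
    have dh := dhi_le_wt (idx := idx) hw (join t₁ t₂)
    -- Used when one branch contains both extreme leaves: that branch pays for the interval, the
    -- other one for the path to the nearest leaf, and the collapse has no excess.
    have same : span ((join t₁ t₂).lo idx) ((join t₁ t₂).hi idx) + (join t₁ t₂).near w ≤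
        a * (join t₁ t₂).wt w → ∃ s : RTree H x, s.Simplifies idx (join t₁ t₂) ∧
        s.leaves.length ≤ 2 ^ k ∧
        (2 * (2 ^ k - 1) + 1) * (s.cost w span - a * (join t₁ t₂).wt w) ≤
          (join t₁ t₂).wt w - (join t₁ t₂).dlo w idx ∧
        (2 * (2 ^ k - 1) + 1) * (s.cost w span - a * (join t₁ t₂).wt w) ≤
          (join t₁ t₂).wt w - (join t₁ t₂).dhi w idx := by
      intro hle
      have : (2 * ((2 : ℝ) ^ k - 1) + 1) * (s.cost w span - a * (join t₁ t₂).wt w) ≤ 0 :=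
        mul_nonpos_of_nonneg_of_nonpos (by linarith) (by rw [hs3]; linarith)
      exact ⟨s, hs1, by rw [hs2]; exact Nat.one_le_two_pow, by linarith, by linarith⟩
    -- Used when the extreme leaves lie in different branches, at distances `d₁` and `d₂` from the
    -- root. The cheaper of collapsing the tree and simplifying both branches is taken.
    have split : ∀ d₁ d₂ : ℝ, t₁.near w ≤ d₁ → t₂.near w ≤ d₂ →
        span ((join t₁ t₂).lo idx) ((join t₁ t₂).hi idx) ≤ a * (d₁ + d₂) →
        d₁ ≤ t₁.wt w → d₂ ≤ t₂.wt w →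
        (∀ k, ∃ s : RTree H x, s.Simplifies idx t₁ ∧ s.leaves.length ≤ 2 ^ k ∧
          (2 * (2 ^ k - 1) + 1) * (s.cost w span - a * t₁.wt w) ≤ t₁.wt w - d₁) →
        (∀ k, ∃ s : RTree H x, s.Simplifies idx t₂ ∧ s.leaves.length ≤ 2 ^ k ∧
          (2 * (2 ^ k - 1) + 1) * (s.cost w span - a * t₂.wt w) ≤ t₂.wt w - d₂) →
        ∃ s : RTree H x, s.Simplifies idx (join t₁ t₂) ∧ s.leaves.length ≤ 2 ^ k ∧
        (2 * (2 ^ k - 1) + 1) * (s.cost w span - a * (join t₁ t₂).wt w) ≤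
          (join t₁ t₂).wt w - d₁ ∧
        (2 * (2 ^ k - 1) + 1) * (s.cost w span - a * (join t₁ t₂).wt w) ≤
          (join t₁ t₂).wt w - d₂ := by
      intro d₁ d₂ hd1 hd2 hspan hw1 hw2 ih1 ih2
      -- The interval costs at most `a * (d₁ + d₂)`. Everything off the two paths to the extreme
      -- leaves is saved, and `1 ≤ a`.
      have hcol : s.cost w span - a * (join t₁ t₂).wt w ≤
          min (t₁.near w) (t₂.near w) - ((t₁.wt w - d₁) + (t₂.wt w - d₂)) := by
        rw [hs3, wt_join, near]
        nlinarith
      cases k with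
      | zero =>
        -- A single leaf is allowed, so collapsing is the only option; it corresponds to `N = 0` in
        -- `excess_bound`.
        refine ⟨s, hs1, by rw [hs2]; exact Nat.one_le_two_pow, ?_⟩
        rw [wt_join]
        rw [wt_join] at hcol
        exact excess_bound (min_le_left _ _) (min_le_right _ _) hd1 hd2 hcol (by
          simp only [pow_zero, sub_self, zero_mul]
          linarith)
      | succ k =>
        obtain ⟨s₁, a1, b1, c1⟩ := ih1 k
        obtain ⟨s₂, a2, b2, c2⟩ := ih2 k
        -- The factor for `k` is the `N` of `excess_bound` for `k + 1`: the factor passes from `N`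
        -- to `2 * N + 1` when the number of leaves doubles.
        have hN : (2 * ((2 : ℝ) ^ k - 1) + 1) = 2 ^ (k + 1) - 1 := by
          rw [pow_succ]
          ring
        rw [hN] at c1 c2
        have hN0 : (0 : ℝ) ≤ 2 ^ (k + 1) - 1 := by linarith
        have hjoin : (2 ^ (k + 1) - 1) *
            ((join s₁ s₂).cost w span - a * (join t₁ t₂).wt w) ≤
            (t₁.wt w - d₁) + (t₂.wt w - d₂) := by
          rw [cost_join, wt_join]
          linarith
        by_cases hle : s.cost w span ≤ (join s₁ s₂).cost w span
        · refine ⟨s, hs1, by rw [hs2]; exact Nat.one_le_two_pow, ?_⟩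
          rw [wt_join] at hcol hjoin ⊢
          refine excess_bound (min_le_left _ _) (min_le_right _ _) hd1 hd2 hcol ?_
          exact (mul_le_mul_of_nonneg_left (by linarith) hN0).trans hjoin
        · refine ⟨join s₁ s₂, a1.join a2, ?_, ?_⟩
          · simp only [leaves, List.length_append, pow_succ]
            omega
          · rw [wt_join] at hcol hjoin ⊢
            exact excess_bound (min_le_left _ _) (min_le_right _ _) hd1 hd2 (by linarith) hjoin
    have ih1 := exists_simplification hw ha hs t₁ hS1
    have ih2 := exists_simplification hw ha hs t₂ hS2
    have hspan : span ((join t₁ t₂).lo idx) ((join t₁ t₂).hi idx) ≤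
        a * ((join t₁ t₂).dlo w idx + (join t₁ t₂).dhi w idx) := by
      rw [← hxl', ← hxh', ← hpl, ← hph, ← Walk.weight_reverse w pl, ← Walk.weight_append]
      exact hs _ _ _ (hS _ hxl) (hS _ hxh) hlohi
    have hsame : ∀ t : RTree H x, (∀ y ∈ t.leafVerts, y ∈ S) →
        span (t.lo idx) (t.hi idx) ≤ a * t.wt w := by
      intro t ht
      obtain ⟨y, hy, hy', -⟩ := exists_walk_lo (w := w) (idx := idx) t
      obtain ⟨z, hz, hz', -⟩ := exists_walk_hi (w := w) (idx := idx) t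
      obtain ⟨p, hp⟩ := exists_walk_leaf_leaf hw t hy hz
      rw [← hy', ← hz']
      refine (hs _ _ p (ht _ hy) (ht _ hz) (by rw [hy']; exact lo_le _ hz)).trans ?_
      exact mul_le_mul_of_nonneg_left hp (by linarith)
    by_cases hl : t₁.lo idx ≤ t₂.lo idx <;> by_cases hh : t₂.hi idx ≤ t₁.hi idx
    · refine same ?_
      have e1 := hsame t₁ hS1
      have e2 := (near_le_dlo (w := w) (idx := idx) t₂).trans (dlo_le_wt hw t₂)
      have e3 : min (t₁.near w) (t₂.near w) ≤ t₂.near w := min_le_right _ _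
      simp only [lo, hi, near, wt_join, min_eq_left hl, max_eq_left hh]
      nlinarith
    · simp only [dlo, dhi, if_pos hl, if_neg hh] at hspan ⊢
      refine split _ _ (near_le_dlo t₁) (near_le_dhi t₂) hspan (dlo_le_wt hw _)
        (dhi_le_wt hw _) (fun k => ?_) fun k => ?_
      · obtain ⟨s, h1, h2, h3, -⟩ := ih1 k
        exact ⟨s, h1, h2, h3⟩
      · obtain ⟨s, h1, h2, -, h3⟩ := ih2 k
        exact ⟨s, h1, h2, h3⟩
    · simp only [dlo, dhi, if_neg hl, if_pos hh] at hspan ⊢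
      obtain ⟨s, h1, h2, h3, h4⟩ := split _ _ (near_le_dhi t₁) (near_le_dlo t₂)
        (hspan.trans_eq (by ring)) (dhi_le_wt hw _)
        (dlo_le_wt hw _) (fun k => by
          obtain ⟨s, h1, h2, -, h3⟩ := ih1 k
          exact ⟨s, h1, h2, h3⟩) fun k => by
          obtain ⟨s, h1, h2, h3, -⟩ := ih2 k
          exact ⟨s, h1, h2, h3⟩
      exact ⟨s, h1, h2, h4, h3⟩
    · refine same ?_
      have e1 := hsame t₂ hS2
      have e2 := (near_le_dlo (w := w) (idx := idx) t₁).trans (dlo_le_wt hw t₁)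
      have e3 : min (t₁.near w) (t₂.near w) ≤ t₁.near w := min_le_left _ _
      simp only [lo, hi, near, wt_join, min_eq_right (not_le.1 hl).le,
        max_eq_right (not_le.1 hh).le]
      nlinarith

end RTree

end BrickForest

/-! ### Weights of edge lists, and trees within an edge set -/

namespace BrickForest

section ListSum

variable {α β : Type*}

theorem sum_toFinset_le_list_sum [DecidableEq β] {w : β → ℝ} (hw : ∀ e, 0 ≤ w e) (L : List β) :
    ∑ e ∈ L.toFinset, w e ≤ (L.map w).sum := by
  induction L with
  | nil => simp
  | cons a L ih =>
    rw [List.toFinset_cons, List.map_cons, List.sum_cons]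
    by_cases ha : a ∈ L.toFinset
    · rw [Finset.insert_eq_of_mem ha]
      linarith [hw a]
    · rw [Finset.sum_insert ha]
      linarith

theorem weight_le_list_sum {w : β → ℝ} (hw : ∀ e, 0 ≤ w e) {H : Graph α β} {L : List β}
    (hL : ∀ e ∈ E(H), e ∈ L) : weight w H ≤ (L.map w).sum := by
  classical
  have hf : E(H).Finite := (L.toFinset.finite_toSet).subset fun e he => by simpa using hL e he
  unfold weight
  rw [finsum_mem_eq_finite_toFinset_sum _ hf]
  refine le_trans (Finset.sum_le_sum_of_subset_of_nonneg ?_ fun e _ _ => hw e)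
    (sum_toFinset_le_list_sum hw L)
  intro e he
  simpa using hL e (by simpa using he)

end ListSum

section Component

variable {α β : Type*}

/-- The connected component of `r`. -/
def componentOf (H : Graph α β) (r : α) : Graph α β where
  vertexSet := {x | Nonempty (Walk H r x)}
  IsLink e x y := Nonempty (Walk H r x) ∧ H.IsLink e x y
  isLink_symm := fun _ _ => ⟨fun _ _ ⟨⟨p⟩, h⟩ =>
    ⟨⟨p.append (Walk.cons _ h (Walk.nil _ h.right_mem))⟩, h.symm⟩⟩
  eq_or_eq_of_isLink_of_isLink := fun _ _ _ _ _ h h' =>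
    H.eq_or_eq_of_isLink_of_isLink h.2 h'.2
  left_mem_of_isLink := fun _ _ _ h => h.1

theorem componentOf_le (H : Graph α β) (r : α) : componentOf H r ≤ H :=
  ⟨fun _ ⟨p⟩ => p.right_mem, fun _ _ _ h => h.2⟩

theorem walk_componentOf {H : Graph α β} {r : α} : ∀ {x y : α}, Walk H x y →
    Nonempty (Walk H r x) → Nonempty (Walk (componentOf H r) x y)
  | _, _, Walk.nil x _, h => ⟨Walk.nil x h⟩
  | _, _, Walk.cons e h p, ⟨q⟩ => by
    obtain ⟨p'⟩ := walk_componentOf p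
      ⟨q.append (Walk.cons _ h (Walk.nil _ h.right_mem))⟩
    exact ⟨Walk.cons e ⟨⟨q⟩, h⟩ p'⟩

theorem isConnected_componentOf {H : Graph α β} {r : α} (hr : r ∈ V(H)) :
    IsConnected (componentOf H r) := by
  refine ⟨⟨r, ⟨Walk.nil r hr⟩⟩, fun x ⟨p⟩ y ⟨q⟩ => ?_⟩
  exact walk_componentOf (p.reverse.append q) ⟨p⟩

/-- A finite edge set that joins all of `S` to `r` contains a tree spanning `S`. -/
theorem exists_tree_of_edges {H : Graph α β} {r : α} (hr : r ∈ V(H)) {X : Set β}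
    (hX : X.Finite) {S : Set α}
    (hS : ∀ x ∈ S, ∃ p : Walk H r x, ∀ e ∈ p.edges, e ∈ X) :
    ∃ T ≤ H, IsTree T ∧ Spans T S ∧ E(T) ⊆ X := by
  have hle := (componentOf_le (keepEdges H X) r)
  have hE : E(componentOf (keepEdges H X) r) ⊆ X := fun e he => by
    have := hle.edgeSet_mono he
    rw [edgeSet_keepEdges] at this
    exact this.1
  obtain ⟨T, hT, hT', hV⟩ := exists_spanning_tree (hX.subset hE)
    (isConnected_componentOf (H := keepEdges H X) (r := r) hr)
  refine ⟨T, hT.trans (hle.trans (keepEdges_le _ _)), hT', ⟨hT'.1, fun x hx => ?_⟩,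
    hT.edgeSet_mono.trans hE⟩
  rw [hV]
  obtain ⟨p, hp⟩ := hS x hx
  obtain ⟨q, -⟩ := p.exists_map (H' := keepEdges H X) id hr (fun e he a b h => ⟨hp e he, h⟩)
  exact ⟨q⟩

end Component

/-! ### Doubled closed walks -/

namespace Walk

variable {α β : Type*} {H : Graph α β}

/-- The vertex of a walk at a given position. -/
def vert : {x y : α} → Walk H x y → ℕ → α
  | _, _, nil x _, _ => x
  | x, _, cons _ _ _, 0 => x
  | _, _, cons _ _ p, n + 1 => p.vert n

theorem vert_zero : ∀ {x y : α} (p : Walk H x y), p.vert 0 = x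
  | _, _, nil _ _ => rfl
  | _, _, cons _ _ _ => rfl

theorem vert_length : ∀ {x y : α} (p : Walk H x y), p.vert p.edges.length = y
  | _, _, nil _ _ => rfl
  | _, _, cons _ _ p => vert_length p

theorem exists_vert_of_mem_support : ∀ {x y : α} (p : Walk H x y) {z : α}, z ∈ p.support →
    ∃ j ≤ p.edges.length, p.vert j = z
  | _, _, nil x _, z, h => ⟨0, le_rfl, by simp [support] at h; exact h.symm⟩
  | _, _, cons e h p, z, hz => by
    simp only [support, List.mem_cons] at hz
    rcases hz with rfl | hz
    · exact ⟨0, Nat.zero_le _, rfl⟩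
    · obtain ⟨j, hj, hj'⟩ := exists_vert_of_mem_support p hz
      exact ⟨j + 1, by simpa [edges] using hj, hj'⟩

theorem isLink_vert : ∀ {x y : α} (p : Walk H x y) {j : ℕ} {e : β}, p.edges[j]? = some e →
    H.IsLink e (p.vert j) (p.vert (j + 1))
  | _, _, nil _ _, j, e, h => by simp [edges] at h
  | _, _, cons f h p, 0, e, he => by
    simp only [edges, List.getElem?_cons_zero, Option.some.injEq] at he
    subst he
    change H.IsLink _ _ (p.vert 0)
    rw [vert_zero p]
    exact h
  | _, _, cons f h p, j + 1, e, he => by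
    simp only [edges, List.getElem?_cons_succ] at he
    exact isLink_vert p he

theorem vert_mem_support : ∀ {x y : α} (p : Walk H x y) (j : ℕ), p.vert j ∈ p.support
  | _, _, nil _ _, _ => by simp [vert, support]
  | _, _, cons _ _ _, 0 => by simp [vert, support]
  | _, _, cons _ _ p, j + 1 => by simp [vert, support, vert_mem_support p j]

/-- The doubled walk: the `j`-th edge of the walk becomes two parallel edges, namely its copies
`2 * j` and `2 * j + 1`. -/
def double {x y : α} (p : Walk H x y) : Graph α (β × ℕ) where
  vertexSet := {v | v ∈ p.support}
  IsLink e a b := p.edges[e.2 / 2]? = some e.1 ∧ H.IsLink e.1 a b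
  isLink_symm := fun _ _ => ⟨fun _ _ h => ⟨h.1, h.2.symm⟩⟩
  eq_or_eq_of_isLink_of_isLink := fun _ _ _ _ _ h h' =>
    H.eq_or_eq_of_isLink_of_isLink h.2 h'.2
  left_mem_of_isLink := fun _ _ _ h =>
    p.mem_support_of_inc (List.mem_of_getElem? h.1) h.2.inc_left

variable {x : α}

theorem double_le {x y : α} (p : Walk H x y) : p.double ≤ copies H :=
  ⟨fun _ h => p.support_subset h, fun _ _ _ h => h.2⟩

theorem edge_double {x y : α} {p : Walk H x y} {e : β × ℕ} (he : e ∈ E(p.double)) :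
    p.edges[e.2 / 2]? = some e.1 := by
  obtain ⟨a, b, h⟩ := he
  exact h.1

theorem mem_edges_of_edge_double {x y : α} {p : Walk H x y} {e : β × ℕ}
    (he : e ∈ E(p.double)) : e.1 ∈ p.edges :=
  List.mem_of_getElem? (edge_double he)

/-- The edges of the doubled walk, as a list. -/
theorem exists_list_edges_double {x y : α} (p : Walk H x y) (w : β → ℝ) :
    ∃ L : List (β × ℕ), (∀ e ∈ E(p.double), e ∈ L) ∧
      (L.map fun e => w e.1).sum = 2 * p.weight w := by
  refine ⟨p.edges.zipIdx.flatMap fun z => [(z.1, 2 * z.2), (z.1, 2 * z.2 + 1)], ?_, ?_⟩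
  · rintro ⟨e, m⟩ he
    rw [List.mem_flatMap]
    refine ⟨(e, m / 2), List.mk_mem_zipIdx_iff_getElem?.2 (edge_double he), ?_⟩
    simp only [List.mem_cons, Prod.mk.injEq, true_and, List.not_mem_nil, or_false]
    omega
  · have key : ∀ Z : List (β × ℕ),
        ((Z.flatMap fun z => [(z.1, 2 * z.2), (z.1, 2 * z.2 + 1)]).map fun e => w e.1).sum =
          2 * ((Z.map Prod.fst).map w).sum := by
      intro Z
      induction Z with
      | nil => simp
      | cons z Z ih =>
        simp only [List.flatMap_cons, List.map_append, List.sum_append, ih, List.map_cons,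
          List.map_nil, List.sum_cons, List.sum_nil]
        ring
    rw [key, List.zipIdx_map_fst]
    rfl

theorem finite_edges_double {x y : α} (p : Walk H x y) : E(p.double).Finite := by
  classical
  obtain ⟨L, hL, -⟩ := p.exists_list_edges_double fun _ => 0
  exact (L.toFinset.finite_toSet).subset fun e he => by simpa using hL e he

theorem weight_double_le {x y : α} (p : Walk H x y) {w : β → ℝ} (hw : ∀ e, 0 ≤ w e) :
    BrickForest.weight (fun e : β × ℕ => w e.1) p.double ≤ 2 * p.weight w := by
  obtain ⟨L, hL, hs⟩ := p.exists_list_edges_double w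
  rw [← hs]
  exact weight_le_list_sum (fun e => hw e.1) hL

theorem exists_walk_double_segment {x y : α} (p : Walk H x y) (c : ℕ → ℕ) (hc : ∀ j, c j < 2)
    {s t : ℕ} (hst : s ≤ t) (ht : t ≤ p.edges.length) :
    ∃ q : Walk p.double (p.vert s) (p.vert t),
      ∀ e ∈ q.edges, s ≤ e.2 / 2 ∧ e.2 / 2 < t ∧ e.2 % 2 = c (e.2 / 2) := by
  induction t, hst using Nat.le_induction with
  | base => exact ⟨nil _ (p.vert_mem_support s), by simp [edges]⟩
  | succ t hst ih =>
    obtain ⟨q, hq⟩ := ih (by omega)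
    have h1 : p.edges[t]? = some (p.edges[t]'(by omega)) := List.getElem?_eq_getElem _
    have hct := hc t
    have h2 : (2 * t + c t) / 2 = t := by omega
    have hl : p.double.IsLink (p.edges[t]'(by omega), 2 * t + c t) (p.vert t)
        (p.vert (t + 1)) := ⟨by simp only [h2]; exact h1, p.isLink_vert h1⟩
    refine ⟨q.append (cons _ hl (nil _ hl.right_mem)), ?_⟩
    intro e he
    rw [edges_append, List.mem_append] at he
    rcases he with he | he
    · obtain ⟨h3, h4, h5⟩ := hq e he
      exact ⟨h3, by omega, h5⟩
    · simp only [edges, List.mem_singleton] at he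
      subst he
      simp only [h2]
      exact ⟨hst, by omega, by omega⟩

/-- Each interval or its complement can be chosen so that no position is covered three times.
Without a common position, all intervals are chosen. Otherwise some interval is contained in the
union of the one starting first and the one ending last; it is kept and the other two are
complemented. -/
theorem exists_arcs (l h : Fin 3 → ℕ) : ∃ b : Fin 3 → Bool, ∀ j, ∃ i,
    ¬ (b i = true ↔ (l i ≤ j ∧ j < h i)) := by
  by_cases hcom : ∃ j, ∀ i, l i ≤ j ∧ j < h i
  · obtain ⟨j₀, hj₀⟩ := hcom
    obtain ⟨i₁, hi₁⟩ := Finite.exists_min l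
    obtain ⟨i₂, hi₂⟩ := Finite.exists_max h
    obtain ⟨k, hk1, hk2⟩ : ∃ k : Fin 3, k ≠ i₁ ∧ k ≠ i₂ := by
      clear hi₁ hi₂
      revert i₁ i₂
      decide
    refine ⟨fun i => decide (i = k), fun j => ?_⟩
    by_contra hcon
    push Not at hcon
    have e0 := (hcon k).1 (by simp)
    have e1 : ¬ (l i₁ ≤ j ∧ j < h i₁) := fun hh => by
      have := (hcon i₁).2 hh
      simp only [decide_eq_true_eq] at this
      exact hk1 this.symm
    have e2 : ¬ (l i₂ ≤ j ∧ j < h i₂) := fun hh => by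
      have := (hcon i₂).2 hh
      simp only [decide_eq_true_eq] at this
      exact hk2 this.symm
    have := hi₁ k
    have := hi₂ k
    have := hj₀ i₁
    have := hj₀ i₂
    omega
  · refine ⟨fun _ => true, fun j => ?_⟩
    by_contra hcon
    push Not at hcon
    exact hcom ⟨j, fun i => (hcon i).1 rfl⟩

/-- The closed walk offers two routes between two positions: directly if `b = true`, and around
through the base point if `b = false`. The function `c` prescribes which copy is used at each
position. -/
theorem exists_walk_double_arc (p : Walk H x x) (c : ℕ → ℕ) (hc : ∀ j, c j < 2)
    {s t : ℕ} (hst : s ≤ t) (ht : t ≤ p.edges.length) (b : Bool) :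
    ∃ q : Walk p.double (p.vert s) (p.vert t), ∀ e ∈ q.edges,
      (b = true ↔ (s ≤ e.2 / 2 ∧ e.2 / 2 < t)) ∧ e.2 % 2 = c (e.2 / 2) := by
  cases b with
  | true =>
    obtain ⟨q, hq⟩ := p.exists_walk_double_segment c hc hst ht
    exact ⟨q, fun e he => ⟨by simp [(hq e he).1, (hq e he).2.1], (hq e he).2.2⟩⟩
  | false =>
    obtain ⟨q, hq⟩ := p.exists_walk_double_segment c hc (Nat.zero_le s) (hst.trans ht)
    have h1 := p.exists_walk_double_segment c hc ht le_rfl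
    rw [show p.vert p.edges.length = p.vert 0 by rw [vert_length, vert_zero]] at h1
    obtain ⟨q', hq'⟩ := h1
    refine ⟨(q'.append q).reverse, fun e he => ?_⟩
    rw [edges_reverse, List.mem_reverse, edges_append, List.mem_append] at he
    simp only [Bool.false_eq_true, false_iff]
    rcases he with he | he
    · have := hq' e he
      exact ⟨by omega, this.2.2⟩
    · have := hq e he
      exact ⟨by omega, this.2.2⟩

/-- Any three pairs of vertices of a doubled closed walk are linked. -/
theorem double_linked (p : Walk H x x) (u v : Fin 3 → α) (hu : ∀ i, u i ∈ V(p.double))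
    (hv : ∀ i, v i ∈ V(p.double)) : HasThreeEdgeDisjointPaths p.double u v := by
  classical
  choose s hs hsu using fun i => p.exists_vert_of_mem_support (hu i)
  choose t ht htv using fun i => p.exists_vert_of_mem_support (hv i)
  obtain ⟨b, hb⟩ := exists_arcs (fun i => min (s i) (t i)) (fun i => max (s i) (t i))
  let used : Fin 3 → ℕ → Prop := fun i j =>
    b i = true ↔ (min (s i) (t i) ≤ j ∧ j < max (s i) (t i))
  -- Greedy choice of copies: the first user of a position gets copy `0`, later ones copy `1`.
  let c : Fin 3 → ℕ → ℕ := fun i j => if ∃ i' < i, used i' j then 1 else 0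
  have hc : ∀ i j, c i j < 2 := fun i j => by
    simp only [c]
    split_ifs <;> omega
  have hq : ∀ i, ∃ q : Walk p.double (u i) (v i), q.IsPath ∧
      ∀ e ∈ q.edges, used i (e.2 / 2) ∧ e.2 % 2 = c i (e.2 / 2) := by
    intro i
    have : ∃ q : Walk p.double (u i) (v i),
        ∀ e ∈ q.edges, used i (e.2 / 2) ∧ e.2 % 2 = c i (e.2 / 2) := by
      have harc := p.exists_walk_double_arc (c i) (hc i)
        (s := min (s i) (t i)) (t := max (s i) (t i)) min_le_max (max_le (hs i) (ht i)) (b i)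
      rw [← hsu i, ← htv i]
      simp only [used]
      rcases le_total (s i) (t i) with h | h
      · rw [min_eq_left h, max_eq_right h] at harc ⊢
        exact harc
      · rw [min_eq_right h, max_eq_left h] at harc ⊢
        obtain ⟨q, hq⟩ := harc
        refine ⟨q.reverse, fun e he => ?_⟩
        rw [edges_reverse, List.mem_reverse] at he
        exact hq e he
    obtain ⟨q, hq⟩ := this
    obtain ⟨q', h1, h2⟩ := q.exists_path
    exact ⟨q', h1, fun e he => hq e (h2 he)⟩
  choose q hq1 hq2 using hq
  refine ⟨q, hq1, ?_⟩
  have key : ∀ i i', i < i' → ∀ e, e ∈ (q i).edges → e ∉ (q i').edges := by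
    intro i i' hlt e he he'
    obtain ⟨h1, h2⟩ := hq2 i e he
    obtain ⟨h3, h4⟩ := hq2 i' e he'
    have e1 : c i' (e.2 / 2) = 1 := if_pos ⟨i, hlt, h1⟩
    rw [h4, e1] at h2
    -- A collision must happen on copy `1`, so the earlier user `i` was itself preceded by another
    -- one; then all three use this position, contrary to `hb`.
    have e2 : ∃ i'' < i, used i'' (e.2 / 2) := by
      by_contra hcon
      simp only [c, if_neg hcon] at h2
      omega
    obtain ⟨i'', hlt', h5⟩ := e2
    obtain ⟨k, hk⟩ := hb (e.2 / 2)
    have : k = i ∨ k = i' ∨ k = i'' := by omega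
    rcases this with rfl | rfl | rfl
    · exact hk h1
    · exact hk h3
    · exact hk h5
  intro i i' hne e he he'
  rcases lt_or_gt_of_ne hne with h | h
  · exact key i i' h e he he'
  · exact key i' i h e he' he

theorem isConnected_double (p : Walk H x x) : IsConnected p.double := by
  refine ⟨⟨x, p.start_mem_support⟩, fun u hu v hv => ?_⟩
  obtain ⟨q, -⟩ := p.double_linked (fun _ => u) (fun _ => v) (fun _ => hu) fun _ => hv
  exact ⟨q 0⟩

end Walk

end BrickForest

/-! ### Boundary paths, and trees with few joining vertices -/

namespace BrickForest

namespace Walk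

variable {α : Type*} {β : Type*} {H : Graph α β}

theorem mem_support_append : ∀ {x y z : α} (p : Walk H x y) (q : Walk H y z) {v : α},
    v ∈ (p.append q).support ↔ v ∈ p.support ∨ v ∈ q.support
  | _, _, _, nil x _, q, v => by
    simp only [append, support, List.mem_singleton]
    exact ⟨Or.inr, fun h => h.elim (fun h => h ▸ q.start_mem_support) id⟩
  | _, _, _, cons e h p, q, v => by
    simp [append, support, mem_support_append p q, or_assoc]

end Walk

theorem wdist_le {α β : Type*} {w : β → ℝ} (hw : ∀ e, 0 ≤ w e) {H : Graph α β} {x y : α}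
    (p : Walk H x y) : wdist w H x y ≤ p.weight w := by
  refine csInf_le ⟨0, ?_⟩ ⟨p, rfl⟩
  rintro _ ⟨q, rfl⟩
  exact q.weight_nonneg hw

section Leaves

variable {α β : Type*} {T : Graph α β} {PV : Set α} {PE : Set β}

/-- A connected multigraph whose leaves are exactly its joining vertices with a path has no edge
on the path, unless it has no leaves at all. -/
theorem disjoint_of_leaves_eq_joiningVertices (hc : IsConnected T)
    (hl : leaves T = joiningVertices T PV PE) (hne : (leaves T).Nonempty)
    (hPE : ∀ e ∈ PE, ∀ x, T.Inc e x → x ∈ PV) : Disjoint E(T) PE := by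
  rw [Set.disjoint_left]
  intro e heT heP
  obtain ⟨a, b, hab⟩ := T.exists_isLink_of_mem_edgeSet heT
  -- A vertex with edges both on and off the path would be a joining vertex, hence a leaf, but a
  -- leaf has only one edge. Being on the path thus spreads through the connected `T`, up to a leaf,
  -- which has an edge off the path.
  have key : ∀ x, (∃ f ∈ PE, T.Inc f x) → ∀ f, T.Inc f x → f ∈ PE := by
    rintro x ⟨f, hf, hfx⟩ f' hfx'
    by_contra hf'
    have hx : x ∈ leaves T := hl ▸ ⟨hPE f hf x hfx, f', hf', hfx'⟩
    exact hf' (hx.2.unique hfx hfx' ▸ hf)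
  have walk : ∀ {x y : α}, Walk T x y → (∃ f ∈ PE, T.Inc f x) → ∃ f ∈ PE, T.Inc f y := by
    intro x y p
    induction p with
    | nil => exact id
    | cons g h p ih => exact fun hx => ih ⟨g, key _ hx g h.inc_left, h.inc_right⟩
  obtain ⟨y, hy⟩ := hne
  obtain ⟨p⟩ := hc.2 a hab.left_mem y hy.1
  have hyP := walk p ⟨e, heP, hab.inc_left⟩
  rw [hl] at hy
  obtain ⟨-, f, hf, hfy⟩ := hy
  exact hf (key y hyP f hfy)

/-- As `T` has no edge on the path, any edge of `T` at `x` makes `x` a joining vertex. Hence a tree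
has only one edge at each vertex of the boundary paths that it meets. -/
theorem mem_leaves_of_mem_path (hc : IsConnected T)
    (hl : leaves T = joiningVertices T PV PE) (hne : (leaves T).Nonempty)
    (hPE : ∀ e ∈ PE, ∀ x, T.Inc e x → x ∈ PV) {x : α} (hx : x ∈ V(T)) (hxP : x ∈ PV) :
    x ∈ leaves T := by
  obtain ⟨y, hy⟩ := hne
  by_cases hxy : x = y
  · exact hxy ▸ hy
  · obtain ⟨p⟩ := hc.2 x hx y hy.1
    cases p with
    | nil => exact absurd rfl hxy
    | cons e h p =>
      rw [hl]
      refine ⟨hxP, e, fun he => ?_, h.inc_left⟩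
      exact Set.disjoint_left.1 (disjoint_of_leaves_eq_joiningVertices hc hl ⟨y, hy⟩ hPE)
        h.edge_mem he

end Leaves

namespace PlaneGraph

namespace BoundaryPath

variable {V : Type*} {E : Type*} {G : PlaneGraph V E} {o : E × Bool}

theorem vertex_inj (P : G.BoundaryPath o) {i j : ℕ} (hi : i ≤ P.length) (hj : j ≤ P.length)
    (h : P.vertex i = P.vertex j) : i = j :=
  P.injOn hi hj h

theorem isLink_edge (P : G.BoundaryPath o) (i : ℕ) :
    G.toGraph.IsLink (P.edge i) (P.vertex i) (P.vertex (i + 1)) := by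
  have := G.isLink_dart ((G.face ^ i) P.start)
  rwa [← src_face, ← face_pow_succ] at this

theorem distAlong_nonneg (P : G.BoundaryPath o) {w : E → ℝ} (hw : ∀ e, 0 ≤ w e) (i j : ℕ) :
    0 ≤ P.distAlong w i j :=
  Finset.sum_nonneg fun _ _ => hw _

theorem exists_walk_along (P : G.BoundaryPath o) {i j : ℕ} (hij : i ≤ j) :
    ∃ p : Walk G.toGraph (P.vertex i) (P.vertex j),
      (∀ e ∈ p.edges, ∃ m, i ≤ m ∧ m < j ∧ P.edge m = e) ∧
      (∀ m, i ≤ m → m ≤ j → P.vertex m ∈ p.support) ∧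
      ∀ w : E → ℝ, p.weight w = P.distAlong w i j := by
  induction j, hij using Nat.le_induction with
  | base =>
    refine ⟨Walk.nil _ (Set.mem_univ _), by simp [Walk.edges], fun m h1 h2 => ?_, fun w => ?_⟩
    · rw [le_antisymm h2 h1]
      simp [Walk.support]
    · simp [Walk.weight, Walk.edges, distAlong]
  | succ j hij ih =>
    obtain ⟨p, h1, h2, h3⟩ := ih
    let q : Walk G.toGraph (P.vertex j) (P.vertex (j + 1)) :=
      Walk.cons _ (P.isLink_edge j) (Walk.nil _ (Set.mem_univ _))
    refine ⟨p.append q, fun e he => ?_, fun m hm1 hm2 => ?_, fun w => ?_⟩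
    · rw [Walk.edges_append, List.mem_append] at he
      rcases he with he | he
      · obtain ⟨m, hm, hm', rfl⟩ := h1 e he
        exact ⟨m, hm, by omega, rfl⟩
      · simp only [q, Walk.edges, List.mem_singleton] at he
        exact ⟨j, hij, by omega, he.symm⟩
    · rw [Walk.mem_support_append]
      rcases Nat.lt_or_ge j m with h | h
      · right
        rw [show m = j + 1 by omega]
        exact q.end_mem_support
      · exact Or.inl (h2 m hm1 h)
    · rw [Walk.weight_append, h3, distAlong, distAlong, Finset.sum_Ico_succ_top hij]
      simp [q, Walk.weight, Walk.edges]

theorem distAlong_le_of_isShort {P : G.BoundaryPath o} {w : E → ℝ} {ε : ℝ}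
    (hP : P.IsShort w ε) (hw : ∀ e, 0 ≤ w e) (hε : 0 ≤ ε) {i j : ℕ} (hij : i ≤ j)
    (hj : j ≤ P.length) {T : Graph V E} (hT : T ≤ G.toGraph)
    (p : Walk T (P.vertex i) (P.vertex j)) :
    P.distAlong w i j ≤ (1 + ε) * p.weight w := by
  obtain ⟨q, hq⟩ := p.exists_mono hT
  refine (hP i j hij hj).trans (mul_le_mul_of_nonneg_left ?_ (by linarith))
  have := wdist_le hw q
  rwa [Walk.weight, hq] at this

theorem edge_inc_mem_verts (P : G.BoundaryPath o) {e : E} (he : e ∈ P.edgs) {x : V}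
    (hx : G.toGraph.Inc e x) : x ∈ P.verts := by
  obtain ⟨i, hi, rfl⟩ := he
  have hi' : i < P.length := hi
  rcases hx.eq_or_eq_of_isLink (P.isLink_edge i) with rfl | rfl
  · exact ⟨i, hi'.le, rfl⟩
  · exact ⟨i + 1, hi', rfl⟩

/-- The position of a vertex on the path. -/
noncomputable def pos (P : G.BoundaryPath o) (x : V) : ℕ :=
  Function.invFunOn P.vertex (Set.Iic P.length) x

theorem pos_le (P : G.BoundaryPath o) {x : V} (hx : x ∈ P.verts) : P.pos x ≤ P.length :=
  Function.invFunOn_mem hx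

theorem vertex_pos (P : G.BoundaryPath o) {x : V} (hx : x ∈ P.verts) : P.vertex (P.pos x) = x :=
  Function.invFunOn_eq hx

theorem pos_vertex (P : G.BoundaryPath o) {i : ℕ} (hi : i ≤ P.length) :
    P.pos (P.vertex i) = i :=
  have hx : P.vertex i ∈ P.verts := ⟨i, hi, rfl⟩
  P.vertex_inj (P.pos_le hx) hi (P.vertex_pos hx)

theorem distAlong_pos_le {P : G.BoundaryPath o} {w : E → ℝ} {ε : ℝ}
    (hP : P.IsShort w ε) (hw : ∀ e, 0 ≤ w e) (hε : 0 ≤ ε) {T : Graph V E} (hT : T ≤ G.toGraph)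
    {x y : V} (hx : x ∈ P.verts) (hy : y ∈ P.verts) (hxy : P.pos x ≤ P.pos y)
    (p : Walk T x y) : P.distAlong w (P.pos x) (P.pos y) ≤ (1 + ε) * p.weight w := by
  obtain ⟨i, hi, rfl⟩ := hx
  obtain ⟨j, hj, rfl⟩ := hy
  rw [P.pos_vertex hi, P.pos_vertex hj] at hxy ⊢
  exact distAlong_le_of_isShort hP hw hε hxy hj hT p

/-- A walk along the path in either direction. -/
theorem exists_walk_between (P : G.BoundaryPath o) {l h i j : ℕ} (hi : l ≤ i ∧ i ≤ h)
    (hj : l ≤ j ∧ j ≤ h) : ∃ p : Walk G.toGraph (P.vertex i) (P.vertex j),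
      ∀ e ∈ p.edges, ∃ m, l ≤ m ∧ m < h ∧ P.edge m = e := by
  rcases le_total i j with hij | hij
  · obtain ⟨p, hp, -⟩ := P.exists_walk_along hij
    refine ⟨p, fun e he => ?_⟩
    obtain ⟨m, h1, h2, h3⟩ := hp e he
    exact ⟨m, by omega, by omega, h3⟩
  · obtain ⟨p, hp, -⟩ := P.exists_walk_along hij
    refine ⟨p.reverse, fun e he => ?_⟩
    rw [Walk.edges_reverse, List.mem_reverse] at he
    obtain ⟨m, h1, h2, h3⟩ := hp e he
    exact ⟨m, by omega, by omega, h3⟩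

/-- The list of the edges of the path between two positions. -/
def edgesBetween (P : G.BoundaryPath o) (i j : ℕ) : List E :=
  (List.range' i (j - i)).map P.edge

theorem mem_edgesBetween (P : G.BoundaryPath o) {i j : ℕ} {e : E} :
    e ∈ P.edgesBetween i j ↔ ∃ m, i ≤ m ∧ m < j ∧ P.edge m = e := by
  simp only [edgesBetween, List.mem_map, List.mem_range'_1]
  constructor
  · rintro ⟨m, hm, rfl⟩
    exact ⟨m, by omega, by omega, rfl⟩
  · rintro ⟨m, h1, h2, rfl⟩
    exact ⟨m, by omega, rfl⟩

theorem sum_edgesBetween (P : G.BoundaryPath o) (w : E → ℝ) (i j : ℕ) :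
    ((P.edgesBetween i j).map w).sum = P.distAlong w i j := by
  rw [edgesBetween, List.map_map]
  rfl

end BoundaryPath

end PlaneGraph

section FewJoining

open PlaneGraph

variable {V : Type*} {E : Type*} {G : PlaneGraph V E} {o : E × Bool}
  {w : E → ℝ} {ε : ℝ} {T : Graph V E} {PV : Set V} {PE : Set E}

/-- A connected subgraph can be replaced by few of its edges and parts of a short path, while
keeping the connections between `q` and the vertices of `S` on the path. -/
theorem exists_few_joining [Finite V] [Finite E] (P : G.BoundaryPath o) (hP : P.IsShort w ε)
    (hw : ∀ e, 0 ≤ w e) (hε : 0 ≤ ε) (hT : T ≤ G.toGraph) (hc : IsConnected T) {q : V}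
    (hq : q ∈ V(T)) {S : Set V} (hne : S.Nonempty) (hST : S ⊆ V(T)) (hSP : S ⊆ P.verts)
    (hPE : P.edgs ⊆ PE) (hu : ∀ x ∈ PV, ∀ e e', T.Inc e x → T.Inc e' x → e = e') {k : ℕ}
    (hk : 1 ≤ ε * (2 * (2 ^ k - 1) + 1)) :
    ∃ L : List E, (L.map w).sum ≤ (1 + 2 * ε) * weight w T ∧
      (∀ x ∈ S, ∃ p : Walk G.toGraph q x, ∀ e ∈ p.edges, e ∈ L) ∧
      (∀ e ∈ L, e ∉ PE → e ∈ E(T)) ∧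
      {x | x ∈ PV ∧ ∃ e ∈ L, e ∉ PE ∧ G.toGraph.Inc e x}.ncard ≤ 2 ^ k + 1 := by
  classical
  obtain ⟨t₀, ht₀, ht₀'⟩ := RTree.exists_spanning hc hq
  obtain ⟨x₀, hx₀⟩ := hne
  obtain ⟨t, ht1, ht2⟩ := t₀.exists_prune S ⟨x₀, ht₀ x₀ (hST hx₀), hx₀⟩
  have htn : t.edges.Nodup := ht2.nodup ht₀'
  have htw : t.wt w ≤ weight w T :=
    list_sum_le_weight hw (Set.toFinite _) htn fun e he => t.edges_subset he
  have ht1' : ∀ y ∈ t.leafVerts, y ∈ S := fun y hy => ((ht1 y).1 hy).2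
  obtain ⟨s, hs, hlen, hcost, -⟩ := RTree.exists_simplification (w := w) (idx := P.pos)
    (span := P.distAlong w) (a := 1 + ε) (S := S) hw (by linarith) (by
      intro x y p hx hy hxy
      exact BoundaryPath.distAlong_pos_le hP hw hε hT (hSP hx) (hSP hy) hxy p) t ht1' k
  -- The edges of the simplified tree, and the part of `P` prescribed by the interval at each leaf.
  refine ⟨s.edges ++ s.leaves.flatMap fun l => P.edgesBetween l.2.1 l.2.2, ?_, ?_, ?_, ?_⟩
  · have hsum : ((s.edges ++ s.leaves.flatMap fun l => P.edgesBetween l.2.1 l.2.2).map w).sum =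
        s.cost w (P.distAlong w) := by
      rw [List.map_append, List.sum_append, RTree.cost, RTree.wt]
      congr 1
      generalize s.leaves = Z
      induction Z with
      | nil => simp
      | cons z Z ih => simp [ih, BoundaryPath.sum_edgesBetween]
    rw [hsum]
    have hdlo : 0 ≤ t.dlo w P.pos := by
      obtain ⟨y, -, -, p, hp⟩ := RTree.exists_walk_lo (w := w) (idx := P.pos) t
      exact hp ▸ p.weight_nonneg hw
    have h0 := t.wt_nonneg hw
    have hle : s.cost w (P.distAlong w) ≤ (1 + 2 * ε) * t.wt w := by
      -- A positive excess is, by `hk`, at most `ε * (2 * (2 ^ k - 1) + 1)` times itself, hence at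
      -- most `ε * t.wt w`.
      by_cases hx : s.cost w (P.distAlong w) - (1 + ε) * t.wt w ≤ 0
      · nlinarith
      · push Not at hx
        nlinarith [mul_le_mul_of_nonneg_left hcost hε, mul_le_mul_of_nonneg_right hk hx.le,
          mul_nonneg hε hdlo]
    exact hle.trans (mul_le_mul_of_nonneg_left htw (by linarith))
  · intro x hx
    obtain ⟨l, hl, h1, h2⟩ := hs.cover x ((ht1 x).2 ⟨ht₀ x (hST hx), hx⟩)
    obtain ⟨h3, h4, h5, -⟩ := hs.mem_leaf l hl
    have hl1 : l.1 ∈ s.leafVerts := by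
      rw [← RTree.map_leaves]
      exact List.mem_map_of_mem hl
    obtain ⟨p, hp⟩ := s.exists_walk_leaf hl1
    obtain ⟨p', hp'⟩ := p.exists_mono hT
    have hb := P.exists_walk_between (i := P.pos l.1) (j := P.pos x) ⟨h4, h5⟩ ⟨h1, h2⟩
    rw [P.vertex_pos (hSP (ht1' _ h3)), P.vertex_pos (hSP hx)] at hb
    obtain ⟨r, hr⟩ := hb
    refine ⟨p'.append r, fun e he => ?_⟩
    rw [Walk.edges_append, List.mem_append, hp'] at he
    rw [List.mem_append]
    rcases he with he | he
    · exact Or.inl (hp.subset he)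
    · exact Or.inr (List.mem_flatMap.2 ⟨l, hl, P.mem_edgesBetween.2 (hr e he)⟩)
  · intro e he heP
    rw [List.mem_append, List.mem_flatMap] at he
    rcases he with he | ⟨l, hl, he⟩
    · exact s.edges_subset he
    · obtain ⟨m, h1, h2, rfl⟩ := P.mem_edgesBetween.1 he
      -- The upper end of the interval is the position of a leaf of `t`, so the interval does not
      -- run beyond the end of `P`.
      obtain ⟨-, -, -, y, hy, hy'⟩ := hs.mem_leaf l hl
      exact absurd (hPE ⟨m, lt_of_lt_of_le h2 (hy' ▸ P.pos_le (hSP (ht1' y hy))), rfl⟩) heP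
  -- A boundary vertex has only one edge of `T`, so it can meet the edges of `s` only as a leaf or
  -- as the root; the root accounts for the `+ 1`.
  · have hsub : {x | x ∈ PV ∧ ∃ e ∈ s.edges ++ s.leaves.flatMap fun l =>
        P.edgesBetween l.2.1 l.2.2, e ∉ PE ∧ G.toGraph.Inc e x} ⊆
        ((insert q s.leafVerts.toFinset : Finset V) : Set V) := by
      rintro x ⟨hx, e, he, heP, hex⟩
      rw [List.mem_append, List.mem_flatMap] at he
      have he' : e ∈ s.edges := by
        rcases he with he | ⟨l, hl, he⟩
        · exact he
        · obtain ⟨m, h1, h2, rfl⟩ := P.mem_edgesBetween.1 he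
          obtain ⟨-, -, -, y, hy, hy'⟩ := hs.mem_leaf l hl
          exact absurd (hPE ⟨m, lt_of_lt_of_le h2 (hy' ▸ P.pos_le (hSP (ht1' y hy))), rfl⟩) heP
      rw [Finset.mem_coe, Finset.mem_insert, List.mem_toFinset]
      by_cases hxq : x = q
      · exact Or.inl hxq
      · exact Or.inr (RTree.mem_leafVerts_of_inc (hu x hx) s
          (hs.edges_sublist.nodup htn) hxq e he'
          ((hT.inc_congr (s.edges_subset he')).2 hex))
    refine (Set.ncard_le_ncard hsub (Finset.finite_toSet _)).trans ?_
    rw [Set.ncard_coe_finset]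
    refine (Finset.card_insert_le _ _).trans (Nat.add_le_add_right ?_ 1)
    refine (List.toFinset_card_le _).trans ?_
    rw [← RTree.map_leaves, List.length_map]
    exact hlen

theorem weight_copies_le {w : E → ℝ} (hw : ∀ e, 0 ≤ w e) {T' : Graph V (E × ℕ)} {L : List E}
    {tag : ℕ} (h : ∀ e ∈ E(T'), e.1 ∈ L ∧ e.2 = tag) :
    weight (fun e : E × ℕ => w e.1) T' ≤ (L.map w).sum := by
  refine (weight_le_list_sum (L := L.map fun e => (e, tag)) (fun e => hw e.1) ?_).trans ?_
  · rintro ⟨e, m⟩ he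
    obtain ⟨h1, rfl⟩ := h _ he
    exact List.mem_map_of_mem h1
  · rw [List.map_map]
    rfl

theorem exists_walk_copies {H : Graph V E} {x y : V} (p : Walk H x y) (tag : ℕ) :
    ∃ q : Walk (copies H) x y, q.edges = p.edges.map fun e => (e, tag) := by
  obtain ⟨q, hq, -⟩ := p.exists_map (H' := copies H) (fun e => (e, tag)) p.left_mem
    (fun e _ a b h => h)
  exact ⟨q, hq⟩

/-- A tree with the given tag that spans the leaves of `T`, obtained from a list of edges. -/
theorem exists_tree_of_list {L : List E} {S : Set V} {q : V} (hw : ∀ e, 0 ≤ w e)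
    [Finite V] (hL : ∀ x ∈ S, ∃ p : Walk G.toGraph q x, ∀ e ∈ p.edges, e ∈ L) (tag : ℕ) :
    ∃ T' ≤ copies G.toGraph, IsTree T' ∧ Spans T' S ∧ (∀ e ∈ E(T'), e.2 = tag) ∧
      weight (fun e => w e.1) T' ≤ (L.map w).sum ∧
      (joiningVertices T' PV {e | e.1 ∈ PE}).ncard ≤
        {x | x ∈ PV ∧ ∃ e ∈ L, e ∉ PE ∧ G.toGraph.Inc e x}.ncard := by
  classical
  obtain ⟨T', h1, h2, h3, h4⟩ := exists_tree_of_edges (H := copies G.toGraph) (r := q)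
    (X := {e | e.1 ∈ L ∧ e.2 = tag}) (S := S) (Set.mem_univ _) (by
      refine ((L.map fun e => (e, tag)).toFinset.finite_toSet).subset ?_
      rintro ⟨e, m⟩ ⟨he, rfl⟩
      simpa using he) (by
      intro x hx
      obtain ⟨p, hp⟩ := hL x hx
      obtain ⟨p', hp'⟩ := exists_walk_copies p tag
      refine ⟨p', fun e he => ?_⟩
      rw [hp', List.mem_map] at he
      obtain ⟨f, hf, rfl⟩ := he
      exact ⟨hp f hf, rfl⟩)
  refine ⟨T', h1, h2, h3, fun e he => (h4 he).2, weight_copies_le hw h4,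
    Set.ncard_le_ncard ?_ (Set.toFinite _)⟩
  rintro x ⟨hx, e, he, hex⟩
  obtain ⟨y, hy⟩ := hex.mono h1
  exact ⟨hx, e.1, (h4 hex.edge_mem).1, he, y, hy⟩

/-- A tree with leaves on a short path `P`, and possibly some on an interval of a path `P'`, is
replaced by a tree with few joining vertices. -/
theorem exists_tree_few_joining [Finite V] [Finite E] (P P' : G.BoundaryPath o)
    (hP : P.IsShort w ε) (hw : ∀ e, 0 ≤ w e) (hε : 0 ≤ ε) (hT : T ≤ G.toGraph)
    (hc : IsConnected T) (hPE : P.edgs ⊆ PE) (hPE' : P'.edgs ⊆ PE)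
    (hu : ∀ x ∈ PV, ∀ e e', T.Inc e x → T.Inc e' x → e = e') {k : ℕ}
    (hk : 1 ≤ ε * (2 * (2 ^ k - 1) + 1)) {a b c : ℕ} (hac : a ≤ c) (hcb : c ≤ b)
    (hb : b ≤ P'.length) (hq : P'.vertex c ∈ V(T)) (hne : (leaves T ∩ P.verts).Nonempty)
    (hl : ∀ x ∈ leaves T, x ∈ P.verts ∨ ∃ m, a ≤ m ∧ m ≤ b ∧ P'.vertex m = x) (tag : ℕ) :
    ∃ T' ≤ copies G.toGraph, IsTree T' ∧ Spans T' (leaves T) ∧ (∀ e ∈ E(T'), e.2 = tag) ∧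
      weight (fun e => w e.1) T' ≤ (1 + 2 * ε) * weight w T + P'.distAlong w a b ∧
      (joiningVertices T' PV {e | e.1 ∈ PE}).ncard ≤ 2 ^ k + 1 := by
  obtain ⟨L, h1, h2, h3, h4⟩ := exists_few_joining P hP hw hε hT hc hq hne
    (fun x hx => hx.1.1) (fun x hx => hx.2) hPE hu hk
  obtain ⟨T', g1, g2, g3, g4, g5, g6⟩ := exists_tree_of_list (G := G) (PV := PV) (PE := PE)
    (L := L ++ P'.edgesBetween a b) (S := leaves T) (q := P'.vertex c) hw (by
      intro x hx
      rcases hl x hx with h | ⟨m, hm1, hm2, rfl⟩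
      · obtain ⟨p, hp⟩ := h2 x ⟨hx, h⟩
        exact ⟨p, fun e he => List.mem_append_left _ (hp e he)⟩
      · obtain ⟨p, hp⟩ := P'.exists_walk_between ⟨hac, hcb⟩ ⟨hm1, hm2⟩
        exact ⟨p, fun e he => List.mem_append_right _ (P'.mem_edgesBetween.2 (hp e he))⟩) tag
  refine ⟨T', g1, g2, g3, g4, ?_, ?_⟩
  · rw [List.map_append, List.sum_append, P'.sum_edgesBetween] at g5
    linarith
  · refine (g6.trans (Set.ncard_le_ncard ?_ (Set.toFinite _))).trans h4
    rintro x ⟨hx, e, he, heP, hex⟩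
    rw [List.mem_append] at he
    rcases he with he | he
    · exact ⟨hx, e, he, heP, hex⟩
    · obtain ⟨m, hm1, hm2, rfl⟩ := P'.mem_edgesBetween.1 he
      exact absurd (hPE' ⟨m, lt_of_lt_of_le hm2 hb, rfl⟩) heP

/-- A tagged copy of a tree with few leaves. -/
theorem exists_tree_copy [Finite V] [Finite E] (hw : ∀ e, 0 ≤ w e) (hT : T ≤ G.toGraph)
    (hc : IsConnected T) (hl : ∀ x ∈ PV, x ∈ V(T) → x ∈ leaves T) (tag : ℕ) :
    ∃ T' ≤ copies G.toGraph, IsTree T' ∧ Spans T' (leaves T) ∧ (∀ e ∈ E(T'), e.2 = tag) ∧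
      weight (fun e => w e.1) T' ≤ weight w T ∧
      (joiningVertices T' PV {e | e.1 ∈ PE}).ncard ≤ (leaves T).ncard := by
  classical
  obtain ⟨q, hq⟩ := hc.1
  have hf : E(T).Finite := Set.toFinite _
  obtain ⟨T', g1, g2, g3, g4, g5, g6⟩ := exists_tree_of_list (G := G) (PV := PV) (PE := PE)
    (L := hf.toFinset.toList) (S := leaves T) (q := q) hw (by
      intro x hx
      obtain ⟨p⟩ := hc.2 q hq x hx.1
      obtain ⟨p', hp'⟩ := p.exists_mono hT
      refine ⟨p', fun e he => ?_⟩
      rw [hp'] at he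
      simpa using p.edges_subset he) tag
  refine ⟨T', g1, g2, g3, g4, g5.trans (list_sum_le_weight hw hf (Finset.nodup_toList _)
    (by simp)), g6.trans (Set.ncard_le_ncard ?_ (Set.toFinite _))⟩
  rintro x ⟨hx, e, he, -, hex⟩
  have he' : e ∈ E(T) := by simpa using he
  exact hl x hx ((hT.inc_congr he').2 hex).vertex_mem

end FewJoining

end BrickForest

/-! ### Positions on the two paths, and consequences of non-crossing -/

namespace BrickForest

open PlaneGraph

namespace PlaneGraph.BoundaryPath

variable {V : Type*} {E : Type*} {G : PlaneGraph V E} {o : E × Bool}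

/-- The least position on the path of a vertex in `S`. -/
noncomputable def loPos (P : G.BoundaryPath o) (S : Set V) : ℕ :=
  sInf {i | i ≤ P.length ∧ P.vertex i ∈ S}

/-- The largest position on the path of a vertex in `S`. -/
noncomputable def hiPos (P : G.BoundaryPath o) (S : Set V) : ℕ :=
  sSup {i | i ≤ P.length ∧ P.vertex i ∈ S}

variable {P : G.BoundaryPath o} {S : Set V}

theorem nonempty_positions (h : (S ∩ P.verts).Nonempty) :
    {i | i ≤ P.length ∧ P.vertex i ∈ S}.Nonempty := by
  obtain ⟨_, hx, i, hi, rfl⟩ := h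
  exact ⟨i, hi, hx⟩

theorem loPos_mem (h : (S ∩ P.verts).Nonempty) :
    P.loPos S ≤ P.length ∧ P.vertex (P.loPos S) ∈ S :=
  Nat.sInf_mem (nonempty_positions h)

theorem loPos_le {i : ℕ} (hi : i ≤ P.length) (hS : P.vertex i ∈ S) : P.loPos S ≤ i :=
  Nat.sInf_le ⟨hi, hS⟩

theorem hiPos_mem (h : (S ∩ P.verts).Nonempty) :
    P.hiPos S ≤ P.length ∧ P.vertex (P.hiPos S) ∈ S :=
  Nat.sSup_mem (nonempty_positions h) ⟨P.length, fun _ hi => hi.1⟩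

theorem le_hiPos {i : ℕ} (hi : i ≤ P.length) (hS : P.vertex i ∈ S) : i ≤ P.hiPos S :=
  le_csSup ⟨P.length, fun _ hi => hi.1⟩ ⟨hi, hS⟩

theorem loPos_le_hiPos (h : (S ∩ P.verts).Nonempty) : P.loPos S ≤ P.hiPos S :=
  loPos_le (hiPos_mem h).1 (hiPos_mem h).2

theorem mem_ends_iff {i : ℕ} (hi : i ≤ P.length) :
    P.vertex i ∈ P.ends ↔ i = 0 ∨ i = P.length := by
  constructor
  · rintro (h | h)
    · exact Or.inl (P.vertex_inj hi (Nat.zero_le _) h)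
    · exact Or.inr (P.vertex_inj hi le_rfl h)
  · rintro (rfl | rfl)
    · exact Or.inl rfl
    · exact Or.inr rfl

theorem length_lt_minimalPeriod [Finite E] (P : G.BoundaryPath o) :
    P.length < Function.minimalPeriod G.face P.start := by
  by_contra h
  push Not at h
  have h0 := minimalPeriod_perm_pos G.face P.start
  have : P.vertex (Function.minimalPeriod G.face P.start) = P.vertex 0 := by
    rw [vertex, pow_minimalPeriod_apply]
    rfl
  have := P.vertex_inj h (Nat.zero_le _) this
  omega

/-- The second path follows the first one on the facial walk. -/
structure Aligned (P₁ P₂ : G.BoundaryPath o) (k : ℕ) : Prop where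
  start_eq : P₂.start = (G.face ^ k) P₁.start
  le_shift : P₁.length ≤ k
  shift_le : k + P₂.length ≤ Function.minimalPeriod G.face P₁.start

/-- Within one turn of the facial walk, an overlap of the paths would make an inner vertex of one of
them common, unless both start with the same dart. In that case the next vertices are common too, so
both paths are that one edge, or else one of them is a single vertex. -/
theorem exists_aligned [Finite E] (P₁ P₂ : G.BoundaryPath o)
    (h : P₁.verts ∩ P₂.verts ⊆ P₁.ends ∩ P₂.ends) :
    (∃ k, Aligned P₁ P₂ k) ∨ (P₁.start = P₂.start ∧ P₁.length = 1 ∧ P₂.length = 1) := by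
  have hs : G.face.SameCycle P₁.start P₂.start := P₁.start_mem.symm.trans P₂.start_mem
  obtain ⟨k, hk, hkeq⟩ := exists_pow_lt_minimalPeriod hs
  have hv : ∀ j, P₂.vertex j = G.src ((G.face ^ (j + k)) P₁.start) := fun j => by
    rw [vertex, ← hkeq, pow_add, Equiv.Perm.mul_apply]
  have h1 := P₁.length_lt_minimalPeriod
  by_cases hkL : P₁.length ≤ k
  · left
    refine ⟨k, hkeq.symm, hkL, ?_⟩
    by_contra hcon
    push Not at hcon
    set n := Function.minimalPeriod G.face P₁.start with hn
    have e : P₂.vertex (n - k) = P₁.vertex 0 := by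
      rw [hv, Nat.sub_add_cancel hk.le, hn, pow_minimalPeriod_apply]
      rfl
    have hm : P₂.vertex (n - k) ∈ P₂.ends :=
      (h ⟨e ▸ ⟨0, Nat.zero_le _, rfl⟩, ⟨n - k, by simp; omega, rfl⟩⟩).2
    rw [mem_ends_iff (by omega)] at hm
    omega
  · push Not at hkL
    have e : P₁.vertex k = P₂.vertex 0 := by
      rw [hv, zero_add]
      rfl
    have hm : P₁.vertex k ∈ P₁.ends :=
      (h ⟨⟨k, hkL.le, rfl⟩, e ▸ ⟨0, Nat.zero_le _, rfl⟩⟩).1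
    rw [mem_ends_iff hkL.le] at hm
    have hk0 : k = 0 := by omega
    subst hk0
    have hss : P₁.start = P₂.start := hkeq
    rcases Nat.eq_zero_or_pos P₂.length with h0 | h0
    · left
      -- `P₂` is the single vertex at which `P₁` starts; a full turn as shift places it after `P₁`.
      refine ⟨Function.minimalPeriod G.face P₁.start, ?_, h1.le, by omega⟩
      rw [pow_minimalPeriod_apply, hss]
    · right
      have e1 : P₁.vertex 1 = P₂.vertex 1 := by rw [hv]; rfl
      have hm := h ⟨⟨1, hkL, rfl⟩, e1 ▸ ⟨1, h0, rfl⟩⟩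
      have hm1 := hm.1
      have hm2 := hm.2
      rw [mem_ends_iff hkL] at hm1
      rw [e1, mem_ends_iff h0] at hm2
      exact ⟨hss, by omega, by omega⟩

end PlaneGraph.BoundaryPath

open PlaneGraph.BoundaryPath

variable {V : Type*} {E : Type*} {G : PlaneGraph V E} {o : E × Bool}

/-- A set of pairwise non-crossing trees whose leaves are their joining vertices with two paths, and
that have leaves on both paths. -/
structure IsBrickForest (P₁ P₂ : G.BoundaryPath o) (F : Finset (Graph V E)) : Prop where
  tree : ∀ T ∈ F, T ≤ G.toGraph ∧ IsTree T
  nonCrossing : ∀ T ∈ F, ∀ T' ∈ F, T ≠ T' → G.NonCrossing T T'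
  leaves : ∀ T ∈ F,
    leaves T = joiningVertices T (P₁.verts ∪ P₂.verts) (P₁.edgs ∪ P₂.edgs) ∧
    (leaves T ∩ P₁.verts).Nonempty ∧ (leaves T ∩ P₂.verts).Nonempty

namespace IsBrickForest

variable {P₁ P₂ : G.BoundaryPath o} {F : Finset (Graph V E)} {T T' : Graph V E}

theorem inc_mem_verts (P₁ P₂ : G.BoundaryPath o) (hT : T ≤ G.toGraph) :
    ∀ e ∈ P₁.edgs ∪ P₂.edgs, ∀ x, T.Inc e x → x ∈ P₁.verts ∪ P₂.verts := by
  rintro e (he | he) x hx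
  · exact Or.inl (P₁.edge_inc_mem_verts he (hx.mono hT))
  · exact Or.inr (P₂.edge_inc_mem_verts he (hx.mono hT))

theorem mem_leaves (hF : IsBrickForest P₁ P₂ F) (hT : T ∈ F) {x : V} (hx : x ∈ V(T))
    (hxP : x ∈ P₁.verts ∪ P₂.verts) : x ∈ BrickForest.leaves T :=
  mem_leaves_of_mem_path (hF.tree T hT).2.1 (hF.leaves T hT).1
    ((hF.leaves T hT).2.1.mono Set.inter_subset_left)
    (inc_mem_verts P₁ P₂ (hF.tree T hT).1) hx hxP

theorem leaves_subset (hF : IsBrickForest P₁ P₂ F) (hT : T ∈ F) :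
    BrickForest.leaves T ⊆ P₁.verts ∪ P₂.verts := by
  rw [(hF.leaves T hT).1]
  exact fun x hx => hx.1

theorem eq_of_inc (hF : IsBrickForest P₁ P₂ F) (hT : T ∈ F) :
    ∀ x ∈ P₁.verts ∪ P₂.verts, ∀ e e', T.Inc e x → T.Inc e' x → e = e' :=
  fun _ hx _ _ he he' => (hF.mem_leaves hT he.vertex_mem hx).2.unique he he'

/-- A path between two leaves of a tree avoids all other vertices of the two boundary paths. -/
theorem exists_path_avoiding (hF : IsBrickForest P₁ P₂ F) (hT : T ∈ F) {x y : V}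
    (hx : x ∈ V(T)) (hy : y ∈ V(T)) : ∃ p : Walk T x y, p.edges.Nodup ∧
      ∀ z ∈ P₁.verts ∪ P₂.verts, z ≠ x → z ≠ y → ∀ e ∈ p.edges, ¬ T.Inc e z := by
  obtain ⟨p₀⟩ := (hF.tree T hT).2.1.2 x hx y hy
  obtain ⟨p, hp, -⟩ := p₀.exists_path
  exact ⟨p, hp.edges_nodup, fun z hz hzx hzy =>
    p.not_inc_of_subsingleton (hF.eq_of_inc hT z hz) hp.edges_nodup hzx hzy⟩

theorem vertex_shift {k : ℕ} (hA : Aligned P₁ P₂ k) (j : ℕ) :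
    G.src ((G.face ^ (k + j)) P₁.start) = P₂.vertex j := by
  rw [vertex, hA.start_eq, ← Equiv.Perm.mul_apply, ← pow_add, add_comm]

/-- Lists `P₁` again after `P₂`, for increasing sequences of positions that start on `P₂`. -/
theorem vertex_turn (i : ℕ) :
    G.src ((G.face ^ (i + Function.minimalPeriod G.face P₁.start)) P₁.start) = P₁.vertex i := by
  rw [vertex, pow_add, Equiv.Perm.mul_apply, pow_minimalPeriod_apply]

variable [Finite E]

/-- The conditions of `PlaneGraph.not_crosswise` at the four vertices follow from trees having only
one edge at each boundary vertex they meet. -/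
theorem not_crosswise (hF : IsBrickForest P₁ P₂ F) (hT : T ∈ F) (hT' : T' ∈ F) (hne : T ≠ T')
    {s : E × Bool} {i₁ i₂ i₃ i₄ : ℕ} (h12 : i₁ < i₂) (h23 : i₂ < i₃) (h34 : i₃ < i₄)
    (h41 : i₄ < i₁ + Function.minimalPeriod G.face s) {x₁ x₂ x₃ x₄ : V}
    (e1 : G.src ((G.face ^ i₁) s) = x₁) (e2 : G.src ((G.face ^ i₂) s) = x₂)
    (e3 : G.src ((G.face ^ i₃) s) = x₃) (e4 : G.src ((G.face ^ i₄) s) = x₄)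
    (hx1 : x₁ ∈ BrickForest.leaves T) (hx2 : x₂ ∈ BrickForest.leaves T')
    (hx3 : x₃ ∈ BrickForest.leaves T) (hx4 : x₄ ∈ BrickForest.leaves T')
    (n21 : x₂ ≠ x₁) (n23 : x₂ ≠ x₃) (n41 : x₄ ≠ x₁) (n43 : x₄ ≠ x₃) : False := by
  subst e1 e2 e3 e4
  obtain ⟨p, -, hp⟩ := hF.exists_path_avoiding hT hx1.1 hx3.1
  exact G.not_crosswise (hF.tree T hT).1 (hF.tree T' hT').1 (hF.tree T' hT').2.1
    (hF.nonCrossing T hT T' hT' hne) h12 h23 h34 h41 p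
    (hp _ (hF.leaves_subset hT' hx2) n21 n23) (hp _ (hF.leaves_subset hT' hx4) n41 n43)
    hx2.1 hx4.1 n21 n23 n41 n43
    (hF.eq_of_inc hT' _ (hF.leaves_subset hT hx1)) (hF.eq_of_inc hT' _ (hF.leaves_subset hT hx3))

variable {k : ℕ}

/-- Two trees do not join the two paths crosswise. -/
theorem not_cross_both (hF : IsBrickForest P₁ P₂ F) (hA : Aligned P₁ P₂ k) (hT : T ∈ F)
    (hT' : T' ∈ F) (hne : T ≠ T') {i i' j j' : ℕ} (hii : i < i') (hi' : i' ≤ P₁.length)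
    (hjj : j < j') (hj' : j' ≤ P₂.length) (hi : P₁.vertex i ∈ BrickForest.leaves T)
    (hj : P₂.vertex j ∈ BrickForest.leaves T) (hTi' : P₁.vertex i' ∈ BrickForest.leaves T')
    (hTj' : P₂.vertex j' ∈ BrickForest.leaves T') (n1 : P₁.vertex i ≠ P₂.vertex j')
    (n2 : P₁.vertex i' ≠ P₂.vertex j) : False := by
  have h1 := hA.le_shift
  have h2 := hA.shift_le
  -- Alignment only gives weak inequalities between positions on the two paths; the distinctness of
  -- vertices makes them strict.
  have n3 : i' ≠ k + j := fun h => n2 (by rw [← vertex_shift hA, ← h]; rfl)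
  have n4 : k + j' ≠ i + Function.minimalPeriod G.face P₁.start := fun h =>
    n1 (by rw [← vertex_shift hA, h, vertex_turn])
  refine hF.not_crosswise hT hT' hne (s := P₁.start) (i₁ := i) (i₂ := i') (i₃ := k + j)
    (i₄ := k + j') hii (by omega) (by omega) (by omega) rfl rfl (vertex_shift hA j)
    (vertex_shift hA j') hi hTi' hj hTj' ?_ n2 n1.symm ?_
  · exact fun h => hii.ne' (P₁.vertex_inj hi' (by omega) h)
  · exact fun h => hjj.ne' (P₂.vertex_inj hj' (by omega) h)

/-- A tree joins no inner vertex of an interval on the second path, the ends of which are joined by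
another tree, to a vertex outside the second path. -/
theorem not_cross_second (hF : IsBrickForest P₁ P₂ F) (hA : Aligned P₁ P₂ k) (hT : T ∈ F)
    (hT' : T' ∈ F) (hne : T ≠ T') {i j₁ j₂ j₃ : ℕ} (h12 : j₁ < j₂) (h23 : j₂ < j₃)
    (hj₃ : j₃ ≤ P₂.length) (hi : i ≤ P₁.length) (h1 : P₂.vertex j₁ ∈ BrickForest.leaves T)
    (h2 : P₂.vertex j₂ ∈ BrickForest.leaves T') (h3 : P₂.vertex j₃ ∈ BrickForest.leaves T)
    (h4 : P₁.vertex i ∈ BrickForest.leaves T') (hi2 : P₁.vertex i ∉ P₂.verts) : False := by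
  have a1 := hA.le_shift
  have a2 := hA.shift_le
  have n1 : P₁.vertex i ≠ P₂.vertex j₁ := fun h => hi2 (h ▸ ⟨j₁, by simp; omega, rfl⟩)
  have n3 : P₁.vertex i ≠ P₂.vertex j₃ := fun h => hi2 (h ▸ ⟨j₃, hj₃, rfl⟩)
  have n1' : i ≠ k + j₁ := fun h => n1 (by rw [← vertex_shift hA, ← h]; rfl)
  have n3' : k + j₃ ≠ i + Function.minimalPeriod G.face P₁.start := fun h =>
    n3 (by rw [← vertex_shift hA, h, vertex_turn])
  refine hF.not_crosswise hT hT' hne (s := P₁.start) (i₁ := k + j₁) (i₂ := k + j₂)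
    (i₃ := k + j₃) (i₄ := i + Function.minimalPeriod G.face P₁.start) (by omega) (by omega)
    (by omega) (by omega) (vertex_shift hA _) (vertex_shift hA _) (vertex_shift hA _)
    (vertex_turn i) h1 h2 h3 h4 ?_ ?_ n1 n3
  · exact fun h => h12.ne' (P₂.vertex_inj (by omega) (by omega) h)
  · exact fun h => h23.ne (P₂.vertex_inj (by omega) (by omega) h)

variable {Ta Tb : Graph V E}

/-- The facial walk traverses the paths in opposite directions as seen across the brick: a tree that
comes before `Ta` on `P₁` comes after it on `P₂`. By `hlt` the first vertex of `Ta` on `P₁` is an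
inner vertex of `P₁`, hence not on `P₂`. -/
theorem hiPos_le_of_lt_loPos (hF : IsBrickForest P₁ P₂ F) (hA : Aligned P₁ P₂ k)
    (hI : P₁.verts ∩ P₂.verts ⊆ P₁.ends ∩ P₂.ends) (hTa : Ta ∈ F) (hT : T ∈ F)
    (hlt : P₁.loPos (BrickForest.leaves Ta) < P₁.length) {i : ℕ}
    (hi : P₁.vertex i ∈ BrickForest.leaves T) (hil : i < P₁.loPos (BrickForest.leaves Ta))
    {j : ℕ} (hj : j ≤ P₂.length) (hjT : P₂.vertex j ∈ BrickForest.leaves T) :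
    P₂.hiPos (BrickForest.leaves Ta) ≤ j := by
  by_contra hcon
  push Not at hcon
  have hla := loPos_mem (hF.leaves Ta hTa).2.1
  have hqa := hiPos_mem (hF.leaves Ta hTa).2.2
  have hne : T ≠ Ta := by
    rintro rfl
    exact absurd (loPos_le (by omega) hi) (not_le.2 hil)
  refine hF.not_cross_both hA hT hTa hne hil hla.1 hcon hqa.1 hi hjT hla.2 hqa.2 ?_ ?_
  · intro h
    exact absurd (loPos_le (by omega) (h ▸ hqa.2)) (not_le.2 hil)
  · intro h
    have := (hI ⟨⟨_, hla.1, rfl⟩, h ▸ ⟨j, hj, rfl⟩⟩).1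
    rw [mem_ends_iff hla.1] at this
    omega

theorem le_loPos_of_hiPos_lt (hF : IsBrickForest P₁ P₂ F) (hA : Aligned P₁ P₂ k)
    (hI : P₁.verts ∩ P₂.verts ⊆ P₁.ends ∩ P₂.ends) (hTb : Tb ∈ F) (hT : T ∈ F)
    (hlt : 0 < P₁.hiPos (BrickForest.leaves Tb)) {i : ℕ} (hiL : i ≤ P₁.length)
    (hi : P₁.vertex i ∈ BrickForest.leaves T) (hil : P₁.hiPos (BrickForest.leaves Tb) < i)
    {j : ℕ} (hj : j ≤ P₂.length) (hjT : P₂.vertex j ∈ BrickForest.leaves T) :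
    j ≤ P₂.loPos (BrickForest.leaves Tb) := by
  by_contra hcon
  push Not at hcon
  have hrb := hiPos_mem (hF.leaves Tb hTb).2.1
  have hqb := loPos_mem (hF.leaves Tb hTb).2.2
  have hne : Tb ≠ T := by
    rintro rfl
    exact absurd (le_hiPos hiL hi) (not_le.2 hil)
  refine hF.not_cross_both hA hTb hT hne hil hiL hcon hj hrb.2 hqb.2 hi hjT ?_ ?_
  · intro h
    have := (hI ⟨⟨_, hrb.1, rfl⟩, h ▸ ⟨j, hj, rfl⟩⟩).1
    rw [mem_ends_iff hrb.1] at this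
    omega
  · intro h
    exact absurd (le_hiPos hiL (h ▸ hqb.2)) (not_le.2 hil)

/-- Otherwise all leaves of `Ta` on `P₂` precede those of `Tb`, in the same order as on `P₁`, and
the two trees cross. -/
theorem loPos_le_hiPos_of_lt (hF : IsBrickForest P₁ P₂ F) (hA : Aligned P₁ P₂ k)
    (hTa : Ta ∈ F) (hTb : Tb ∈ F)
    (hlt : P₁.loPos (BrickForest.leaves Ta) < P₁.hiPos (BrickForest.leaves Tb)) :
    P₂.loPos (BrickForest.leaves Tb) ≤ P₂.hiPos (BrickForest.leaves Ta) := by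
  by_contra hcon
  push Not at hcon
  have hla := loPos_mem (hF.leaves Ta hTa).2.1
  have hqa := hiPos_mem (hF.leaves Ta hTa).2.2
  have hrb := hiPos_mem (hF.leaves Tb hTb).2.1
  have hqb := loPos_mem (hF.leaves Tb hTb).2.2
  have hne : Ta ≠ Tb := by
    rintro rfl
    exact absurd (loPos_le_hiPos (hF.leaves Ta hTa).2.2) (not_le.2 hcon)
  refine hF.not_cross_both hA hTa hTb hne hlt hrb.1 hcon hqb.1 hla.2 hqa.2 hrb.2 hqb.2 ?_ ?_
  · intro h
    exact absurd (le_hiPos hqb.1 (h ▸ hla.2)) (not_le.2 hcon)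
  · intro h
    exact absurd (loPos_le hqa.1 (h ▸ hrb.2)) (not_le.2 hcon)

/-- The intervals spanned on the second path by two trees with more than three leaves overlap only
at their ends. -/
theorem hulls_disjoint (hF : IsBrickForest P₁ P₂ F) (hA : Aligned P₁ P₂ k) (hT : T ∈ F)
    (hT' : T' ∈ F) (hne : T ≠ T') (h2 : ¬ BrickForest.leaves T ⊆ P₂.verts)
    (h2' : ¬ BrickForest.leaves T' ⊆ P₂.verts) (h3 : 3 < (BrickForest.leaves T).ncard) {j : ℕ}
    (hj : P₂.loPos (BrickForest.leaves T) ≤ j ∧ j < P₂.hiPos (BrickForest.leaves T))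
    (hj' : P₂.loPos (BrickForest.leaves T') ≤ j ∧ j < P₂.hiPos (BrickForest.leaves T')) :
    False := by
  have hlo := loPos_mem (hF.leaves T hT).2.2
  have hhi := hiPos_mem (hF.leaves T hT).2.2
  have hlo' := loPos_mem (hF.leaves T' hT').2.2
  have hhi' := hiPos_mem (hF.leaves T' hT').2.2
  have out : ∀ T ∈ F, ∀ x ∈ BrickForest.leaves T, x ∉ P₂.verts →
      ∃ i ≤ P₁.length, P₁.vertex i = x := by
    intro T hT x hx hx2
    rcases hF.leaves_subset hT hx with ⟨i, hi, rfl⟩ | h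
    · exact ⟨i, hi, rfl⟩
    · exact absurd h hx2
  obtain ⟨y, hy, hy2⟩ := Set.not_subset.1 h2
  obtain ⟨y', hy', hy2'⟩ := Set.not_subset.1 h2'
  obtain ⟨i, hi, rfl⟩ := out T hT y hy hy2
  obtain ⟨i', hi', rfl⟩ := out T' hT' y' hy' hy2'
  have nv : ∀ {i j}, P₁.vertex i ∉ P₂.verts → j ≤ P₂.length → P₁.vertex i ≠ P₂.vertex j :=
    fun h hj e => h (e ▸ ⟨_, hj, rfl⟩)
  -- If both hulls contain the edge `j`, a leaf of either tree strictly inside the hull of the other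
  -- would be cut off from its leaf outside `P₂`. So below and above the edge, `T` has leaves only
  -- at the two ends of the hull of `T'`.
  have low : ∀ x ≤ j, P₂.vertex x ∈ BrickForest.leaves T →
      x = P₂.loPos (BrickForest.leaves T') := by
    intro x hx hxT
    rcases lt_trichotomy x (P₂.loPos (BrickForest.leaves T')) with h | h | h
    · exact (hF.not_cross_second hA hT hT' hne h (by omega) hhi.1 hi' hxT hlo'.2 hhi.2 hy'
        hy2').elim
    · exact h
    · exact (hF.not_cross_second hA hT' hT hne.symm h (by omega) hhi'.1 hi hlo'.2 hxT hhi'.2 hy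
        hy2).elim
  have high : ∀ x ≤ P₂.length, j < x → P₂.vertex x ∈ BrickForest.leaves T →
      x = P₂.hiPos (BrickForest.leaves T') := by
    intro x hxL hx hxT
    rcases lt_trichotomy x (P₂.hiPos (BrickForest.leaves T')) with h | h | h
    · exact (hF.not_cross_second hA hT' hT hne.symm (by omega) h hhi'.1 hi hlo'.2 hxT hhi'.2 hy
        hy2).elim
    · exact h
    · exact (hF.not_cross_second hA hT hT' hne (by omega) h hxL hi' hlo.2 hhi'.2 hxT hy'
        hy2').elim
  -- Outside `P₂`, a leaf of `T` on either side of `i'` would give a crossing. This leaves at most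
  -- three leaves in all.
  have top : ∀ x ≤ P₁.length, P₁.vertex x ∉ P₂.verts → P₁.vertex x ∈ BrickForest.leaves T →
      x = i' := by
    intro x hxL hx2 hxT
    rcases lt_trichotomy x i' with h | h | h
    · exact (hF.not_cross_both hA hT hT' hne h hi' (by omega) hhi'.1 hxT hlo.2 hy' hhi'.2
        (nv hx2 hhi'.1) (nv hy2' hlo.1)).elim
    · exact h
    · exact (hF.not_cross_both hA hT' hT hne.symm h hxL (by omega) hhi.1 hy' hlo'.2 hxT hhi.2
        (nv hy2' hhi.1) (nv hx2 hlo'.1)).elim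
  have hsub : BrickForest.leaves T ⊆ {P₂.vertex (P₂.loPos (BrickForest.leaves T')),
      P₂.vertex (P₂.hiPos (BrickForest.leaves T')), P₁.vertex i'} := by
    intro x hx
    by_cases hx2 : x ∈ P₂.verts
    · obtain ⟨m, hm, rfl⟩ := hx2
      rcases Nat.lt_or_ge j m with h | h
      · rw [high m hm h hx]
        simp
      · rw [low m h hx]
        simp
    · obtain ⟨m, hm, rfl⟩ := out T hT x hx hx2
      rw [top m hm hx2 hx]
      simp
  have h1 := Set.ncard_le_ncard hsub (Set.toFinite _)
  have h2 := Set.ncard_insert_le (P₂.vertex (P₂.loPos (BrickForest.leaves T')))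
    {P₂.vertex (P₂.hiPos (BrickForest.leaves T')), P₁.vertex i'}
  have h3 := Set.ncard_insert_le (P₂.vertex (P₂.hiPos (BrickForest.leaves T'))) {P₁.vertex i'}
  rw [Set.ncard_singleton] at h3
  omega

end IsBrickForest

end BrickForest

/-! ### Cheap trees, simplified trees, and the ring through both paths -/

namespace BrickForest

open PlaneGraph PlaneGraph.BoundaryPath

/-- Among the first `m` elements in the order of `key`, one has at most average cost. -/
theorem exists_cheap_low {ι : Type*} (F : Finset ι) (key : ι → ℕ) {c : ι → ℝ}
    (hc : ∀ i, 0 ≤ c i) {m : ℕ} (hm : 1 ≤ m) (hmF : m ≤ F.card) :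
    ∃ a ∈ F, m * c a ≤ ∑ i ∈ F, c i ∧ {i ∈ F | key i < key a}.card ≤ m := by
  classical
  have low : ∀ m ≤ F.card, ∃ A ⊆ F, A.card = m ∧ ∀ a ∈ A, ∀ b ∈ F, b ∉ A → key a ≤ key b := by
    intro m
    induction m with
    | zero => exact fun _ => ⟨∅, by simp, rfl, by simp⟩
    | succ m ih =>
      intro hm
      obtain ⟨A, hAF, hA, hAk⟩ := ih (by omega)
      have hne : (F \ A).Nonempty := by
        rw [← Finset.card_pos, Finset.card_sdiff_of_subset hAF]
        omega
      obtain ⟨x, hx, hxmin⟩ := Finset.exists_min_image (F \ A) key hne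
      rw [Finset.mem_sdiff] at hx
      refine ⟨insert x A, Finset.insert_subset hx.1 hAF, by
        rw [Finset.card_insert_of_notMem hx.2, hA], fun a ha b hb hbA => ?_⟩
      rw [Finset.mem_insert, not_or] at hbA
      rcases Finset.mem_insert.1 ha with rfl | ha
      · exact hxmin b (Finset.mem_sdiff.2 ⟨hb, hbA.2⟩)
      · exact hAk a ha b hb hbA.2
  obtain ⟨A, hAF, hA, hAk⟩ := low m hmF
  obtain ⟨a, ha, hmin⟩ := Finset.exists_min_image A c (Finset.card_pos.1 (by omega))
  refine ⟨a, hAF ha, ?_, ?_⟩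
  · calc (m : ℝ) * c a = ∑ _i ∈ A, c a := by rw [Finset.sum_const, hA, nsmul_eq_mul]
      _ ≤ ∑ i ∈ A, c i := Finset.sum_le_sum hmin
      _ ≤ ∑ i ∈ F, c i := Finset.sum_le_sum_of_subset_of_nonneg hAF fun i _ _ => hc i
  · rw [← hA]
    refine Finset.card_le_card fun i hi => ?_
    rw [Finset.mem_filter] at hi
    by_contra hiA
    exact absurd (hAk a ha i hi.1 hiA) (not_le.2 hi.2)

variable {V : Type*} {E : Type*} {G : PlaneGraph V E} {o : E × Bool}
  {P₁ P₂ : G.BoundaryPath o} {F : Finset (Graph V E)} {w : E → ℝ} {ε : ℝ}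

open Classical in
/-- The positions of the edges of the second path that are added to the simplification of a tree
with leaves outside each of the two paths. -/
noncomputable def hull (P₁ P₂ : G.BoundaryPath o) (T : Graph V E) : Finset ℕ :=
  if ¬ leaves T ⊆ P₁.verts ∧ ¬ leaves T ⊆ P₂.verts ∧ 3 < (leaves T).ncard then
    Finset.Ico (P₂.loPos (leaves T)) (P₂.hiPos (leaves T))
  else ∅

theorem hull_subset_Ico (P₁ P₂ : G.BoundaryPath o) (T : Graph V E) :
    hull P₁ P₂ T ⊆ Finset.Ico (P₂.loPos (leaves T)) (P₂.hiPos (leaves T)) := by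
  unfold hull
  split_ifs
  · exact subset_rfl
  · exact Finset.empty_subset _

/-- Hulls of different trees are disjoint, so each edge of `P₂` is paid for at most once, however
many trees there are. -/
theorem sum_hull_le [Finite E] (hF : IsBrickForest P₁ P₂ F) {k : ℕ} (hA : Aligned P₁ P₂ k)
    (hw : ∀ e, 0 ≤ w e) {N : Finset (Graph V E)} (hN : N ⊆ F) {S : Finset ℕ}
    (hS : ∀ T ∈ N, hull P₁ P₂ T ⊆ S) :
    ∑ T ∈ N, ∑ j ∈ hull P₁ P₂ T, w (P₂.edge j) ≤ ∑ j ∈ S, w (P₂.edge j) := by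
  classical
  rw [← Finset.sum_biUnion]
  · exact Finset.sum_le_sum_of_subset_of_nonneg (Finset.biUnion_subset.2 hS) fun _ _ _ => hw _
  · intro T hT T' hT' hne
    rw [Function.onFun, Finset.disjoint_left]
    intro j hj hj'
    have h1 := hull_subset_Ico P₁ P₂ T hj
    have h1' := hull_subset_Ico P₁ P₂ T' hj'
    rw [Finset.mem_Ico] at h1 h1'
    unfold hull at hj hj'
    split_ifs at hj with hc
    · split_ifs at hj' with hc'
      · exact hF.hulls_disjoint hA (hN hT) (hN hT') hne hc.2.1 hc'.2.1 hc.2.2 h1 h1'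
      · simp at hj'
    · simp at hj

theorem hull_subset_range (hF : IsBrickForest P₁ P₂ F) {T : Graph V E} (hT : T ∈ F) :
    hull P₁ P₂ T ⊆ Finset.Ico 0 P₂.length := by
  refine (hull_subset_Ico P₁ P₂ T).trans (Finset.Ico_subset_Ico (Nat.zero_le _) ?_)
  exact (hiPos_mem (hF.leaves T hT).2.2).1

/-- The simplification of a single tree. -/
theorem exists_simplified_tree [Finite V] [Finite E] (hF : IsBrickForest P₁ P₂ F)
    (hP₁ : P₁.IsShort w ε) (hP₂ : P₂.IsShort w ε) (hw : ∀ e, 0 ≤ w e) (hε : 0 ≤ ε) {k : ℕ}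
    (hk : 1 ≤ ε * (2 * (2 ^ k - 1) + 1)) {T : Graph V E} (hT : T ∈ F) (tag : ℕ) :
    ∃ T' ≤ copies G.toGraph, IsTree T' ∧ Spans T' (leaves T) ∧ (∀ e ∈ E(T'), e.2 = tag) ∧
      weight (fun e => w e.1) T' ≤
        (1 + 2 * ε) * weight w T + ∑ j ∈ hull P₁ P₂ T, w (P₂.edge j) ∧
      (joiningVertices T' (P₁.verts ∪ P₂.verts) {e | e.1 ∈ P₁.edgs ∪ P₂.edgs}).ncard ≤
        2 ^ k + 3 := by
  have hTG := (hF.tree T hT).1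
  have hc := (hF.tree T hT).2.1
  have hu := hF.eq_of_inc hT
  have h1 := (hF.leaves T hT).2.1
  have h2 := (hF.leaves T hT).2.2
  have hpos : 0 ≤ ∑ j ∈ hull P₁ P₂ T, w (P₂.edge j) := Finset.sum_nonneg fun _ _ => hw _
  have hw0 := weight_nonneg hw T
  by_cases c1 : leaves T ⊆ P₁.verts
  · obtain ⟨hm1, hm2⟩ := loPos_mem h1
    obtain ⟨T', g1, g2, g3, g4, g5, g6⟩ := exists_tree_few_joining P₁ P₁ hP₁ hw hε hTG hc
      (Set.subset_union_left (t := P₂.edgs)) Set.subset_union_left hu hk le_rfl le_rfl hm1 hm2.1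
      h1 (fun x hx => Or.inl (c1 hx)) tag
    refine ⟨T', g1, g2, g3, g4, g5.trans ?_, g6.trans (by omega)⟩
    simp only [distAlong, Finset.Ico_self, Finset.sum_empty]
    linarith
  by_cases c2 : leaves T ⊆ P₂.verts
  · obtain ⟨hm1, hm2⟩ := loPos_mem h2
    obtain ⟨T', g1, g2, g3, g4, g5, g6⟩ := exists_tree_few_joining P₂ P₂ hP₂ hw hε hTG hc
      (Set.subset_union_right (s := P₁.edgs)) Set.subset_union_right hu hk le_rfl le_rfl hm1 hm2.1
      h2 (fun x hx => Or.inl (c2 hx)) tag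
    refine ⟨T', g1, g2, g3, g4, g5.trans ?_, g6.trans (by omega)⟩
    simp only [distAlong, Finset.Ico_self, Finset.sum_empty]
    linarith
  -- The tree, rooted at a leaf on `P₂`, is simplified with respect to its leaves on `P₁`; its
  -- leaves on `P₂` are reached from the root along the hull. With at most three leaves the hull is
  -- empty and the tree is kept as it is.
  by_cases c3 : 3 < (leaves T).ncard
  · obtain ⟨hm1, hm2⟩ := loPos_mem h2
    obtain ⟨T', g1, g2, g3, g4, g5, g6⟩ := exists_tree_few_joining P₁ P₂ hP₁ hw hε hTG hc
      (Set.subset_union_left (t := P₂.edgs)) Set.subset_union_right hu hk le_rfl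
      (loPos_le_hiPos h2) (hiPos_mem h2).1 hm2.1 h1 (by
        intro x hx
        rcases hF.leaves_subset hT hx with h | ⟨m, hm, rfl⟩
        · exact Or.inl h
        · exact Or.inr ⟨m, loPos_le hm hx, le_hiPos hm hx, rfl⟩) tag
    refine ⟨T', g1, g2, g3, g4, g5.trans_eq ?_, g6.trans (by omega)⟩
    rw [hull, if_pos ⟨c1, c2, c3⟩]
    rfl
  · obtain ⟨T', g1, g2, g3, g4, g5, g6⟩ := exists_tree_copy (PE := P₁.edgs ∪ P₂.edgs) hw hTG hc
      (fun x hx hxT => hF.mem_leaves hT hxT hx) tag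
    exact ⟨T', g1, g2, g3, g4, g5.trans (by nlinarith),
      g6.trans ((not_lt.1 c3).trans (Nat.le_add_left _ _))⟩

/-- The common part of the solution: the multisubgraph `C` that replaces all trees of `F` outside
`N`. -/
structure IsCore (P₁ P₂ : G.BoundaryPath o) (F N : Finset (Graph V E))
    (C : Graph V (E × ℕ)) : Prop where
  subset : N ⊆ F
  le_copies : C ≤ copies G.toGraph
  finite : E(C).Finite
  spans : ∀ T ∈ F, T ∉ N → Spans C (leaves T)
  joining : (joiningVertices C (P₁.verts ∪ P₂.verts) {e | e.1 ∈ P₁.edgs ∪ P₂.edgs}).ncard ≤ 4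
  linked : ∀ x y : Fin 3 → V, (∀ i, x i ∈ V(C)) → (∀ i, y i ∈ V(C)) →
    HasThreeEdgeDisjointPaths C x y

theorem isCore_noEdge (P₁ P₂ : G.BoundaryPath o) (F : Finset (Graph V E)) :
    IsCore P₁ P₂ F F (Graph.noEdge ∅ (E × ℕ)) where
  subset := subset_rfl
  le_copies := Graph.noEdge_le_iff.2 (Set.empty_subset _)
  finite := by simp
  spans T hT hN := absurd hT hN
  joining := by
    have : joiningVertices (Graph.noEdge (∅ : Set V) (E × ℕ)) (P₁.verts ∪ P₂.verts)
        {e | e.1 ∈ P₁.edgs ∪ P₂.edgs} = ∅ := by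
      ext x
      simp [joiningVertices, Graph.Inc]
    rw [this, Set.ncard_empty]
    omega
  linked x y hx := by
    have := hx 0
    simp at this

/-- The doubled closed walk through an interval of the first path and the whole second path. -/
theorem exists_ring_core [Finite V] (hw : ∀ e, 0 ≤ w e) {l r qa qb : ℕ} (hlr : l ≤ r)
    (hr : r ≤ P₁.length) (hqa : qa ≤ P₂.length) (hqb : qb ≤ P₂.length)
    (Qa : Walk G.toGraph (P₁.vertex l) (P₂.vertex qa))
    (Qb : Walk G.toGraph (P₁.vertex r) (P₂.vertex qb))
    (ha : ∀ z ∈ P₁.verts ∪ P₂.verts, z ≠ P₁.vertex l → z ≠ P₂.vertex qa →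
      ∀ e ∈ Qa.edges, ¬ G.toGraph.Inc e z)
    (hb : ∀ z ∈ P₁.verts ∪ P₂.verts, z ≠ P₁.vertex r → z ≠ P₂.vertex qb →
      ∀ e ∈ Qb.edges, ¬ G.toGraph.Inc e z)
    {N : Finset (Graph V E)} (hN : N ⊆ F)
    (hF : ∀ T ∈ F, T ∉ N → leaves T ⊆ P₁.vertex '' Set.Icc l r ∪ P₂.verts) :
    ∃ C, IsCore P₁ P₂ F N C ∧ weight (fun e => w e.1) C ≤
      2 * (P₁.distAlong w l r + Qa.weight w + Qb.weight w + P₂.distAlong w 0 qb +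
        P₂.distAlong w 0 P₂.length + P₂.distAlong w qa P₂.length) := by
  obtain ⟨p1, a1, b1, c1⟩ := P₁.exists_walk_along hlr
  obtain ⟨p2, a2, b2, c2⟩ := P₂.exists_walk_along (Nat.zero_le qb)
  obtain ⟨p3, a3, b3, c3⟩ := P₂.exists_walk_along (Nat.zero_le P₂.length)
  obtain ⟨p4, a4, b4, c4⟩ := P₂.exists_walk_along hqa
  -- Along `P₁` from `l` to `r`, by `Qb` to `P₂`, back to the start of `P₂`, along all of it, back
  -- to `qa`, and by `Qa` to `l`. Off the two paths the walk uses only `Qa` and `Qb`, so the joining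
  -- vertices are among their four ends.
  let p := p1.append (Qb.append (p2.reverse.append (p3.append (p4.reverse.append Qa.reverse))))
  have hedge : ∀ e ∈ p.edges, e ∈ P₁.edgs ∪ P₂.edgs ∨ e ∈ Qa.edges ∨ e ∈ Qb.edges := by
    intro e he
    simp only [p, Walk.edges_append, Walk.edges_reverse, List.mem_append, List.mem_reverse] at he
    rcases he with he | he | he | he | he | he
    · obtain ⟨m, h1, h2, rfl⟩ := a1 e he
      exact Or.inl (Or.inl ⟨m, lt_of_lt_of_le h2 hr, rfl⟩)
    · exact Or.inr (Or.inr he)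
    · obtain ⟨m, h1, h2, rfl⟩ := a2 e he
      exact Or.inl (Or.inr ⟨m, lt_of_lt_of_le h2 hqb, rfl⟩)
    · obtain ⟨m, h1, h2, rfl⟩ := a3 e he
      exact Or.inl (Or.inr ⟨m, h2, rfl⟩)
    · obtain ⟨m, h1, h2, rfl⟩ := a4 e he
      exact Or.inl (Or.inr ⟨m, h2, rfl⟩)
    · exact Or.inr (Or.inl he)
  refine ⟨p.double, ⟨hN, p.double_le, p.finite_edges_double, ?_, ?_, p.double_linked⟩, ?_⟩
  · refine fun T hT hTN => ⟨p.isConnected_double, fun x hx => ?_⟩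
    change x ∈ p.support
    simp only [p, Walk.mem_support_append]
    rcases hF T hT hTN hx with ⟨m, hm, rfl⟩ | ⟨m, hm, rfl⟩
    · exact Or.inl (b1 m hm.1 hm.2)
    · exact Or.inr (Or.inr (Or.inr (Or.inl (b3 m (Nat.zero_le _) hm))))
  · have hsub : joiningVertices p.double (P₁.verts ∪ P₂.verts)
        {e | e.1 ∈ P₁.edgs ∪ P₂.edgs} ⊆
        {P₁.vertex l, P₂.vertex qa, P₁.vertex r, P₂.vertex qb} := by
      rintro x ⟨hx, e, he, y, hey⟩
      have hex : G.toGraph.Inc e.1 x := ⟨y, hey.2⟩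
      rcases hedge e.1 (Walk.mem_edges_of_edge_double hey.edge_mem) with h | h | h
      · exact absurd h he
      · by_contra hcon
        simp only [Set.mem_insert_iff, Set.mem_singleton_iff, not_or] at hcon
        exact ha x hx hcon.1 hcon.2.1 _ h hex
      · by_contra hcon
        simp only [Set.mem_insert_iff, Set.mem_singleton_iff, not_or] at hcon
        exact hb x hx hcon.2.2.1 hcon.2.2.2 _ h hex
    have h1 := Set.ncard_le_ncard hsub (Set.toFinite _)
    have h2 := Set.ncard_insert_le (P₁.vertex l) {P₂.vertex qa, P₁.vertex r, P₂.vertex qb}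
    have h3 := Set.ncard_insert_le (P₂.vertex qa) {P₁.vertex r, P₂.vertex qb}
    have h4 := Set.ncard_insert_le (P₁.vertex r) {P₂.vertex qb}
    rw [Set.ncard_singleton] at h4
    omega
  · refine (p.weight_double_le hw).trans_eq ?_
    simp only [p, Walk.weight_append, Walk.weight_reverse, c1, c2, c3, c4]
    ring

end BrickForest

/-! ### Choice of the common part -/

namespace BrickForest

open PlaneGraph PlaneGraph.BoundaryPath

variable {V : Type*} {E : Type*} {G : PlaneGraph V E} {o : E × Bool}
  {P₁ P₂ : G.BoundaryPath o} {F : Finset (Graph V E)} {w : E → ℝ} {ε : ℝ}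

theorem exists_leaf_path [Finite E] (hF : IsBrickForest P₁ P₂ F) (hw : ∀ e, 0 ≤ w e)
    {T : Graph V E} (hT : T ∈ F) {x y : V} (hx : x ∈ leaves T) (hy : y ∈ leaves T) :
    ∃ p : Walk G.toGraph x y, p.weight w ≤ weight w T ∧
      ∀ z ∈ P₁.verts ∪ P₂.verts, z ≠ x → z ≠ y → ∀ e ∈ p.edges, ¬ G.toGraph.Inc e z := by
  obtain ⟨q, hq, hav⟩ := hF.exists_path_avoiding hT hx.1 hy.1
  obtain ⟨p, hp⟩ := q.exists_mono (hF.tree T hT).1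
  refine ⟨p, ?_, fun z hz hzx hzy e he hez => ?_⟩
  · rw [Walk.weight, hp]
    exact list_sum_le_weight hw (Set.toFinite _) hq fun e he => q.edges_subset he
  · rw [hp] at he
    exact hav z hz hzx hzy e he (((hF.tree T hT).1.inc_congr (q.edges_subset he)).2 hez)

/-- Two cheap trees close to the two ends of `P₁` bound the ring; the trees reaching beyond them
form `N`. The hulls of `N` are counted together with `C`, since both are charged to `P₂`. -/
theorem exists_core [Finite V] [Finite E] (hF : IsBrickForest P₁ P₂ F)
    (hI : P₁.verts ∩ P₂.verts ⊆ P₁.ends ∩ P₂.ends) (hP₁ : P₁.IsShort w ε)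
    (hw : ∀ e, 0 ≤ w e) (hε : 0 < ε) (hε1 : ε < 1) :
    ∃ (N : Finset (Graph V E)) (C : Graph V (E × ℕ)), IsCore P₁ P₂ F N C ∧
      (N.card : ℝ) ≤ 4 / ε ∧
      weight (fun e => w e.1) C + ∑ T ∈ N, ∑ j ∈ hull P₁ P₂ T, w (P₂.edge j) ≤
        6 * P₂.weight w + 12 * ε * ∑ T ∈ F, weight w T := by
  classical
  have hd2 : ∀ i j, 0 ≤ P₂.distAlong w i j := P₂.distAlong_nonneg hw
  have hwF : 0 ≤ ∑ T ∈ F, weight w T := Finset.sum_nonneg fun T _ => weight_nonneg hw T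
  have hεF : 0 ≤ ε * ∑ T ∈ F, weight w T := mul_nonneg hε.le hwF
  have hP₂w : P₂.weight w = P₂.distAlong w 0 P₂.length := rfl
  rcases exists_aligned P₁ P₂ hI with ⟨k, hA⟩ | ⟨hs, hL1, hL2⟩
  · set m := ⌈1 / ε⌉₊ with hmdef
    have hε' : 1 < 1 / ε := by rwa [one_lt_div hε]
    have hm1 : 1 / ε ≤ m := Nat.le_ceil _
    have hm2 : (m : ℝ) ≤ 2 / ε := by
      have := Nat.ceil_lt_add_one (show 0 ≤ 1 / ε by linarith)
      have h2 : 2 / ε = 1 / ε + 1 / ε := by ring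
      linarith
    have hm0 : 1 ≤ m := by
      have : (1 : ℝ) ≤ m := by linarith
      exact_mod_cast this
    have hεm : 1 ≤ ε * m := by
      have := mul_le_mul_of_nonneg_left hm1 hε.le
      rwa [mul_one_div_cancel hε.ne'] at this
    have cheap : ∀ T : Graph V E, m * weight w T ≤ ∑ T ∈ F, weight w T →
        weight w T ≤ ε * ∑ T ∈ F, weight w T := by
      intro T h
      have h0 := weight_nonneg hw T
      nlinarith [mul_le_mul_of_nonneg_left h hε.le, mul_le_mul_of_nonneg_right hεm h0]
    have empty : (F.card : ℝ) ≤ 4 / ε → ∃ (N : Finset (Graph V E)) (C : Graph V (E × ℕ)),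
        IsCore P₁ P₂ F N C ∧ (N.card : ℝ) ≤ 4 / ε ∧
        weight (fun e => w e.1) C + ∑ T ∈ N, ∑ j ∈ hull P₁ P₂ T, w (P₂.edge j) ≤
          6 * P₂.weight w + 12 * ε * ∑ T ∈ F, weight w T := by
      intro hcard
      refine ⟨F, _, isCore_noEdge P₁ P₂ F, hcard, ?_⟩
      have h1 := sum_hull_le hF hA hw subset_rfl fun T hT => hull_subset_range hF hT
      have h2 : weight (fun e : E × ℕ => w e.1) (Graph.noEdge (∅ : Set V) (E × ℕ)) = 0 := by
        simp [weight]
      have h3 := hd2 0 P₂.length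
      rw [h2, hP₂w]
      change _ ≤ P₂.distAlong w 0 P₂.length at h1
      linarith
    rcases Nat.lt_or_ge F.card m with hcard | hcard
    · refine empty ?_
      have h1 : (F.card : ℝ) ≤ m := by exact_mod_cast hcard.le
      have h2 : 4 / ε = 2 / ε + 2 / ε := by ring
      linarith
    obtain ⟨Ta, hTa, hTac, hTan⟩ := exists_cheap_low F (fun T => P₁.loPos (leaves T))
      (weight_nonneg hw) hm0 hcard
    obtain ⟨Tb, hTb, hTbc, hTbn⟩ := exists_cheap_low F
      -- The reversed key orders the trees from the far end of `P₁`.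
      (fun T => P₁.length - P₁.hiPos (leaves T)) (weight_nonneg hw) hm0 hcard
    set l := P₁.loPos (leaves Ta) with hl
    set r := P₁.hiPos (leaves Tb) with hr
    have hla := loPos_mem (hF.leaves Ta hTa).2.1
    have hrb := hiPos_mem (hF.leaves Tb hTb).2.1
    have hqa := hiPos_mem (hF.leaves Ta hTa).2.2
    have hqb := loPos_mem (hF.leaves Tb hTb).2.2
    let N := {T ∈ F | P₁.loPos (leaves T) < l ∨ r < P₁.hiPos (leaves T)}
    have hNF : N ⊆ F := Finset.filter_subset _ _
    have hNcard : (N.card : ℝ) ≤ 4 / ε := by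
      have h1 : N ⊆ {T ∈ F | P₁.loPos (leaves T) < l} ∪
          {T ∈ F | P₁.length - P₁.hiPos (leaves T) < P₁.length - r} := by
        intro T hT
        rw [Finset.mem_filter] at hT
        rw [Finset.mem_union, Finset.mem_filter, Finset.mem_filter]
        rcases hT.2 with h | h
        · exact Or.inl ⟨hT.1, h⟩
        · have := (hiPos_mem (hF.leaves T hT.1).2.1).1
          exact Or.inr ⟨hT.1, by omega⟩
      have h2 := (Finset.card_le_card h1).trans (Finset.card_union_le _ _)
      have h3 : N.card ≤ m + m := h2.trans (add_le_add hTan hTbn)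
      have h4 : (N.card : ℝ) ≤ m + m := by exact_mod_cast h3
      have h5 : 4 / ε = 2 / ε + 2 / ε := by ring
      linarith
    rcases Nat.lt_or_ge r l with hrl | hlr
    -- If `r < l`, every tree starts before `l` or ends after `r`, so `N = F` is small and no ring
    -- is needed.
    · refine empty ?_
      have : N = F := by
        refine Finset.filter_true_of_mem fun T hT => ?_
        have := loPos_le_hiPos (hF.leaves T hT).2.1
        omega
      rwa [this] at hNcard
    have hcover : ∀ T ∈ F, T ∉ N → leaves T ⊆ P₁.vertex '' Set.Icc l r ∪ P₂.verts := by
      intro T hT hTN x hx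
      rw [Finset.mem_filter, not_and, not_or] at hTN
      have := hTN hT
      rcases hF.leaves_subset hT hx with ⟨i, hi, rfl⟩ | h
      · have h1 := loPos_le hi hx
        have h2 := le_hiPos hi hx
        exact Or.inl ⟨i, ⟨by omega, by omega⟩, rfl⟩
      · exact Or.inr h
    -- If `l = r`, the order of `qb` and `qa` is not available. A path of `Ta` then serves in both
    -- directions, and the total is at most `5 w(P₂) + 4 ε w(F)`.
    rcases Nat.eq_or_lt_of_le hlr with heq | hlt
    · obtain ⟨Qa, hQa, hav⟩ := exists_leaf_path hF hw hTa hla.2 hqa.2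
      obtain ⟨C, hC, hCw⟩ := exists_ring_core hw le_rfl hla.1 hqa.1 hqa.1 Qa Qa hav hav hNF
        (by simpa only [← heq] using hcover)
      refine ⟨N, C, hC, hNcard, ?_⟩
      have h1 := sum_hull_le hF hA hw hNF fun T hT => hull_subset_range hF (hNF hT)
      change _ ≤ P₂.distAlong w 0 P₂.length at h1
      have h2 : P₁.distAlong w l l = 0 := by simp [distAlong]
      have h3 : P₂.distAlong w 0 (P₂.hiPos (leaves Ta)) +
          P₂.distAlong w (P₂.hiPos (leaves Ta)) P₂.length = P₂.distAlong w 0 P₂.length :=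
        Finset.sum_Ico_consecutive _ (Nat.zero_le _) hqa.1
      have h4 := cheap Ta hTac
      have h5 := hd2 0 P₂.length
      rw [hP₂w]
      linarith
    · set qa := P₂.hiPos (leaves Ta) with hqadef
      set qb := P₂.loPos (leaves Tb) with hqbdef
      obtain ⟨Qa, hQa, hava⟩ := exists_leaf_path hF hw hTa hla.2 hqa.2
      obtain ⟨Qb, hQb, havb⟩ := exists_leaf_path hF hw hTb hrb.2 hqb.2
      have hqq : qb ≤ qa := hF.loPos_le_hiPos_of_lt hA hTa hTb hlt
      obtain ⟨C, hC, hCw⟩ := exists_ring_core hw hlr hrb.1 hqa.1 hqb.1 Qa Qb hava havb hNF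
        hcover
      refine ⟨N, C, hC, hNcard, ?_⟩
      obtain ⟨p, -, -, hp⟩ := P₂.exists_walk_along hqq
      -- Shortness of `P₁` against the detour through `Qa`, the part of `P₂` between `qb` and `qa`,
      -- and `Qb`.
      have hseg : P₁.distAlong w l r ≤
          (1 + ε) * (Qa.weight w + P₂.distAlong w qb qa + Qb.weight w) := by
        have := distAlong_le_of_isShort hP₁ hw hε.le hlr hrb.1 le_rfl
          (Qa.append (p.reverse.append Qb.reverse))
        rw [Walk.weight_append, Walk.weight_append, Walk.weight_reverse, Walk.weight_reverse,
          hp] at this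
        linarith
      -- A tree before `Ta` on `P₁` meets `P₂` only from `qa` on, and a tree after `Tb` only up to
      -- `qb`. So hulls are charged only to the parts of `P₂` that do not pay for `P₁[l,r]`.
      have hS : ∀ T ∈ N, hull P₁ P₂ T ⊆ Finset.Ico 0 qb ∪ Finset.Ico qa P₂.length := by
        intro T hT j hj
        have hj1 := hull_subset_Ico P₁ P₂ T hj
        rw [Finset.mem_filter] at hT
        rw [Finset.mem_Ico] at hj1
        rw [Finset.mem_union, Finset.mem_Ico, Finset.mem_Ico]
        have hlo1 := loPos_mem (hF.leaves T hT.1).2.1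
        have hhi1 := hiPos_mem (hF.leaves T hT.1).2.1
        have hlo2 := loPos_mem (hF.leaves T hT.1).2.2
        have hhi2 := hiPos_mem (hF.leaves T hT.1).2.2
        rcases hT.2 with h | h
        · have := hF.hiPos_le_of_lt_loPos hA hI hTa hT.1 (by omega) hlo1.2 h hlo2.1 hlo2.2
          right
          omega
        · have := hF.le_loPos_of_hiPos_lt hA hI hTb hT.1 (by omega) hhi1.1 hhi1.2 h hhi2.1 hhi2.2
          left
          omega
      have h1 := sum_hull_le hF hA hw hNF hS
      rw [Finset.sum_union (by
        rw [Finset.disjoint_left]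
        intro j hj hj'
        rw [Finset.mem_Ico] at hj hj'
        omega)] at h1
      change _ ≤ P₂.distAlong w 0 qb + P₂.distAlong w qa P₂.length at h1
      have h2 : P₂.distAlong w 0 qb + P₂.distAlong w qb qa = P₂.distAlong w 0 qa :=
        Finset.sum_Ico_consecutive _ (Nat.zero_le _) hqq
      have h3 : P₂.distAlong w 0 qa + P₂.distAlong w qa P₂.length =
          P₂.distAlong w 0 P₂.length :=
        Finset.sum_Ico_consecutive _ (Nat.zero_le _) hqa.1
      have h4 := cheap Ta hTac
      have h5 := cheap Tb hTbc
      have h6 := hd2 0 qb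
      have h7 := hd2 qb qa
      have h8 := hd2 qa P₂.length
      have h9 := Qa.weight_nonneg hw
      have h10 := Qb.weight_nonneg hw
      rw [hP₂w]
      -- All of `P₂` counts twice; its middle part counts `2(1 + ε) ≤ 4` more times and its outer
      -- parts `2 + 1` more times, giving at most `6`. Each of `Qa` and `Qb` counts `2(2 + ε) ≤ 6`
      -- times and weighs at most `ε w(F)`, whence `12 ε`.
      nlinarith [mul_nonneg (sub_nonneg.2 hε1.le) h7, mul_nonneg (sub_nonneg.2 hε1.le) h9,
        mul_nonneg (sub_nonneg.2 hε1.le) h10]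
  -- Both paths are the same single edge, so all leaves are on `P₂`; the ring degenerates to `P₂`
  -- run back and forth.
  · have hv : ∀ i, P₁.vertex i = P₂.vertex i := fun i => by rw [vertex, vertex, hs]
    have hQ : ∃ Q : Walk G.toGraph (P₁.vertex 0) (P₂.vertex 0), Q.edges = [] := by
      rw [hv]
      exact ⟨Walk.nil _ (Set.mem_univ _), rfl⟩
    obtain ⟨Q, hQ⟩ := hQ
    have hav : ∀ z ∈ P₁.verts ∪ P₂.verts, z ≠ P₁.vertex 0 → z ≠ P₂.vertex 0 →
        ∀ e ∈ Q.edges, ¬ G.toGraph.Inc e z := by simp [hQ]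
    obtain ⟨C, hC, hCw⟩ := exists_ring_core (F := F) hw (Nat.le_refl 0) (Nat.zero_le _)
      (Nat.zero_le _) (Nat.zero_le _) Q Q hav hav (N := ∅) (Finset.empty_subset _) (by
        intro T hT _ x hx
        right
        rcases hF.leaves_subset hT hx with ⟨i, hi, rfl⟩ | h
        · exact ⟨i, by rw [hL2, ← hL1]; exact hi, (hv i).symm⟩
        · exact h)
    refine ⟨∅, C, hC, by simp; positivity, ?_⟩
    have h1 : P₁.distAlong w 0 0 = 0 := by simp [distAlong]
    have h2 : P₂.distAlong w 0 0 = 0 := by simp [distAlong]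
    have h3 : Q.weight w = 0 := by simp [Walk.weight, hQ]
    have h5 := hd2 0 P₂.length
    rw [h1, h2, h3] at hCw
    rw [hP₂w, Finset.sum_empty]
    linarith

end BrickForest

/-! ### Assembly -/

open BrickForest in
theorem mainTheorem8 :
    ∃ (g : ℝ → ℝ) (d : ℝ),
      (g =o[nhdsWithin 0 (Set.Ioi 0)] fun ε : ℝ => ε ^ (-(5 / 2) : ℝ)) ∧
      ∀ (V : Type u) (E : Type v) [Finite V] [Finite E] (G : PlaneGraph V E) (w : E → ℝ)
        (ε : ℝ) (o : E × Bool) (P₁ P₂ : G.BoundaryPath o) (F : Finset (Graph V E)),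
        (∀ e, 0 ≤ w e) →
        0 < ε → ε < 1 →
        P₁.IsShort w ε → P₂.IsShort w ε →
        P₁.verts ∩ P₂.verts ⊆ P₁.ends ∩ P₂.ends →
        (∀ T ∈ F, T ≤ G.toGraph ∧ IsTree T) →
        (∀ T ∈ F, ∀ T' ∈ F, T ≠ T' → G.NonCrossing T T') →
        (∀ T ∈ F,
          leaves T = joiningVertices T (P₁.verts ∪ P₂.verts) (P₁.edgs ∪ P₂.edgs) ∧
          (leaves T ∩ P₁.verts).Nonempty ∧ (leaves T ∩ P₂.verts).Nonempty) →
        ∃ (C : Graph V (E × ℕ)) (F' : Finset (Graph V (E × ℕ)))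
          (φ : Graph V E → Graph V (E × ℕ)),
          C ≤ copies G.toGraph ∧ E(C).Finite ∧
          (∀ T ∈ F', T ≤ copies G.toGraph ∧ IsTree T) ∧
          (∀ T ∈ F, φ T ∈ F' ∨ φ T = C) ∧
          (∀ T ∈ F, Spans (φ T) (leaves T)) ∧
          (∀ T ∈ F, ∀ T' ∈ F, T ≠ T' → (φ T ≠ C ∨ φ T' ≠ C) →
            Disjoint E(φ T) E(φ T')) ∧
          ((⋃ H ∈ insert C (F' : Set (Graph V (E × ℕ))),
              joiningVertices H (P₁.verts ∪ P₂.verts)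
                {e | e.1 ∈ P₁.edgs ∪ P₂.edgs}).ncard : ℝ) ≤ g ε ∧
          weight (fun e => w e.1) C + ∑ T ∈ F', weight (fun e => w e.1) T ≤
            6 * P₂.weight w + (1 + d * ε) * ∑ T ∈ F, weight w T ∧
          (∀ x ∈ V(C) ∩ (P₁.verts ∪ P₂.verts), ∀ y ∈ V(C) ∩ (P₁.verts ∪ P₂.verts),
            ThreeEdgeConnected C x y) ∧
          (∀ x y : Fin 3 → V,
            (∀ i, x i ∈ V(C) ∩ (P₁.verts ∪ P₂.verts)) →
            (∀ i, y i ∈ V(C) ∩ (P₁.verts ∪ P₂.verts)) →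
            HasThreeEdgeDisjointPaths C x y) := by
  classical
  -- `14 = 12 + 2`: the ring costs `12 ε w(F)` and the simplification of the trees `2 ε w(F)`.
  refine ⟨fun ε => 24 * ε ^ (-2 : ℝ), 14, ?_, ?_⟩
  · refine Asymptotics.IsLittleO.const_mul_left ?_ _
    rw [Asymptotics.isLittleO_iff_tendsto']
    · have h : Filter.Tendsto (fun ε : ℝ => ε ^ (1 / 2 : ℝ)) (nhdsWithin 0 (Set.Ioi 0))
          (nhds 0) := by
        have := (Real.continuousAt_rpow_const 0 (1 / 2) (Or.inr (by norm_num))).tendsto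
        rw [Real.zero_rpow (by norm_num)] at this
        exact this.mono_left nhdsWithin_le_nhds
      refine h.congr' ?_
      filter_upwards [self_mem_nhdsWithin] with ε hε
      rw [← Real.rpow_sub hε]
      norm_num
    · filter_upwards [self_mem_nhdsWithin] with ε hε h
      exact absurd h (Real.rpow_pos_of_pos hε _).ne'
  intro V E _ _ G w ε o P₁ P₂ F hw hε hε1 hP₁ hP₂ hI hF1 hF2 hF3
  have hF : IsBrickForest P₁ P₂ F := ⟨hF1, hF2, hF3⟩
  obtain ⟨N, C, hC, hNcard, hweight⟩ := exists_core hF hI hP₁ hw hε hε1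
  -- Copies numbered below `M` are reserved for `C`. The tree replacing `T` uses only copies `M + τ
  -- T`, which makes the images edge-disjoint.
  obtain ⟨M, hM⟩ : ∃ M : ℕ, ∀ e ∈ E(C), e.2 < M := by
    obtain ⟨M, hM⟩ := (hC.finite.image Prod.snd).bddAbove
    exact ⟨M + 1, fun e he => Nat.lt_succ_of_le (hM ⟨e, he, rfl⟩)⟩
  have hε' : 1 < 1 / ε := by rwa [one_lt_div hε]
  -- The lower bound on `2 ^ k` keeps the excess of the simplification small; the upper bound limits
  -- the joining vertices per tree.
  obtain ⟨k, hk1, hk2⟩ : ∃ k : ℕ, 1 / ε ≤ 2 ^ k ∧ (2 : ℝ) ^ k ≤ 2 / ε := by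
    obtain ⟨n, h1, h2⟩ := exists_nat_pow_near hε'.le (by norm_num : (1 : ℝ) < 2)
    refine ⟨n + 1, h2.le, ?_⟩
    rw [pow_succ, show 2 / ε = 1 / ε * 2 by ring]
    linarith
  have hk : 1 ≤ ε * (2 * (2 ^ k - 1) + 1) := by
    have h1 := mul_le_mul_of_nonneg_left hk1 hε.le
    rw [mul_one_div_cancel hε.ne'] at h1
    have h2 : (1 : ℝ) ≤ 2 ^ k := one_le_pow₀ (by norm_num)
    nlinarith
  obtain ⟨τ, hτ⟩ : ∃ τ : Graph V E → ℕ, Set.InjOn τ (F : Set (Graph V E)) := by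
    obtain ⟨f, hf⟩ := exists_injective_nat {T // T ∈ F}
    refine ⟨fun T => if h : T ∈ F then f ⟨T, h⟩ else 0, fun T hT T' hT' h => ?_⟩
    simp only [dif_pos (Finset.mem_coe.1 hT), dif_pos (Finset.mem_coe.1 hT')] at h
    exact congrArg Subtype.val (hf h)
  have hsimp : ∀ T : Graph V E, ∃ T' : Graph V (E × ℕ), T ∈ F →
      T' ≤ copies G.toGraph ∧ IsTree T' ∧ Spans T' (leaves T) ∧
      (∀ e ∈ E(T'), e.2 = M + τ T) ∧
      weight (fun e => w e.1) T' ≤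
        (1 + 2 * ε) * weight w T + ∑ j ∈ hull P₁ P₂ T, w (P₂.edge j) ∧
      (joiningVertices T' (P₁.verts ∪ P₂.verts) {e | e.1 ∈ P₁.edgs ∪ P₂.edgs}).ncard ≤
        2 ^ k + 3 := by
    intro T
    by_cases hT : T ∈ F
    · obtain ⟨T', h1, h2⟩ := exists_simplified_tree hF hP₁ hP₂ hw hε.le hk hT (M + τ T)
      exact ⟨T', fun _ => ⟨h1, h2⟩⟩
    · exact ⟨C, fun h => absurd h hT⟩
  choose ψ hψ using hsimp
  have hCD : ∀ T ∈ F, Disjoint E(ψ T) E(C) := by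
    intro T hT
    rw [Set.disjoint_left]
    intro e he he'
    have h1 := (hψ T hT).2.2.2.1 e he
    have h2 := hM e he'
    omega
  refine ⟨C, N.image ψ, fun T => if T ∈ N then ψ T else C, hC.le_copies, hC.finite, ?_, ?_, ?_, ?_,
    ?_, ?_, ?_, ?_⟩
  · intro T' hT'
    obtain ⟨T, hT, rfl⟩ := Finset.mem_image.1 hT'
    have := hψ T (hC.subset hT)
    exact ⟨this.1, this.2.1⟩
  · intro T hT
    by_cases hTN : T ∈ N
    · exact Or.inl (by simpa only [if_pos hTN] using Finset.mem_image_of_mem ψ hTN)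
    · exact Or.inr (if_neg hTN)
  · intro T hT
    by_cases hTN : T ∈ N
    · simpa only [if_pos hTN] using (hψ T hT).2.2.1
    · simpa only [if_neg hTN] using hC.spans T hT hTN
  · intro T hT T' hT' hne hor
    by_cases hTN : T ∈ N <;> by_cases hTN' : T' ∈ N
    · simp only [if_pos hTN, if_pos hTN']
      rw [Set.disjoint_left]
      intro e he he'
      have h1 := (hψ T hT).2.2.2.1 e he
      have h2 := (hψ T' hT').2.2.2.1 e he'
      exact hne (hτ hT hT' (by omega))
    · simp only [if_pos hTN, if_neg hTN']
      exact hCD T hT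
    · simp only [if_neg hTN, if_pos hTN']
      exact (hCD T' hT').symm
    · simp only [if_neg hTN, if_neg hTN'] at hor
      exact absurd rfl (hor.elim id id)
  · have hcount : (⋃ H ∈ insert C ((N.image ψ : Finset _) : Set (Graph V (E × ℕ))),
        joiningVertices H (P₁.verts ∪ P₂.verts) {e | e.1 ∈ P₁.edgs ∪ P₂.edgs}).ncard ≤
        4 + N.card * (2 ^ k + 3) := by
      rw [Set.biUnion_insert, Finset.coe_image, Set.biUnion_image]
      refine (Set.ncard_union_le _ _).trans (add_le_add hC.joining ?_)
      have := Finset.set_ncard_biUnion_le N fun T =>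
        joiningVertices (ψ T) (P₁.verts ∪ P₂.verts) {e | e.1 ∈ P₁.edgs ∪ P₂.edgs}
      refine this.trans ?_
      refine (Finset.sum_le_card_nsmul _ _ (2 ^ k + 3) fun T hT => ?_).trans_eq (by simp)
      exact (hψ T (hC.subset hT)).2.2.2.2.2
    have hcount' : ((⋃ H ∈ insert C ((N.image ψ : Finset _) : Set (Graph V (E × ℕ))),
        joiningVertices H (P₁.verts ∪ P₂.verts) {e | e.1 ∈ P₁.edgs ∪ P₂.edgs}).ncard : ℝ) ≤
        4 + N.card * (2 ^ k + 3) := by exact_mod_cast hcount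
    refine hcount'.trans ?_
    have hpow : ε ^ (-2 : ℝ) = (1 / ε) ^ 2 := by
      rw [Real.rpow_neg hε.le, one_div, inv_pow]
      norm_cast
    change _ ≤ 24 * ε ^ (-2 : ℝ)
    rw [hpow]
    have h4 : 4 / ε = 4 * (1 / ε) := by ring
    have h2 : 2 / ε = 2 * (1 / ε) := by ring
    rw [h4] at hNcard
    rw [h2] at hk2
    have h0 : (0 : ℝ) ≤ 2 ^ k + 3 := by positivity
    calc (4 : ℝ) + N.card * (2 ^ k + 3)
        ≤ 4 + 4 * (1 / ε) * (2 * (1 / ε) + 3) := by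
          have h5 := mul_le_mul_of_nonneg_right hNcard h0
          have h6 := mul_le_mul_of_nonneg_left (add_le_add_left hk2 3)
            (show 0 ≤ 4 * (1 / ε) by linarith)
          linarith
      -- With `x = 1 / ε > 1`, the terms `4 + 12 x + 8 x ^ 2` are at most `24 x ^ 2`.
      _ ≤ 24 * (1 / ε) ^ 2 := by nlinarith
  · have h1 : ∑ T ∈ N.image ψ, weight (fun e => w e.1) T ≤
        ∑ T ∈ N, weight (fun e => w e.1) (ψ T) :=
      Finset.sum_image_le_of_nonneg fun T _ => weight_nonneg (fun e => hw e.1) T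
    have h2 : ∑ T ∈ N, weight (fun e => w e.1) (ψ T) ≤
        (1 + 2 * ε) * ∑ T ∈ N, weight w T + ∑ T ∈ N, ∑ j ∈ hull P₁ P₂ T, w (P₂.edge j) := by
      rw [Finset.mul_sum, ← Finset.sum_add_distrib]
      exact Finset.sum_le_sum fun T hT => (hψ T (hC.subset hT)).2.2.2.2.1
    have h3 : ∑ T ∈ N, weight w T ≤ ∑ T ∈ F, weight w T :=
      Finset.sum_le_sum_of_subset_of_nonneg hC.subset fun T _ _ => weight_nonneg hw T
    have h4 := mul_le_mul_of_nonneg_left h3 (show 0 ≤ 1 + 2 * ε by linarith)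
    linarith
  · exact fun x hx y hy => hC.linked _ _ (fun _ => hx.1) fun _ => hy.1
  · exact fun x y hx hy => hC.linked x y (fun i => (hx i).1) fun i => (hy i).1
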